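/- **Setting.** Let $\kappa>0$, $1<\gamma<3$, $\theta=\frac{\gamma-1}{2}$, $a=\frac{2\sqrt{\gamma\kappa}}{\gamma-1}$, $\lambda=\frac1{\gamma-1}-\frac12$, and consider $d$ pipes with cross-sections $A_1,\dots,A_d>0$. States are pairs $(\rho,u)$ in $D=\{(\rho,u):\rho>0\text{ or }\rho=u=0\}$, with Riemann invariants $\omega_1=u-a\rho^\theta$, $\omega_2=u+a\rho^\theta$ and characteristic speeds $\lambda_1=u-\sqrt{\kappa\gamma}\,\rho^\theta$, $\lambda_2=u+\sqrt{\kappa\gamma}\,\rho^\theta$. In each pipe $x>0$ the gas satisfies $$\partial_t\rho_k+\partial_x(\rho_ku_k)=0,\qquad \partial_t(\rho_ku_k)+\partial_x(\rho_ku_k^2+\kappa\rho_k^\gamma)=0 .$$ For convex $S:\mathbb R\to\mathbb R$ put $\eta_S(\rho,u)=\int_{\mathbb R}\chi(\rho,v-u)S(v)\,dv$ and $G_S(\rho,u)=\int_{\mathbb R}[(1-\theta)u+\theta v]\,\chi(\rho,v-u)S(v)\,dv$, where $\chi(\rho,\xi)=c\,(a^2\rho^{\gamma-1}-\xi^2)_+^\lambda$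 and $c>0$ is the constant with $\int\chi(\rho,\xi)\,d\xi=\rho$. A *weak entropy solution* on $(0,T)\times(0,\infty)$ is a measurable $D$-valued $(\rho,u)$ with $\rho,u\in L^\infty((0,\tau)\times(0,\infty))$ for every finite $\tau<T$ that satisfies the two equations, and $\partial_t\eta_S+\partial_xG_S\le0$ for every convex $S$, in the sense of distributions on $(0,T)\times(0,\infty)$. The *Lax solution* of the Riemann problem with left state $l\in D$ and right state $r\in D$ is the self-similar solution $w(x/t)$ composed of a 1-wave from $l$ to a middle state and a 2-wave from the middle state to $r$, each wave being a rarefaction or a Lax shock. If $l$ or $r$ is vacuum, or $\omega_2(l)\le\omega_1(r)$, it is composed of the 1-rarefaction from $l$ to vacuum, vacuum, and the 2-rarefaction from vacuum to $r$ (the fan of a vacuum state being absent). For $b\in D$ let $\mathcal V(b)\subset D$ be the set of values $w(0+)$ of all Lax solutions with left state $b$. Boundary values $(\bar\rho_k,\bar u_k)(t)=(\rho_k,u_k)(t,0+)\in D$ are right limits of the conserved quantities $(\rho_k,\rho_ku_k)(t,x)$ as $x\to0+$ (essential limits); limits as $t\to0+$ at fixed $x$ are understood in the same way. *Generalized Riemann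 problem.* Given constant states $(\hat\rho_k,\hat u_k)\in D$, functions $(\rho_k,u_k)$ on $(0,\infty)^2$ are a solution if $(\rho_k,u_k)(0+,x)=(\hat\rho_k,\hat u_k)$ for all $x>0$ and all $k$; there is $\rho_*\ge0$ such that for every $k$, $(\rho_k,u_k)$ agrees a.e. on $\{t,x>0\}$ with the Lax solution for the left state $(\rho_*,0)$ and the right state $(\hat\rho_k,\hat u_k)$; and, for a.e. $t>0$, the boundary values exist and $\sum_kA_k\bar\rho_k\bar u_k=0$. *Generalized Cauchy problem.* Let $T\in(0,\infty]$, let $U^0_k\in\mathbb R^2$ be constants and $(\hat\rho_k,\hat u_k)$ be a.e. $D$-valued with $(\hat\rho_k,\hat\rho_k\hat u_k)\in U^0_k+L^1(0,\infty)$. Functions $(\rho_k,u_k)$ are a solution on $[0,T]$ ($[0,\infty)$ if $T=\infty$) if they are weak entropy solutions on $(0,T)\times(0,\infty)$; $t\mapsto(\rho_k,\rho_ku_k)(t,\cdot)$ is continuous on $[0,T]$ with values in $U^0_k+L^1(0,\infty)$; $(\rho_k,u_k)(0,\cdot)=(\hat\rho_k,\hat u_k)$ a.e.; and, for a.e. $t\in(0,T)$,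 the boundary values exist, there is $\rho_*(t)\ge0$ with $(\bar\rho_k,\bar u_k)(t)\in\mathcal V((\rho_*(t),0))$ for all $k$, and $\sum_kA_k\bar\rho_k\bar u_k=0$. **Corollary (maximum principle).** Let $\omega_M\in\mathbb R$ and let $(\rho_k,u_k)_{k=1}^d$ be a solution of the generalized Riemann problem (put $T=\infty$) or of the generalized Cauchy problem on $[0,T]$, with initial data $(\hat\rho_k,\hat u_k)$ such that $$-\omega_M\le\omega_1(\hat\rho_k,\hat u_k)(x)<\omega_2(\hat\rho_k,\hat u_k)(x)\le\omega_M\qquad\text{for a.e. }x>0,\ k=1,\dots,d.$$ Then $$-\omega_M\le\omega_1(\rho_k,u_k)(t,x)\le\omega_2(\rho_k,u_k)(t,x)\le\omega_M\qquad\text{for a.e. }t\in(0,T),\ x>0,\ k=1,\dots,d,$$ and the middle inequality is strict wherever $(\rho_k,u_k)(t,x)$ is not the vacuum state $(0,0)$. -/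

import Mathlib

open MeasureTheory Filter Topology
open scoped ContDiff

noncomputable section

namespace IsentropicNetwork

/-! A state is a pair `s = (ρ, u)` of density and velocity. -/

/-- The state space: positive density, or vacuum (density and velocity both zero). -/
def stateSpace : Set (ℝ × ℝ) := {s | 0 < s.1 ∨ (s.1 = 0 ∧ s.2 = 0)}

/-- The conserved quantities `(ρ, ρ u)` of the state `(ρ, u)`. -/
def conserved (s : ℝ × ℝ) : ℝ × ℝ := (s.1, s.1 * s.2)

def theta (γ : ℝ) : ℝ := (γ - 1) / 2

/-- The exponent `λ = 1 / (γ - 1) - 1 / 2`. -/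
def lam (γ : ℝ) : ℝ := 1 / (γ - 1) - 1 / 2

def aConst (κ γ : ℝ) : ℝ := 2 * Real.sqrt (γ * κ) / (γ - 1)

def jConst (γ : ℝ) : ℝ := ∫ z in (-1 : ℝ)..1, (1 - z ^ 2) ^ lam γ

/-- The normalisation for which `∫ χ(ρ, ξ) dξ = ρ`. -/
def cConst (κ γ : ℝ) : ℝ := aConst κ γ ^ (-(2 / (γ - 1))) / jConst γ

/-- The kernel `χ(ρ, ξ) = c (a² ρ^(γ - 1) - ξ²)₊^λ`. -/
def chi (κ γ ρ ξ : ℝ) : ℝ :=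
  cConst κ γ * (max (aConst κ γ ^ 2 * ρ ^ (γ - 1) - ξ ^ 2) 0) ^ lam γ

/-- The weak entropy `η_S`. -/
def eta (κ γ : ℝ) (S : ℝ → ℝ) (s : ℝ × ℝ) : ℝ :=
  ∫ v : ℝ, chi κ γ s.1 (v - s.2) * S v

/-- The flux `G_S` of the weak entropy `η_S`. -/
def entropyFlux (κ γ : ℝ) (S : ℝ → ℝ) (s : ℝ × ℝ) : ℝ :=
  ∫ v : ℝ, ((1 - theta γ) * s.2 + theta γ * v) * chi κ γ s.1 (v - s.2) * S v

/-- The first Riemann invariant. -/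
def omega1 (κ γ : ℝ) (s : ℝ × ℝ) : ℝ := s.2 - aConst κ γ * s.1 ^ theta γ

/-- The second Riemann invariant. -/
def omega2 (κ γ : ℝ) (s : ℝ × ℝ) : ℝ := s.2 + aConst κ γ * s.1 ^ theta γ

/-- The first eigenvalue. -/
def lambda1 (κ γ : ℝ) (s : ℝ × ℝ) : ℝ := s.2 - Real.sqrt (κ * γ) * s.1 ^ theta γ

/-- The second eigenvalue. -/
def lambda2 (κ γ : ℝ) (s : ℝ × ℝ) : ℝ := s.2 + Real.sqrt (κ * γ) * s.1 ^ theta γ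

/-! ### The Riemann problem in the sense of Lax -/

/-- The velocity jump across a shock between the densities `ρ₀` and `ρ`. -/
def shockJump (κ γ ρ₀ ρ : ℝ) : ℝ :=
  Real.sqrt (κ * (ρ ^ γ - ρ₀ ^ γ) * (ρ - ρ₀) / (ρ * ρ₀))

/-- The forward 1-wave curve through `s₀` (rarefactions and shocks), away from vacuum. -/
def waveCurve1 (κ γ : ℝ) (s₀ : ℝ × ℝ) : Set (ℝ × ℝ) :=
  {s | 0 < s₀.1 ∧ 0 < s.1 ∧
    ((s.1 ≤ s₀.1 ∧
        s.2 = s₀.2 + aConst κ γ * s₀.1 ^ theta γ - aConst κ γ * s.1 ^ theta γ) ∨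
      (s₀.1 < s.1 ∧ s.2 = s₀.2 - shockJump κ γ s₀.1 s.1))}

/-- The forward 2-wave curve through `s₀` (rarefactions and shocks), away from vacuum. -/
def waveCurve2 (κ γ : ℝ) (s₀ : ℝ × ℝ) : Set (ℝ × ℝ) :=
  {s | 0 < s₀.1 ∧ 0 < s.1 ∧
    ((s₀.1 ≤ s.1 ∧
        s.2 = s₀.2 - aConst κ γ * s₀.1 ^ theta γ + aConst κ γ * s.1 ^ theta γ) ∨
      (s.1 < s₀.1 ∧ s.2 = s₀.2 - shockJump κ γ s₀.1 s.1))}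

/-- The Rankine-Hugoniot speed of a shock between two states of different density. -/
def shockSpeed (l r : ℝ × ℝ) : ℝ := (r.1 * r.2 - l.1 * l.2) / (r.1 - l.1)

/-- The state of the 1-rarefaction fan of `l` on the ray `x / t = ξ`: the solution of
`ω₂ = ω₂(l)`, `λ₁ = ξ`. -/
def fan1 (κ γ : ℝ) (l : ℝ × ℝ) (ξ : ℝ) : ℝ × ℝ :=
  let y := (omega2 κ γ l - ξ) / (aConst κ γ + Real.sqrt (κ * γ))
  (y ^ (1 / theta γ), ξ + Real.sqrt (κ * γ) * y)

/-- The state of the 2-rarefaction fan of `r` on the ray `x / t = ξ`: the solution of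
`ω₁ = ω₁(r)`, `λ₂ = ξ`. -/
def fan2 (κ γ : ℝ) (r : ℝ × ℝ) (ξ : ℝ) : ℝ × ℝ :=
  let y := (ξ - omega1 κ γ r) / (aConst κ γ + Real.sqrt (κ * γ))
  (y ^ (1 / theta γ), ξ - Real.sqrt (κ * γ) * y)

open Classical in
/-- The 1-wave with left state `l` and right state `m`, for `m` on the 1-wave curve of `l`. -/
def wave1 (κ γ : ℝ) (l m : ℝ × ℝ) (ξ : ℝ) : ℝ × ℝ :=
  if m.1 ≤ l.1 then
    if ξ ≤ lambda1 κ γ l then l else if ξ < lambda1 κ γ m then fan1 κ γ l ξ else m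
  else if ξ < shockSpeed l m then l else m

open Classical in
/-- The 2-wave with left state `m` and right state `r`, for `r` on the 2-wave curve of `m`. -/
def wave2 (κ γ : ℝ) (m r : ℝ × ℝ) (ξ : ℝ) : ℝ × ℝ :=
  if m.1 ≤ r.1 then
    if ξ ≤ lambda2 κ γ m then m else if ξ < lambda2 κ γ r then fan2 κ γ r ξ else r
  else if ξ < shockSpeed m r then m else r

open Classical in
/-- The solution with vacuum between the 1-rarefaction fan of `l` and the 2-rarefaction fan
of `r`; the fan of a vacuum state is absent. -/
def vacuumFans (κ γ : ℝ) (l r : ℝ × ℝ) (ξ : ℝ) : ℝ × ℝ :=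
  if 0 < l.1 ∧ ξ < omega2 κ γ l then
    if ξ ≤ lambda1 κ γ l then l else fan1 κ γ l ξ
  else if 0 < r.1 ∧ omega1 κ γ r < ξ then
    if ξ < lambda2 κ γ r then fan2 κ γ r ξ else r
  else (0, 0)

open Classical in
/-- `w` is the profile, as a function of `ξ = x / t`, of the self-similar Lax solution of the
Riemann problem with left state `l` and right state `r`. Either a middle state `m` of positive
density is joined to `l` by a 1-wave, which is slower than `u(m)`, and to `r` by a 2-wave,
which is faster than `u(m)`, or the solution contains vacuum. -/
def IsLaxProfile (κ γ : ℝ) (l r : ℝ × ℝ) (w : ℝ → ℝ × ℝ) : Prop :=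
  (∃ m : ℝ × ℝ, m ∈ waveCurve1 κ γ l ∧ r ∈ waveCurve2 κ γ m ∧
      ∀ ξ : ℝ, w ξ = if ξ < m.2 then wave1 κ γ l m ξ else wave2 κ γ m r ξ) ∨
    ((l.1 = 0 ∨ r.1 = 0 ∨ omega2 κ γ l ≤ omega1 κ γ r) ∧
      ∀ ξ : ℝ, w ξ = vacuumFans κ γ l r ξ)

/-- The boundary Riemann set `𝒱(b)`: the values at `x / t = 0+` of the Lax solutions of
Riemann problems with left state `b`. -/
def boundaryRiemannSet (κ γ : ℝ) (b : ℝ × ℝ) : Set (ℝ × ℝ) :=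
  {s | s ∈ stateSpace ∧ ∃ r ∈ stateSpace, ∃ w : ℝ → ℝ × ℝ,
    IsLaxProfile κ γ b r w ∧ Tendsto w (𝓝[>] 0) (𝓝 s)}

/-! ### One-sided traces and weak entropy solutions -/

/-- `s` is the state with `conserved s = conserved (f (0+))`, the right limit at `0` being an
essential limit (null sets are disregarded). -/
def IsRightTrace (f : ℝ → ℝ × ℝ) (s : ℝ × ℝ) : Prop :=
  s ∈ stateSpace ∧
    Tendsto (fun y => conserved (f y)) (𝓝[>] 0 ⊓ ae volume) (𝓝 (conserved s))

/-- The times `0 < t < T`, where `T` may be infinite. -/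
def openTimes (T : EReal) : Set ℝ := {t | 0 < t ∧ (t : EReal) < T}

/-- The times `0 ≤ t ≤ T`; all `t ≥ 0` if `T` is infinite. -/
def closedTimes (T : EReal) : Set ℝ := {t | 0 ≤ t ∧ (t : EReal) ≤ T}

/-- The domain `(0, T) × (0, ∞)` of points `(t, x)`. -/
def pipe (T : EReal) : Set (ℝ × ℝ) := openTimes T ×ˢ Set.Ioi 0

/-- Test functions on `(0, T) × (0, ∞)`. -/
def IsTest (T : EReal) (φ : ℝ × ℝ → ℝ) : Prop :=
  ContDiff ℝ ∞ φ ∧ HasCompactSupport φ ∧ tsupport φ ⊆ pipe T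

def dt (φ : ℝ × ℝ → ℝ) (z : ℝ × ℝ) : ℝ := fderiv ℝ φ z (1, 0)

def dx (φ : ℝ × ℝ → ℝ) (z : ℝ × ℝ) : ℝ := fderiv ℝ φ z (0, 1)

/-- Weak entropy solutions of the isentropic gas equations on `(0, T) × (0, ∞)`: measurable,
with density and velocity in `L^∞((0, τ) × (0, ∞))` for all finite `τ < T`, satisfying the
equations and the entropy inequalities for all convex `S` in the sense of distributions. -/
structure IsWeakEntropySolution (κ γ : ℝ) (T : EReal) (s : ℝ → ℝ → ℝ × ℝ) : Prop where
  measurable : AEStronglyMeasurable (fun z : ℝ × ℝ => s z.1 z.2) (volume.restrict (pipe T))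
  mem_stateSpace : ∀ᵐ z ∂(volume.restrict (pipe T)), s z.1 z.2 ∈ stateSpace
  bounded : ∀ τ : ℝ, (τ : EReal) < T → ∃ C : ℝ,
    ∀ᵐ z ∂(volume.restrict (pipe τ)), |(s z.1 z.2).1| ≤ C ∧ |(s z.1 z.2).2| ≤ C
  mass : ∀ φ, IsTest T φ →
    ∫ z in pipe T, ((s z.1 z.2).1 * dt φ z + (s z.1 z.2).1 * (s z.1 z.2).2 * dx φ z) = 0
  momentum : ∀ φ, IsTest T φ →
    ∫ z in pipe T, ((s z.1 z.2).1 * (s z.1 z.2).2 * dt φ z +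
      ((s z.1 z.2).1 * (s z.1 z.2).2 ^ 2 + κ * (s z.1 z.2).1 ^ γ) * dx φ z) = 0
  entropy : ∀ S : ℝ → ℝ, ConvexOn ℝ Set.univ S → ∀ φ, IsTest T φ → (∀ z, 0 ≤ φ z) →
    0 ≤ ∫ z in pipe T, (eta κ γ S (s z.1 z.2) * dt φ z +
      entropyFlux κ γ S (s z.1 z.2) * dx φ z)

/-! ### The coupled problems; `A k` is the cross-section of the pipe `k` -/

/-- Weak solutions `s k t x` of the generalized Riemann problem with initial states `i k`. -/
structure IsRiemannSolution (κ γ : ℝ) {d : ℕ} (A : Fin d → ℝ) (i : Fin d → ℝ × ℝ)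
    (s : Fin d → ℝ → ℝ → ℝ × ℝ) : Prop where
  initial_mem : ∀ k, i k ∈ stateSpace
  initial : ∀ k, ∀ x > 0, IsRightTrace (fun t => s k t x) (i k)
  lax : ∃ ρstar : ℝ, 0 ≤ ρstar ∧ ∀ k, ∃ w : ℝ → ℝ × ℝ, IsLaxProfile κ γ (ρstar, 0) (i k) w ∧
    ∀ᵐ z ∂(volume.restrict (pipe ⊤)), s k z.1 z.2 = w (z.2 / z.1)
  mass_junction : ∀ᵐ t ∂(volume.restrict (Set.Ioi (0 : ℝ))), ∃ b : Fin d → ℝ × ℝ,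
    (∀ k, IsRightTrace (s k t) (b k)) ∧ ∑ k, A k * ((b k).1 * (b k).2) = 0

/-- Weak solutions `s k t x` of the generalized Cauchy problem on `[0, T]` with initial data
`i k x`. Here `U₀ k` is a constant pair of conserved quantities, and
`t ↦ conserved (s k t ·)` is a continuous function with values in `U₀ k + L¹(0, ∞)`. -/
structure IsCauchySolution (κ γ : ℝ) {d : ℕ} (A : Fin d → ℝ) (T : EReal)
    (U₀ : Fin d → ℝ × ℝ) (i : Fin d → ℝ → ℝ × ℝ) (s : Fin d → ℝ → ℝ → ℝ × ℝ) : Prop where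
  initial_mem : ∀ k, ∀ᵐ x ∂(volume.restrict (Set.Ioi (0 : ℝ))), i k x ∈ stateSpace
  initial_integrable : ∀ k,
    Integrable (fun x => conserved (i k x) - U₀ k) (volume.restrict (Set.Ioi 0))
  integrable : ∀ k, ∀ t ∈ closedTimes T,
    Integrable (fun x => conserved (s k t x) - U₀ k) (volume.restrict (Set.Ioi 0))
  continuous : ∀ k, ∀ t₀ ∈ closedTimes T,
    Tendsto (fun t => ∫ x in Set.Ioi 0, ‖conserved (s k t x) - conserved (s k t₀ x)‖)
      (𝓝[closedTimes T] t₀) (𝓝 0)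
  solution : ∀ k, IsWeakEntropySolution κ γ T (s k)
  initial : ∀ k, ∀ᵐ x ∂(volume.restrict (Set.Ioi (0 : ℝ))), s k 0 x = i k x
  junction : ∀ᵐ t ∂(volume.restrict (openTimes T)), ∃ b : Fin d → ℝ × ℝ,
    (∀ k, IsRightTrace (s k t) (b k)) ∧
    (∃ ρstar : ℝ, 0 ≤ ρstar ∧ ∀ k, b k ∈ boundaryRiemannSet κ γ (ρstar, 0)) ∧
    ∑ k, A k * ((b k).1 * (b k).2) = 0

end IsentropicNetwork

end

namespace IsentropicNetwork

/-! ### Constants -/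

section Constants

variable {κ γ : ℝ}

/-! For the Cauchy problem a single entropy suffices: the one generated by `S = trunc M p`, that is
`S(v) = (|v| - M)₊ ^ p` with `M = ω_M` and `p` large. The kernel `χ` lives on the interval between
the two Riemann invariants, so `η_S ≥ 0`, and `η_S` vanishes at a state exactly when both invariants
lie in `[-M, M]`. The goal is therefore `η_S = 0` a.e. The entropy inequality is tested with a
weight that decreases along every signal of admissible speed
(`IsWeakEntropySolution.integral_testFn_le`). This bounds a weighted integral of `η_S` by an initial
term, which is zero by assumption on the data, and by the entropy entering through the junction, `∑
A_k G_S(b_k)` for the boundary values `b_k`.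

The heart of the matter is that this last sum is nonpositive. With `W = a ρ_*^θ` one shows `G_S(b) ≤
c(W) ρ u` for every boundary value `b = (ρ, u)` admissible for the junction state `(ρ_*, 0)`
(`IsBoundaryState.meanFlux_le`). The factor `c(W)` is common to all pipes, so summation and
conservation of mass give the claim. The choice of `c(W)`, called `fluxRatio`, is forced: it is the
derivative of `G_S / ρ` in `u` at `u = 0` and half-width `W`, and the mass flux may have either sign
nearby.

Boundary values fall into three classes (`IsLaxProfile.exists_trace`). For subsonic inflow the
kernel is at least as wide as that of the junction state, and the convexity of `S` and of `S'` on
the positive half-line gives the bound. For supersonic inflow the extreme velocity exceeds `W` by a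
fixed factor `1 + θ²/(2γ)` (for shocks this is `supersonic_of_shock`), and a large power `p` wins.
For outflow `ω₂ = W`; an affine substitution compares the two kernels, and its loss `(A/W)^(λ+1)`,
with `A` the half-width at the boundary value, is again compensated by a large `p`
(`trunc_outgoing`).

The Riemann problem needs no entropy. By conservation of mass some pipe has nonpositive mass flux,
which forces `W = 0` or `W ≤ -ω₁` of its initial state, hence `W ≤ ω_M`. All waves of positive speed
then stay within the bounds (`IsLaxProfile.inBounds`). -/

lemma theta_pos (h₁ : 1 < γ) : 0 < theta γ := by unfold theta; linarith

lemma theta_lt_one (h₃ : γ < 3) : theta γ < 1 := by unfold theta; linarith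

lemma lam_pos (h₁ : 1 < γ) (h₃ : γ < 3) : 0 < lam γ := by
  unfold lam
  have : 1 / 2 < 1 / (γ - 1) := one_div_lt_one_div_of_lt (by linarith) (by linarith)
  linarith

/-- This exponent identity makes the kernel self-similar: height times width scales like `width ^
(2λ + 1)`, which is proportional to `ρ`. -/
lemma two_lam_add_one (h₁ : 1 < γ) : 2 * lam γ + 1 = 1 / theta γ := by
  unfold lam theta
  have : γ - 1 ≠ 0 := by linarith
  field_simp
  ring

lemma theta_mul_two_lam_add_one (h₁ : 1 < γ) : theta γ * (2 * lam γ + 1) = 1 := by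
  rw [two_lam_add_one h₁, mul_one_div_cancel (theta_pos h₁).ne']

lemma aConst_pos (hκ : 0 < κ) (h₁ : 1 < γ) : 0 < aConst κ γ := by
  unfold aConst
  have : 0 < Real.sqrt (γ * κ) := Real.sqrt_pos.2 (by positivity)
  have : 0 < γ - 1 := by linarith
  positivity

/-- The sound speed is thus `θ` times the half-width of the kernel, so that sonic conditions and
Riemann invariants can be compared linearly. -/
lemma sqrt_eq (h₁ : 1 < γ) : Real.sqrt (κ * γ) = theta γ * aConst κ γ := by
  unfold theta aConst
  have : γ - 1 ≠ 0 := by linarith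
  rw [mul_comm κ γ]
  field_simp

lemma theta_mul_aConst_sq (hκ : 0 < κ) (h₁ : 1 < γ) :
    (theta γ * aConst κ γ) ^ 2 = κ * γ := by
  rw [← sqrt_eq h₁, Real.sq_sqrt (by positivity)]

end Constants

/-! ### The truncated power entropies -/

/-- The even convex function `(|v| - M)₊ ^ p`. -/
noncomputable def trunc (M : ℝ) (p : ℕ) (v : ℝ) : ℝ := (max (|v| - M) 0) ^ p

/-- The derivative of `trunc M p` on the positive half-line. -/
noncomputable def truncDeriv (M : ℝ) (p : ℕ) (v : ℝ) : ℝ := p * (max (v - M) 0) ^ (p - 1)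

section Trunc

variable {M : ℝ} {p : ℕ}

lemma trunc_nonneg (v : ℝ) : 0 ≤ trunc M p v := by unfold trunc; positivity

lemma truncDeriv_nonneg (v : ℝ) : 0 ≤ truncDeriv M p v := by unfold truncDeriv; positivity

lemma continuous_trunc : Continuous (trunc M p) := by unfold trunc; fun_prop

lemma continuous_truncDeriv : Continuous (truncDeriv M p) := by unfold truncDeriv; fun_prop

lemma trunc_neg (v : ℝ) : trunc M p (-v) = trunc M p v := by simp [trunc]

lemma trunc_sub_comm (v w : ℝ) : trunc M p (v - w) = trunc M p (w - v) := by
  simp [trunc, abs_sub_comm]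

lemma trunc_le_of_abs_le {v w : ℝ} (h : |v| ≤ |w|) : trunc M p v ≤ trunc M p w := by
  unfold trunc; gcongr

lemma truncDeriv_mono {v w : ℝ} (h : v ≤ w) : truncDeriv M p v ≤ truncDeriv M p w := by
  unfold truncDeriv; gcongr

lemma trunc_eq_zero (hp : p ≠ 0) {v : ℝ} (h : |v| ≤ M) : trunc M p v = 0 := by
  unfold trunc; rw [max_eq_right (by linarith), zero_pow hp]

lemma abs_le_of_trunc_eq_zero {v : ℝ} (h : trunc M p v = 0) : |v| ≤ M := by
  have h1 := eq_zero_of_pow_eq_zero h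
  linarith [le_max_left (|v| - M) 0]

lemma convexOn_trunc : ConvexOn ℝ Set.univ (trunc M p) := by
  have h1 : ConvexOn ℝ Set.univ (fun v : ℝ => |v|) := convexOn_univ_norm
  have h2 : ConvexOn ℝ Set.univ (fun v : ℝ => |v| - M) := by
    exact h1.add_const (-M)
  have h3 : ConvexOn ℝ Set.univ (fun v : ℝ => max (|v| - M) 0) :=
    h2.sup (convexOn_const 0 convex_univ)
  exact h3.pow (fun _ _ => le_max_right _ _) p

lemma two_mul_pow_le {x y : ℝ} (hy : 0 ≤ y) (hyx : y ≤ x) (p : ℕ) :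
    2 * x ^ p ≤ (x + y) ^ p + (x - y) ^ p := by
  have hx : x + y ∈ Set.Ici (0 : ℝ) := by rw [Set.mem_Ici]; linarith
  have hx' : x - y ∈ Set.Ici (0 : ℝ) := by rw [Set.mem_Ici]; linarith
  have := (convexOn_pow (𝕜 := ℝ) p).2 hx hx' (by norm_num : (0 : ℝ) ≤ 1 / 2)
    (by norm_num : (0 : ℝ) ≤ 1 / 2) (by norm_num)
  simp only [smul_eq_mul] at this
  rw [show 1 / 2 * (x + y) + 1 / 2 * (x - y) = x by ring] at this
  linarith

/-- The derivative `(p + 1) x ^ p` is convex, so its mean over `[x - y, x + y]` is at least its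
value at the midpoint. The induction avoids integrals. -/
lemma two_mul_mul_pow_le {x y : ℝ} (hy : 0 ≤ y) (hyx : y ≤ x) (p : ℕ) :
    2 * (p + 1 : ℝ) * y * x ^ p ≤ (x + y) ^ (p + 1) - (x - y) ^ (p + 1) := by
  induction p with
  | zero => simp; linarith
  | succ n ih =>
    have h := two_mul_pow_le hy hyx (n + 1)
    have hx : 0 ≤ x := hy.trans hyx
    have e : (x + y) ^ (n + 1 + 1) - (x - y) ^ (n + 1 + 1) =
      x * ((x + y) ^ (n + 1) - (x - y) ^ (n + 1)) + y * ((x + y) ^ (n + 1) + (x - y) ^ (n + 1)) := by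
      ring
    rw [e]
    have h1 := mul_le_mul_of_nonneg_left ih hx
    have h2 := mul_le_mul_of_nonneg_left h hy
    push_cast
    calc _ = x * (2 * (n + 1 : ℝ) * y * x ^ n) + y * (2 * x ^ (n + 1)) := by ring
      _ ≤ _ := add_le_add h1 h2

/-- A central difference of `trunc` dominates its derivative, since the derivative is convex. -/
lemma truncDeriv_le (hM : 0 ≤ M) (hp : 2 ≤ p) {c u : ℝ} (hc : 0 ≤ c) (hu : 0 ≤ u) :
    2 * u * truncDeriv M p c ≤ trunc M p (c + u) - trunc M p (c - u) := by
  obtain ⟨q, rfl⟩ : ∃ q, p = q + 1 + 1 := ⟨p - 2, by omega⟩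
  rcases le_or_gt c M with hcM | hcM
  · have : truncDeriv M (q + 1 + 1) c = 0 := by
      unfold truncDeriv; rw [max_eq_right (by linarith)]; simp
    rw [this, mul_zero, sub_nonneg]
    apply trunc_le_of_abs_le
    rw [abs_of_nonneg (by linarith : 0 ≤ c + u), abs_le]
    constructor <;> linarith
  · set β := c - M with hβ
    have hβ0 : 0 < β := by simp [hβ]; linarith
    have e1 : trunc M (q + 1 + 1) (c + u) = (β + u) ^ (q + 1 + 1) := by
      unfold trunc
      rw [abs_of_nonneg (by linarith), max_eq_left (by linarith)]; congr 1; rw [hβ]; ring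
    have e2 : trunc M (q + 1 + 1) (c - u) ≤ |β - u| ^ (q + 1 + 1) := by
      unfold trunc
      gcongr
      apply max_le _ (abs_nonneg _)
      rcases abs_cases (c - u) with h | h <;> rcases abs_cases (β - u) with h' | h' <;> linarith
    have e3 : truncDeriv M (q + 1 + 1) c = (q + 1 + 1 : ℝ) * β ^ (q + 1) := by
      unfold truncDeriv; rw [max_eq_left (by linarith)]; push_cast; rfl
    rw [e1, e3]
    suffices 2 * u * ((q + 1 + 1 : ℝ) * β ^ (q + 1)) ≤
        (β + u) ^ (q + 1 + 1) - |β - u| ^ (q + 1 + 1) by linarith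
    rcases le_total u β with h | h
    · rw [abs_of_nonneg (by linarith)]
      have := two_mul_mul_pow_le hu h (q + 1)
      push_cast at this
      linarith
    -- For `u ≥ β` the difference is symmetric in `β` and `u`, so the inequality is used with the
    -- roles exchanged; `β * u ^ (q + 1) ≥ u * β ^ (q + 1)` then suffices.
    · rw [abs_sub_comm, abs_of_nonneg (by linarith), add_comm β u]
      have := two_mul_mul_pow_le hβ0.le h (q + 1)
      push_cast at this
      refine le_trans ?_ this
      have hb : β ^ q ≤ u ^ q := by gcongr
      calc 2 * u * ((q + 1 + 1 : ℝ) * β ^ (q + 1)) = 2 * (q + 1 + 1) * u * β * β ^ q := by ring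
        _ ≤ 2 * (q + 1 + 1) * u * β * u ^ q := by gcongr
        _ = _ := by ring

lemma two_mul_trunc_le (c u : ℝ) : 2 * trunc M p c ≤ trunc M p (c + u) + trunc M p (c - u) := by
  have := (convexOn_trunc (M := M) (p := p)).2 (Set.mem_univ (c + u)) (Set.mem_univ (c - u))
    (by norm_num : (0 : ℝ) ≤ 1 / 2) (by norm_num : (0 : ℝ) ≤ 1 / 2) (by norm_num)
  simp only [smul_eq_mul] at this
  rw [show 1 / 2 * (c + u) + 1 / 2 * (c - u) = c by ring] at this
  linarith

/-- Fast growth of `trunc` under dilations. -/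
lemma two_mul_add_le_trunc_dilation (hM : 0 ≤ M) (hp : 2 ≤ p) {θ k v : ℝ} (hθ : θ ≤ 1)
    (hk : 0 < k) (hkp : 2 + 2 * (p : ℝ) ≤ k * (1 + k) ^ (p - 1)) (hv : 0 ≤ v) :
    2 * (trunc M p v + θ * v * truncDeriv M p v) ≤ trunc M p ((1 + k) * v) := by
  obtain ⟨q, rfl⟩ : ∃ q, p = q + 1 + 1 := ⟨p - 2, by omega⟩
  rcases le_or_gt v M with hcM | hcM
  · have h1 : trunc M (q + 1 + 1) v = 0 :=
      trunc_eq_zero (by omega) (by rwa [abs_of_nonneg hv])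
    have h2 : truncDeriv M (q + 1 + 1) v = 0 := by
      unfold truncDeriv; rw [max_eq_right (by linarith)]; simp
    rw [h1, h2]
    simpa using trunc_nonneg _
  · set β := v - M with hβ
    have hβ0 : 0 < β := by rw [hβ]; linarith
    have hkv : 0 ≤ k * v := by positivity
    have e1 : trunc M (q + 1 + 1) v = β ^ (q + 1 + 1) := by
      unfold trunc
      rw [abs_of_nonneg hv, max_eq_left (by linarith)]
    have e2 : trunc M (q + 1 + 1) ((1 + k) * v) = (k * v + β) ^ (q + 1 + 1) := by
      unfold trunc
      rw [abs_of_nonneg (by positivity), max_eq_left (by linarith)]; congr 1; linarith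
    have e3 : truncDeriv M (q + 1 + 1) v = (q + 1 + 1 : ℝ) * β ^ (q + 1) := by
      unfold truncDeriv; rw [max_eq_left (by linarith)]; push_cast; rfl
    rw [e1, e2, e3]
    have hβv : β ≤ v := by linarith
    -- Dilation raises the excess over `M` from `β` to `k v + β`, at least by the factor `1 + k`.
    -- Hence the power `p - 1` yields the factor `(1 + k) ^ (p - 1)` of `hkp`, while one factor `k
    -- v` is kept to dominate `v`.
    have h1 : (1 + k) * β ≤ k * v + β := by nlinarith
    push_cast at hkp
    calc 2 * (β ^ (q + 1 + 1) + θ * v * ((q + 1 + 1 : ℝ) * β ^ (q + 1)))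
        = (2 * β + θ * (2 * v * (q + 1 + 1))) * β ^ (q + 1) := by ring
      _ ≤ (2 * v + 1 * (2 * v * (q + 1 + 1))) * β ^ (q + 1) := by gcongr
      _ = v * β ^ (q + 1) * (2 + 2 * (q + 1 + 1)) := by ring
      _ ≤ v * β ^ (q + 1) * (k * (1 + k) ^ (q + 1)) := by gcongr
      _ = (k * v) * ((1 + k) * β) ^ (q + 1) := by rw [mul_pow]; ring
      _ ≤ (k * v + β) * (k * v + β) ^ (q + 1) := by gcongr; linarith
      _ = _ := by ring

/-- A quantitative gain over the tangent bound `p x`. If `k x ≥ 1`, then `p x ≥ 4` and the right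
side is at least `1`. Otherwise `1 - (1 - x)^p = x ∑ (1 - x)^j`, and each summand lies below the
chord between the points `1` and `1 - 1/k`. Since `∑ (1 - 1/k)^j ≤ k ≤ p/4`, the sum is at most `p
(1 - (3/4) k x)`, whence the constant `3/2`. -/
lemma one_sub_pow_le {k x c : ℝ} (hk : 1 ≤ k) (hkp : 4 * k ≤ p) (hx : 0 ≤ x) (hc : c ≤ 1 / 2)
    (hcx : 2 * c ≤ k * x) :
    1 - (max (1 - x) 0) ^ p ≤ p * x * (1 - 3 / 2 * c) := by
  rcases le_or_gt 1 (k * x) with h | h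
  · have h0 : (0 : ℝ) ≤ (max (1 - x) 0) ^ p := by positivity
    have hpx : 4 * k * x ≤ p * x := by gcongr
    have := mul_le_mul_of_nonneg_left hc (mul_nonneg (Nat.cast_nonneg (α := ℝ) p) hx)
    linarith
  · have hx1 : x ≤ 1 := by nlinarith
    rw [max_eq_left (by linarith)]
    have hk0 : 0 < k := by linarith
    have hk1 : 1 / k ≤ 1 := by rw [div_le_one hk0]; exact hk
    have hterm : ∀ j : ℕ, (1 - x) ^ j ≤ (1 - k * x) + k * x * (1 - 1 / k) ^ j := by
      intro j
      have h1 : (1 : ℝ) ∈ Set.Ici (0 : ℝ) := by simp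
      have h2 : 1 - 1 / k ∈ Set.Ici (0 : ℝ) := by rw [Set.mem_Ici]; linarith
      have := (convexOn_pow (𝕜 := ℝ) j).2 h1 h2 (by linarith : (0 : ℝ) ≤ 1 - k * x)
        (by positivity : 0 ≤ k * x) (by ring)
      simp only [smul_eq_mul, one_pow, mul_one] at this
      rwa [show 1 - k * x + k * x * (1 - 1 / k) = 1 - x by field_simp; ring] at this
    have hsum := Finset.sum_le_sum fun j (_ : j ∈ Finset.range p) => hterm j
    rw [Finset.sum_add_distrib, ← Finset.mul_sum] at hsum
    simp only [Finset.sum_const, Finset.card_range, nsmul_eq_mul] at hsum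
    have g1 := mul_neg_geom_sum (1 - x) p
    have g2 := mul_neg_geom_sum (1 - 1 / k) p
    rw [show 1 - (1 - x) = x by ring] at g1
    rw [show 1 - (1 - 1 / k) = 1 / k by ring] at g2
    have g3 : ∑ j ∈ Finset.range p, (1 - 1 / k) ^ j ≤ k := by
      have : (0 : ℝ) ≤ (1 - 1 / k) ^ p := by
        apply pow_nonneg; linarith
      have h3 : 1 / k * ∑ j ∈ Finset.range p, (1 - 1 / k) ^ j ≤ 1 := by rw [g2]; linarith
      rwa [one_div_mul_eq_div, div_le_one hk0] at h3
    rw [← g1]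
    have g4 : ∑ j ∈ Finset.range p, (1 - x) ^ j ≤ p * (1 - 3 / 2 * c) := by
      have hkx : 0 ≤ k * x := by positivity
      have := mul_le_mul_of_nonneg_left (g3.trans (by linarith : k ≤ p / 4)) hkx
      nlinarith [mul_nonneg (Nat.cast_nonneg (α := ℝ) p) (by linarith : 0 ≤ k * x - 2 * c)]
    calc _ ≤ x * (p * (1 - 3 / 2 * c)) := by gcongr
      _ = _ := by ring

/-- The pointwise comparison behind the entropy bound for outgoing states. -/
lemma trunc_outgoing (hM : 0 ≤ M) {θ k b u c : ℝ} (hp : 2 ≤ p) (hθ : 0 < θ) (hθp : 2 ≤ θ * p)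
    (hk : 1 ≤ k) (hkp : 4 * k ≤ p) (hu : 0 < u) (hub : u ≤ b) (hc0 : 0 ≤ c) (hc : c ≤ 1 / 2)
    (hcb : c * b ≤ k * u) :
    u * (trunc M p b + trunc M p (b - 2 * u)) + θ * (b - u) * (trunc M p b - trunc M p (b - 2 * u))
      ≤ (1 - c) * (2 * u * (trunc M p b + θ * b * truncDeriv M p b)) := by
  obtain ⟨q, rfl⟩ : ∃ q, p = q + 1 := ⟨p - 1, by omega⟩
  have hb : 0 < b := by linarith
  have hab : trunc M (q + 1) (b - 2 * u) ≤ trunc M (q + 1) b := by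
    apply trunc_le_of_abs_le
    rw [abs_of_pos hb, abs_le]; constructor <;> linarith
  rcases le_or_gt b M with hbM | hbM
  · have h1 : trunc M (q + 1) b = 0 :=
      trunc_eq_zero (by omega) (by rwa [abs_of_pos hb])
    have h2 : trunc M (q + 1) (b - 2 * u) = 0 := le_antisymm (h1 ▸ hab) (trunc_nonneg _)
    rw [h1, h2]
    have := truncDeriv_nonneg (M := M) (p := q + 1) b
    have h3 : 0 ≤ 1 - c := by linarith
    simp only [add_zero, mul_zero, sub_zero, zero_add]
    positivity
  · set β := b - M with hβ
    have hβ0 : 0 < β := by rw [hβ]; linarith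
    have hβb : β ≤ b := by linarith
    have e1 : trunc M (q + 1) b = β ^ (q + 1) := by
      unfold trunc
      rw [abs_of_nonneg hb.le, max_eq_left (by linarith)]
    have e3 : truncDeriv M (q + 1) b = (q + 1 : ℝ) * β ^ q := by
      unfold truncDeriv; rw [max_eq_left (by linarith)]; push_cast; rfl
    have e2 : (max (β - 2 * u) 0) ^ (q + 1) ≤ trunc M (q + 1) (b - 2 * u) := by
      unfold trunc
      refine pow_le_pow_left₀ (le_max_right _ _) (max_le_max_right _ ?_) _
      linarith [le_abs_self (b - 2 * u)]
    have key := one_sub_pow_le (p := q + 1) (k := k) (x := 2 * u / β) (c := c) hk hkp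
      (by positivity) hc (by rw [← mul_div_assoc, le_div_iff₀ hβ0]; linarith [mul_le_mul_of_nonneg_left hβb hc0])
    have e4 : (max (β - 2 * u) 0) ^ (q + 1) = β ^ (q + 1) * (max (1 - 2 * u / β) 0) ^ (q + 1) := by
      rw [← mul_pow, mul_max_of_nonneg _ _ hβ0.le, mul_zero, mul_sub, mul_one,
        mul_div_cancel₀ _ hβ0.ne']
    have key2 : β ^ (q + 1) - trunc M (q + 1) (b - 2 * u) ≤
        2 * u * ((q + 1 : ℝ) * β ^ q) * (1 - 3 / 2 * c) := by
      have := mul_le_mul_of_nonneg_left key (pow_nonneg hβ0.le (q + 1))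
      push_cast at this
      calc _ ≤ β ^ (q + 1) * (1 - max (1 - 2 * u / β) 0 ^ (q + 1)) := by
            rw [mul_sub, mul_one, ← e4]; linarith
        _ ≤ _ := this
        _ = _ := by field_simp; ring
    rw [e1] at hab
    rw [e1, e3]
    push_cast at hθp
    have hpos : 0 ≤ β ^ (q + 1) - trunc M (q + 1) (b - 2 * u) := by linarith
    have k1 : θ * (b - u) * (β ^ (q + 1) - trunc M (q + 1) (b - 2 * u)) ≤
        θ * b * (2 * u * ((q + 1 : ℝ) * β ^ q) * (1 - 3 / 2 * c)) := by
      calc _ ≤ θ * b * (β ^ (q + 1) - trunc M (q + 1) (b - 2 * u)) := by gcongr; linarith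
        _ ≤ _ := by gcongr
    have k2 : u * (β ^ (q + 1) + trunc M (q + 1) (b - 2 * u)) ≤ 2 * u * β ^ (q + 1) := by
      have := mul_le_mul_of_nonneg_left hab hu.le
      linarith
    -- The gain `3/2 c` exceeds the required `c`. The surplus `c/2` in the derivative term pays for
    -- the missing factor `1 - c` in the `S` term, because `β ≤ b` and `θ p ≥ 2`.
    have k3 : 2 * u * c * β ^ (q + 1) ≤ 2 * u * c * (θ * (q + 1) / 2 * (b * β ^ q)) := by
      gcongr
      calc β ^ (q + 1) = 1 * (β * β ^ q) := by ring
        _ ≤ θ * (q + 1) / 2 * (b * β ^ q) := by gcongr; linarith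
    linarith

end Trunc

/-! ### The entropies as averages over `[-1, 1]` -/

/-- The average of `f` for the probability density proportional to `(1 - y²) ^ λ`. -/
noncomputable def kineticMean (γ : ℝ) (f : ℝ → ℝ) : ℝ :=
  (∫ y in (-1 : ℝ)..1, (1 - y ^ 2) ^ lam γ * f y) / jConst γ

/-- The half-width of the support of the kernel. -/
noncomputable def width (κ γ ρ : ℝ) : ℝ := aConst κ γ * ρ ^ theta γ

/-- The entropy as a continuous function of density and velocity. -/
noncomputable def meanEta (κ γ : ℝ) (S : ℝ → ℝ) (s : ℝ × ℝ) : ℝ :=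
  s.1 * kineticMean γ (fun y => S (s.2 + width κ γ s.1 * y))

/-- The entropy flux as a continuous function of density and velocity. -/
noncomputable def meanFlux (κ γ : ℝ) (S : ℝ → ℝ) (s : ℝ × ℝ) : ℝ :=
  s.1 * kineticMean γ
    (fun y => (s.2 + theta γ * (width κ γ s.1 * y)) * S (s.2 + width κ γ s.1 * y))

section Kernel

variable {κ γ : ℝ}

lemma continuous_weight (h₁ : 1 < γ) (h₃ : γ < 3) :
    Continuous fun y : ℝ => (1 - y ^ 2) ^ lam γ :=
  (by fun_prop : Continuous fun y : ℝ => 1 - y ^ 2).rpow_const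
    fun _ => Or.inr (lam_pos h₁ h₃).le

lemma weight_nonneg {y : ℝ} (h0 : -1 ≤ y) (h1 : y ≤ 1) : 0 ≤ (1 - y ^ 2) ^ lam γ :=
  Real.rpow_nonneg (by nlinarith) _

lemma jConst_pos (h₁ : 1 < γ) (h₃ : γ < 3) : 0 < jConst γ := by
  unfold jConst
  apply intervalIntegral.intervalIntegral_pos_of_pos_on
  · exact (continuous_weight h₁ h₃).intervalIntegrable _ _
  · intro x hx
    exact Real.rpow_pos_of_pos (by nlinarith [hx.1, hx.2]) _
  · norm_num

lemma width_nonneg (hκ : 0 < κ) (h₁ : 1 < γ) {ρ : ℝ} (hρ : 0 ≤ ρ) : 0 ≤ width κ γ ρ :=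
  mul_nonneg (aConst_pos hκ h₁).le (Real.rpow_nonneg hρ _)

lemma width_pos (hκ : 0 < κ) (h₁ : 1 < γ) {ρ : ℝ} (hρ : 0 < ρ) : 0 < width κ γ ρ :=
  mul_pos (aConst_pos hκ h₁) (Real.rpow_pos_of_pos hρ _)

lemma width_zero (h₁ : 1 < γ) : width κ γ 0 = 0 := by
  simp [width, Real.zero_rpow (theta_pos h₁).ne']

lemma width_mono (hκ : 0 < κ) (h₁ : 1 < γ) {ρ ρ' : ℝ} (hρ : 0 ≤ ρ) (h : ρ ≤ ρ') :
    width κ γ ρ ≤ width κ γ ρ' :=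
  mul_le_mul_of_nonneg_left (Real.rpow_le_rpow hρ h (theta_pos h₁).le) (aConst_pos hκ h₁).le

lemma continuous_width (h₁ : 1 < γ) : Continuous (width κ γ) :=
  continuous_const.mul (continuous_id.rpow_const fun _ => Or.inr (theta_pos h₁).le)

lemma chi_zero (h₁ : 1 < γ) (h₃ : γ < 3) (ξ : ℝ) : chi κ γ 0 ξ = 0 := by
  unfold chi
  rw [Real.zero_rpow (by linarith : γ - 1 ≠ 0), mul_zero, zero_sub,
    max_eq_right (by nlinarith), Real.zero_rpow (lam_pos h₁ h₃).ne', mul_zero]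

lemma width_sq {ρ : ℝ} (hρ : 0 ≤ ρ) :
    width κ γ ρ ^ 2 = aConst κ γ ^ 2 * ρ ^ (γ - 1) := by
  unfold width
  rw [mul_pow, ← Real.rpow_natCast (ρ ^ theta γ), ← Real.rpow_mul hρ]
  congr 2
  unfold theta
  push_cast
  ring

/-- By homogeneity, `width * (width ^ 2) ^ λ = a ^ (2 / (γ - 1)) * ρ`, and the power of `a` cancels
against the normalisation `cConst`. -/
lemma chi_width_mul (hκ : 0 < κ) (h₁ : 1 < γ) {ρ : ℝ} (hρ : 0 < ρ) (y : ℝ) :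
    width κ γ ρ * chi κ γ ρ (width κ γ ρ * y) =
      ρ / jConst γ * (max (1 - y ^ 2) 0) ^ lam γ := by
  have hA := width_pos hκ h₁ hρ
  have ha := aConst_pos hκ h₁
  unfold chi
  rw [← width_sq hρ.le]
  rw [show width κ γ ρ ^ 2 - (width κ γ ρ * y) ^ 2 = width κ γ ρ ^ 2 * (1 - y ^ 2) by ring,
    show max (width κ γ ρ ^ 2 * (1 - y ^ 2)) 0 = width κ γ ρ ^ 2 * max (1 - y ^ 2) 0 by
      rw [mul_max_of_nonneg _ _ (sq_nonneg _), mul_zero],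
    Real.mul_rpow (sq_nonneg _) (le_max_right _ _)]
  have e1 : width κ γ ρ * (width κ γ ρ ^ 2) ^ lam γ =
      aConst κ γ ^ (2 / (γ - 1)) * ρ := by
    rw [← Real.rpow_natCast (width κ γ ρ), ← Real.rpow_mul hA.le]
    nth_rewrite 1 [← Real.rpow_one (width κ γ ρ)]
    rw [← Real.rpow_add hA]
    have : 1 + ((2 : ℕ) : ℝ) * lam γ = 1 / theta γ := by
      rw [← two_lam_add_one h₁]; push_cast; ring
    rw [this]
    unfold width
    rw [Real.mul_rpow ha.le (Real.rpow_nonneg hρ.le _), ← Real.rpow_mul hρ.le,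
      mul_one_div_cancel (theta_pos h₁).ne', Real.rpow_one]
    congr 2
    unfold theta
    field_simp
  unfold cConst
  have e2 : aConst κ γ ^ (-(2 / (γ - 1))) * aConst κ γ ^ (2 / (γ - 1)) = 1 := by
    rw [← Real.rpow_add ha]; simp
  calc _ = (aConst κ γ ^ (-(2 / (γ - 1))) * (width κ γ ρ * (width κ γ ρ ^ 2) ^ lam γ)) / jConst γ *
        (max (1 - y ^ 2) 0) ^ lam γ := by ring
    _ = _ := by rw [e1, ← mul_assoc, e2, one_mul]

lemma integral_max_weight_mul (h₁ : 1 < γ) (h₃ : γ < 3) (f : ℝ → ℝ) :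
    ∫ y : ℝ, (max (1 - y ^ 2) 0) ^ lam γ * f y =
      ∫ y in (-1 : ℝ)..1, (1 - y ^ 2) ^ lam γ * f y := by
  rw [intervalIntegral.integral_of_le (by norm_num), ← integral_indicator measurableSet_Ioc]
  congr 1
  ext y
  by_cases hy : y ∈ Set.Ioc (-1 : ℝ) 1
  · rw [Set.indicator_of_mem hy, max_eq_left (by nlinarith [hy.1, hy.2])]
  -- Outside the interval the positive part is zero, and `0 ^ λ = 0` because `λ > 0`.
  · rw [Set.indicator_of_notMem hy, max_eq_right, Real.zero_rpow (lam_pos h₁ h₃).ne', zero_mul]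
    by_contra! h
    exact hy ⟨by nlinarith, by nlinarith⟩

/-- Substitution `v = u + width * y`. At vacuum this degenerates, but there the kernel itself
vanishes. -/
lemma integral_chi_mul (hκ : 0 < κ) (h₁ : 1 < γ) (h₃ : γ < 3) {ρ : ℝ} (hρ : 0 ≤ ρ) (u : ℝ)
    (f : ℝ → ℝ) :
    ∫ v : ℝ, chi κ γ ρ (v - u) * f v =
      ρ * kineticMean γ (fun y => f (u + width κ γ ρ * y)) := by
  rcases hρ.eq_or_lt with rfl | hρ
  · simp [chi_zero h₁ h₃]
  have hA := width_pos hκ h₁ hρ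
  rw [← integral_add_left_eq_self _ u]
  have h2 := Measure.integral_comp_mul_left
    (fun v => chi κ γ ρ (u + v - u) * f (u + v)) (width κ γ ρ)
  rw [abs_of_pos (inv_pos.2 hA), smul_eq_mul, eq_inv_mul_iff_mul_eq₀ hA.ne'] at h2
  rw [← h2, ← integral_const_mul]
  unfold kineticMean
  rw [← integral_max_weight_mul h₁ h₃, mul_div_assoc', mul_div_right_comm, ← integral_const_mul]
  congr 1
  ext y
  rw [add_sub_cancel_left, ← mul_assoc, chi_width_mul hκ h₁ hρ, mul_assoc]

lemma eta_eq (hκ : 0 < κ) (h₁ : 1 < γ) (h₃ : γ < 3) (S : ℝ → ℝ) {s : ℝ × ℝ} (hs : 0 ≤ s.1) :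
    eta κ γ S s = meanEta κ γ S s :=
  integral_chi_mul hκ h₁ h₃ hs s.2 S

/-- Under `v = u + width * y` the transport speed `(1 - θ) u + θ v` becomes `u + θ * width * y`. -/
lemma entropyFlux_eq (hκ : 0 < κ) (h₁ : 1 < γ) (h₃ : γ < 3) (S : ℝ → ℝ) {s : ℝ × ℝ}
    (hs : 0 ≤ s.1) : entropyFlux κ γ S s = meanFlux κ γ S s := by
  have := integral_chi_mul hκ h₁ h₃ hs s.2
    (fun v => ((1 - theta γ) * s.2 + theta γ * v) * S v)
  unfold entropyFlux meanFlux
  have e1 : ∀ v, ((1 - theta γ) * s.2 + theta γ * v) * chi κ γ s.1 (v - s.2) * S v =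
      chi κ γ s.1 (v - s.2) * (((1 - theta γ) * s.2 + theta γ * v) * S v) := fun v => by ring
  have e2 : ∀ y, (s.2 + theta γ * (width κ γ s.1 * y)) =
      ((1 - theta γ) * s.2 + theta γ * (s.2 + width κ γ s.1 * y)) := fun y => by ring
  simp only [e1, e2, this]

lemma kineticMean_mono (h₁ : 1 < γ) (h₃ : γ < 3) {f g : ℝ → ℝ} (hf : Continuous f)
    (hg : Continuous g) (h : ∀ y ∈ Set.Icc (-1 : ℝ) 1, f y ≤ g y) :
    kineticMean γ f ≤ kineticMean γ g := by
  unfold kineticMean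
  have hw := continuous_weight h₁ h₃
  apply div_le_div_of_nonneg_right _ (jConst_pos h₁ h₃).le
  apply intervalIntegral.integral_mono_on (by norm_num)
    ((hw.mul hf).intervalIntegrable _ _) ((hw.mul hg).intervalIntegrable _ _)
  intro y hy
  exact mul_le_mul_of_nonneg_left (h y hy) (weight_nonneg hy.1 hy.2)

lemma kineticMean_const (h₁ : 1 < γ) (h₃ : γ < 3) (c : ℝ) : kineticMean γ (fun _ => c) = c := by
  unfold kineticMean
  rw [intervalIntegral.integral_mul_const]
  exact mul_div_cancel_left₀ _ (jConst_pos h₁ h₃).ne'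

lemma kineticMean_sub (h₁ : 1 < γ) (h₃ : γ < 3) {f g : ℝ → ℝ} (hf : Continuous f)
    (hg : Continuous g) :
    kineticMean γ (fun y => f y - g y) = kineticMean γ f - kineticMean γ g := by
  unfold kineticMean
  have hw := continuous_weight h₁ h₃
  have hi : ∀ {f : ℝ → ℝ}, Continuous f →
      IntervalIntegrable (fun y => (1 - y ^ 2) ^ lam γ * f y) volume (-1) 1 :=
    fun hf => (hw.mul hf).intervalIntegrable _ _
  rw [← sub_div, ← intervalIntegral.integral_sub (hi hf) (hi hg)]
  simp only [mul_sub]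

lemma kineticMean_const_mul (c : ℝ) (f : ℝ → ℝ) :
    kineticMean γ (fun y => c * f y) = c * kineticMean γ f := by
  unfold kineticMean
  simp only [mul_left_comm _ c]
  rw [intervalIntegral.integral_const_mul, mul_div_assoc]

lemma abs_kineticMean_le (h₁ : 1 < γ) (h₃ : γ < 3) {f : ℝ → ℝ} {C : ℝ} (hf : Continuous f)
    (h : ∀ y ∈ Set.Icc (-1 : ℝ) 1, |f y| ≤ C) : |kineticMean γ f| ≤ C := by
  rw [abs_le]
  constructor
  · rw [← kineticMean_const h₁ h₃ (-C)]
    exact kineticMean_mono h₁ h₃ continuous_const hf fun y hy => (abs_le.1 (h y hy)).1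
  · rw [← kineticMean_const h₁ h₃ C]
    exact kineticMean_mono h₁ h₃ hf continuous_const fun y hy => (abs_le.1 (h y hy)).2

/-- Pairing `y` with `-y` produces the symmetric sums and central differences to which convexity of
`S` and of its derivative apply. -/
lemma kineticMean_fold (h₁ : 1 < γ) (h₃ : γ < 3) {f : ℝ → ℝ} (hf : Continuous f) :
    kineticMean γ f =
      (∫ y in (0 : ℝ)..1, (1 - y ^ 2) ^ lam γ * (f y + f (-y))) / jConst γ := by
  unfold kineticMean
  have hw := continuous_weight h₁ h₃
  have hi : ∀ a b, IntervalIntegrable (fun y => (1 - y ^ 2) ^ lam γ * f y) volume a b :=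
    fun a b => (hw.mul hf).intervalIntegrable _ _
  have hi' : ∀ a b, IntervalIntegrable (fun y => (1 - y ^ 2) ^ lam γ * f (-y)) volume a b :=
    fun a b => (hw.mul (hf.comp continuous_neg)).intervalIntegrable _ _
  rw [← intervalIntegral.integral_add_adjacent_intervals (hi (-1) 0) (hi 0 1)]
  have e : ∫ y in (-1 : ℝ)..0, (1 - y ^ 2) ^ lam γ * f y =
      ∫ y in (0 : ℝ)..1, (1 - y ^ 2) ^ lam γ * f (-y) := by
    have := intervalIntegral.integral_comp_neg (a := (0 : ℝ)) (b := 1)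
      (fun y => (1 - y ^ 2) ^ lam γ * f y)
    simp only [neg_sq, neg_zero] at this
    exact this.symm
  rw [e, add_comm, ← intervalIntegral.integral_add (hi 0 1) (hi' 0 1)]
  simp only [mul_add]

end Kernel

/-! ### The entropy flux through the junction -/

/-- The states that occur as boundary values of Lax solutions whose left state has velocity `0`
and maximal speed `W`: subsonic outflow, subsonic inflow and supersonic inflow. -/
def IsBoundaryState (κ γ W : ℝ) (s : ℝ × ℝ) : Prop :=
  (0 ≤ s.2 ∧ s.2 ≤ theta γ * width κ γ s.1 ∧ s.2 + width κ γ s.1 = W) ∨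
  (s.2 ≤ 0 ∧ W ≤ width κ γ s.1) ∨
  (s.2 ≤ 0 ∧ theta γ * width κ γ s.1 ≤ -s.2 ∧
    (1 + theta γ ^ 2 / (2 * γ)) * W ≤ -s.2 + width κ γ s.1)

/-- The ratio of entropy flux and mass flux for a flow of velocity `0` and maximal speed `W`. -/
noncomputable def fluxRatio (γ M : ℝ) (p : ℕ) (W : ℝ) : ℝ :=
  (∫ y in (0 : ℝ)..1, (1 - y ^ 2) ^ lam γ *
    (2 * (trunc M p (W * y) + theta γ * (W * y) * truncDeriv M p (W * y)))) / jConst γ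

/-- Exponents for which the entropy `trunc M p` is dissipated at junctions. -/
structure IsAdmissibleExponent (γ : ℝ) (p : ℕ) : Prop where
  two_le : 2 ≤ p
  two_le_mul : 2 ≤ theta γ * p
  four_mul_le : 4 * (lam γ + 1) ≤ p
  growth : 2 + 2 * (p : ℝ) ≤
    theta γ ^ 2 / (2 * γ) * (1 + theta γ ^ 2 / (2 * γ)) ^ (p - 1)

section Junction

variable {κ γ M : ℝ} {p : ℕ}

/-- All requirements but `growth` are fixed lower bounds for `p`; in `growth` an exponential beats a
linear function. -/
lemma exists_isAdmissibleExponent (h₁ : 1 < γ) : ∃ p, IsAdmissibleExponent γ p := by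
  have hθ := theta_pos h₁
  set k := theta γ ^ 2 / (2 * γ) with hk
  have hk0 : 0 < k := by positivity
  have t1 : Tendsto (fun n : ℕ => (n : ℝ) ^ 1 / (1 + k) ^ n) atTop (𝓝 0) :=
    tendsto_pow_const_div_const_pow_of_one_lt 1 (by linarith)
  have t0 : Tendsto (fun n : ℕ => (n : ℝ) ^ 0 / (1 + k) ^ n) atTop (𝓝 0) :=
    tendsto_pow_const_div_const_pow_of_one_lt 0 (by linarith)
  have t2 := (t1.const_mul 2).add (t0.const_mul 4)
  simp only [mul_zero, add_zero] at t2
  have e1 := t2.eventually (gt_mem_nhds hk0)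
  have e2 := (tendsto_natCast_atTop_atTop (R := ℝ)).eventually_ge_atTop (2 / theta γ)
  have e3 := (tendsto_natCast_atTop_atTop (R := ℝ)).eventually_ge_atTop (4 * (lam γ + 1))
  obtain ⟨n, h1, h2, h3, h4⟩ := (e1.and (e2.and (e3.and (eventually_ge_atTop 1)))).exists
  refine ⟨n + 1, by omega, ?_, by push_cast; linarith, ?_⟩
  · rw [div_le_iff₀ hθ] at h2
    push_cast
    nlinarith
  · have hpos : 0 < (1 + k) ^ n := by positivity
    rw [pow_zero, pow_one, ← mul_div_assoc, ← mul_div_assoc, ← add_div, div_lt_iff₀ hpos] at h1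
    push_cast
    rw [← hk]
    linarith

lemma meanFlux_fold (h₁ : 1 < γ) (h₃ : γ < 3) (s : ℝ × ℝ) :
    meanFlux κ γ (trunc M p) s = s.1 * ((∫ y in (0 : ℝ)..1, (1 - y ^ 2) ^ lam γ *
      ((s.2 + theta γ * (width κ γ s.1 * y)) * trunc M p (s.2 + width κ γ s.1 * y) +
        (s.2 - theta γ * (width κ γ s.1 * y)) * trunc M p (s.2 - width κ γ s.1 * y))) /
      jConst γ) := by
  unfold meanFlux
  have := continuous_trunc (M := M) (p := p)
  rw [kineticMean_fold h₁ h₃ (by fun_prop)]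
  simp only [mul_neg, ← sub_eq_add_neg]

/-- Comparison of weighted integrals over `[0, 1]`. -/
lemma weighted_integral_mono (h₁ : 1 < γ) (h₃ : γ < 3) {f g : ℝ → ℝ} (hf : Continuous f)
    (hg : Continuous g) (h : ∀ y ∈ Set.Icc (0 : ℝ) 1, f y ≤ g y) :
    ∫ y in (0 : ℝ)..1, (1 - y ^ 2) ^ lam γ * f y ≤
      ∫ y in (0 : ℝ)..1, (1 - y ^ 2) ^ lam γ * g y := by
  have hw := continuous_weight h₁ h₃
  apply intervalIntegral.integral_mono_on (by norm_num)
    ((hw.mul hf).intervalIntegrable _ _) ((hw.mul hg).intervalIntegrable _ _)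
  intro y hy
  exact mul_le_mul_of_nonneg_left (h y hy) (weight_nonneg (by linarith [hy.1]) hy.2)

/-- Since `S` is even, the entropy flux is odd in the velocity; inflow is thereby reduced to lower
bounds at positive velocity `U`. -/
lemma flux_integrand_neg (θ u c : ℝ) :
    (-u + θ * c) * trunc M p (-u + c) + (-u - θ * c) * trunc M p (-u - c) =
      -((u + θ * c) * trunc M p (u + c) + (u - θ * c) * trunc M p (u - c)) := by
  rw [show -u + c = -(u - c) by ring, show -u - c = -(u + c) by ring, trunc_neg, trunc_neg]
  ring

/-- Inflow: a pointwise lower bound of the integrand yields the bound of the flux. -/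
lemma meanFlux_le_of_inflow (h₁ : 1 < γ) (h₃ : γ < 3) {W ρ U : ℝ} (hρ : 0 ≤ ρ)
    (h : ∀ y ∈ Set.Icc (0 : ℝ) 1,
      U * (2 * (trunc M p (W * y) + theta γ * (W * y) * truncDeriv M p (W * y))) ≤
      (U + theta γ * (width κ γ ρ * y)) * trunc M p (U + width κ γ ρ * y) +
        (U - theta γ * (width κ γ ρ * y)) * trunc M p (U - width κ γ ρ * y)) :
    meanFlux κ γ (trunc M p) (ρ, -U) ≤ fluxRatio γ M p W * (ρ * -U) := by
  have c1 := continuous_trunc (M := M) (p := p)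
  have c2 := continuous_truncDeriv (M := M) (p := p)
  rw [meanFlux_fold h₁ h₃]
  simp only [flux_integrand_neg]
  have := weighted_integral_mono h₁ h₃ (by fun_prop) (by fun_prop) h
  simp only [mul_left_comm _ U] at this
  rw [intervalIntegral.integral_const_mul] at this
  simp only [mul_neg, intervalIntegral.integral_neg]
  unfold fluxRatio
  have hj := jConst_pos h₁ h₃
  have h2 := div_le_div_of_nonneg_right this hj.le
  have h3 := mul_le_mul_of_nonneg_left h2 hρ
  calc _ ≤ -(ρ * ((U * ∫ y in (0 : ℝ)..1, (1 - y ^ 2) ^ lam γ *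
    (2 * (trunc M p (W * y) + theta γ * (W * y) * truncDeriv M p (W * y)))) / jConst γ)) := by
        rw [neg_div, mul_neg]; exact neg_le_neg h3
    _ = _ := by ring

/-- With `c = width * y` the integrand is `U (S(U+c) + S(U-c)) + θ c (S(U+c) - S(U-c))`. Convexity
of `S` and of its derivative bounds it below by `2U (S(c) + θ c S'(c))`, which is monotone in `c ≥ W
y`. -/
lemma meanFlux_le_of_subsonic_inflow (h₁ : 1 < γ) (h₃ : γ < 3) (hM : 0 ≤ M)
    (hp : 2 ≤ p) {W ρ U : ℝ} (hρ : 0 ≤ ρ) (hU : 0 ≤ U) (hW0 : 0 ≤ W) (hW : W ≤ width κ γ ρ) :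
    meanFlux κ γ (trunc M p) (ρ, -U) ≤ fluxRatio γ M p W * (ρ * -U) := by
  apply meanFlux_le_of_inflow h₁ h₃ hρ
  intro y hy
  have hθ := theta_pos h₁
  set c := width κ γ ρ * y with hc
  have hWc : W * y ≤ c := mul_le_mul_of_nonneg_right hW hy.1
  have hWy : 0 ≤ W * y := mul_nonneg hW0 hy.1
  have hc0 : 0 ≤ c := hWy.trans hWc
  have a1 := two_mul_trunc_le (M := M) (p := p) c U
  have a2 := truncDeriv_le hM hp hc0 hU
  rw [trunc_sub_comm c U] at a1 a2
  rw [add_comm c U] at a1 a2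
  have a3 : trunc M p (W * y) ≤ trunc M p c :=
    trunc_le_of_abs_le (by rwa [abs_of_nonneg hWy, abs_of_nonneg hc0])
  have a4 := truncDeriv_mono (M := M) (p := p) hWc
  have a5 := truncDeriv_nonneg (M := M) (p := p) (W * y)
  have b1 : U * (2 * trunc M p (W * y)) ≤ U * (trunc M p (U + c) + trunc M p (U - c)) := by
    gcongr; linarith
  have b2 : theta γ * ((W * y) * (2 * U * truncDeriv M p (W * y))) ≤
      theta γ * (c * (trunc M p (U + c) - trunc M p (U - c))) := by
    gcongr
    exact le_trans (by gcongr) a2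
  linarith

/-- Supersonic speed makes the factor `U - θ * width * y` nonnegative, so everything except `U S(U +
width * y)` can be dropped. Its argument is at least `(1 + k) W y` with `k = θ²/(2γ)`, and the
growth of `S` under dilation does the rest. -/
lemma meanFlux_le_of_supersonic_inflow (hκ : 0 < κ) (h₁ : 1 < γ) (h₃ : γ < 3) (hM : 0 ≤ M)
    (hp : IsAdmissibleExponent γ p) {W ρ U : ℝ} (hρ : 0 ≤ ρ) (hW0 : 0 ≤ W)
    (hU : theta γ * width κ γ ρ ≤ U)
    (hW : (1 + theta γ ^ 2 / (2 * γ)) * W ≤ U + width κ γ ρ) :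
    meanFlux κ γ (trunc M p) (ρ, -U) ≤ fluxRatio γ M p W * (ρ * -U) := by
  have hθ := theta_pos h₁
  have hA := width_nonneg hκ h₁ hρ
  have hU0 : 0 ≤ U := le_trans (by positivity) hU
  apply meanFlux_le_of_inflow h₁ h₃ hρ
  intro y hy
  have hy0 := hy.1
  have hk : 0 < theta γ ^ 2 / (2 * γ) := by positivity
  have hWy : 0 ≤ W * y := mul_nonneg hW0 hy0
  have d := two_mul_add_le_trunc_dilation hM hp.two_le (theta_lt_one h₃).le hk hp.growth hWy
  have e : trunc M p ((1 + theta γ ^ 2 / (2 * γ)) * (W * y)) ≤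
      trunc M p (U + width κ γ ρ * y) := by
    apply trunc_le_of_abs_le
    rw [abs_of_nonneg (by positivity), abs_of_nonneg (by positivity)]
    have := mul_le_mul_of_nonneg_right hW hy0
    have : U * y ≤ U := mul_le_of_le_one_right hU0 hy.2
    linarith
  have f1 : theta γ * (width κ γ ρ * y) ≤ U := by
    rw [← mul_assoc]
    exact le_trans (mul_le_of_le_one_right (by positivity) hy.2) hU
  have f2 := mul_nonneg (sub_nonneg.2 f1) (trunc_nonneg (M := M) (p := p) (U - width κ γ ρ * y))
  have f3 : 0 ≤ theta γ * (width κ γ ρ * y) * trunc M p (U + width κ γ ρ * y) :=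
    mul_nonneg (by positivity) (trunc_nonneg _)
  have f4 := mul_le_mul_of_nonneg_left (d.trans e) hU0
  linarith

/-- Because `u + width = W`, the map `y ↦ z = q + t y` with `q = u/W`, `t = width/W` carries `[0,
1]` onto `[q, 1]` and `u + width * y` to `W z`. The Jacobian and the comparison of weights cost `t ^
(λ + 1)`, which is at least `1 - (λ + 1) q`; this is the factor provided by `trunc_outgoing`. -/
lemma meanFlux_le_of_outflow (h₁ : 1 < γ) (h₃ : γ < 3) (hM : 0 ≤ M)
    (hp : IsAdmissibleExponent γ p) {W ρ u : ℝ} (hρ : 0 ≤ ρ) (hu0 : 0 ≤ u)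
    (hu : u ≤ theta γ * width κ γ ρ) (hW : u + width κ γ ρ = W) :
    meanFlux κ γ (trunc M p) (ρ, u) ≤ fluxRatio γ M p W * (ρ * u) := by
  have hθ := theta_pos h₁
  have hj := jConst_pos h₁ h₃
  have hlam := lam_pos h₁ h₃
  have c1 := continuous_trunc (M := M) (p := p)
  have c2 := continuous_truncDeriv (M := M) (p := p)
  rw [meanFlux_fold h₁ h₃]
  rcases hu0.eq_or_lt with rfl | hu0
  · have e : ∀ c, (0 + theta γ * c) * trunc M p (0 + c) + (0 - theta γ * c) * trunc M p (0 - c)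
        = 0 := by
      intro c
      rw [zero_add, zero_add, zero_sub, zero_sub, trunc_neg]; ring
    simp only [e]
    simp
  have hA : 0 < width κ γ ρ := pos_of_mul_pos_right (hu0.trans_le hu) hθ.le
  set A := width κ γ ρ with hAdef
  have hW0 : 0 < W := by linarith
  set h : ℝ → ℝ := fun z => 2 * u * (trunc M p (W * z) + theta γ * (W * z) * truncDeriv M p (W * z))
    with hh
  have hhc : Continuous h := by simp only [hh]; fun_prop
  have hw := continuous_weight h₁ h₃
  have hφ : Continuous fun z => (1 - z ^ 2) ^ lam γ * h z := hw.mul hhc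
  have hh0 : ∀ z, 0 ≤ z → 0 ≤ h z := by
    intro z hz
    have := trunc_nonneg (M := M) (p := p) (W * z)
    have := truncDeriv_nonneg (M := M) (p := p) (W * z)
    simp only [hh]
    positivity
  set q := u / W with hq
  set t := A / W with ht
  have hq0 : 0 < q := by positivity
  have ht0 : 0 < t := by positivity
  have hqt : q + t = 1 := by rw [hq, ht, ← add_div, hW, div_self hW0.ne']
  -- change of variables
  have key : ∫ y in (0 : ℝ)..1, (1 - y ^ 2) ^ lam γ *
      ((u + theta γ * (A * y)) * trunc M p (u + A * y) +
        (u - theta γ * (A * y)) * trunc M p (u - A * y)) ≤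
      ∫ z in (0 : ℝ)..1, (1 - z ^ 2) ^ lam γ * h z := by
    calc _ ≤ ∫ y in (0 : ℝ)..1, t * ((1 - (q + t * y) ^ 2) ^ lam γ * h (q + t * y)) := by
          apply intervalIntegral.integral_mono_on (by norm_num)
          · exact (hw.mul (by fun_prop)).intervalIntegrable _ _
          · exact (continuous_const.mul
              (hφ.comp (g := fun z => (1 - z ^ 2) ^ lam γ * h z)
                (f := fun y => q + t * y) (by fun_prop))).intervalIntegrable _ _
          intro y hy
          have hy0 := hy.1
          have hy1 := hy.2
          set b := u + A * y with hb
          have hbW : W * (q + t * y) = b := by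
            rw [hq, ht, hb]; field_simp
          have hb0 : u ≤ b := by rw [hb]; nlinarith
          have hAy : A * y = b - u := by rw [hb]; ring
          have hbW' : b ≤ W := by rw [hb, ← hW]; nlinarith
          -- Subsonicity `u ≤ θ A` means `(1 + θ) u ≤ θ W`, and `1 + θ = 2 θ (λ + 1)`.
          have hqk : (lam γ + 1) * q ≤ 1 / 2 := by
            have e1 : (1 + theta γ) * u ≤ theta γ * W := by rw [← hW]; linarith
            have e2 := theta_mul_two_lam_add_one h₁
            have e3 : (1 + theta γ) = theta γ * (2 * (lam γ + 1)) := by linarith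
            rw [e3, mul_assoc] at e1
            have e4 := le_of_mul_le_mul_left e1 hθ
            rw [hq, ← mul_div_assoc, div_le_iff₀ hW0]
            linarith
          have main := trunc_outgoing (M := M) (p := p) (θ := theta γ) (k := lam γ + 1) (b := b)
            (u := u) (c := (lam γ + 1) * q) hM hp.two_le hθ hp.two_le_mul (by linarith)
            hp.four_mul_le hu0 hb0 (by positivity) hqk (by
              rw [mul_assoc]
              apply mul_le_mul_of_nonneg_left _ (by linarith)
              rw [hq, div_mul_eq_mul_div, div_le_iff₀ hW0]
              exact mul_le_mul_of_nonneg_left hbW' hu0.le)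
          have e5 : h (q + t * y) = 2 * u * (trunc M p b + theta γ * b * truncDeriv M p b) := by
            simp only [hh, hbW]
          rw [← e5] at main
          have hh1 : 0 ≤ h (q + t * y) := hh0 _ (by positivity)
          have bern : 1 - (lam γ + 1) * q ≤ t ^ (lam γ + 1) := by
            have := one_add_mul_self_le_rpow_one_add (s := -q) (by linarith)
              (p := lam γ + 1) (by linarith)
            rw [show 1 + -q = t by linarith] at this
            linarith
          have m2 : (u + theta γ * (A * y)) * trunc M p b +
              (u - theta γ * (A * y)) * trunc M p (u - A * y) ≤ t ^ (lam γ + 1) * h (q + t * y) := by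
            refine le_trans (le_of_eq ?_) (main.trans (mul_le_mul_of_nonneg_right bern hh1))
            rw [hAy, show u - (b - u) = -(b - 2 * u) by ring, trunc_neg]
            ring
          -- With `z = q + t y` and `q = 1 - t` one has `1 - z² = t (1 - y)(1 + z)`, and `z ≥ y`.
          have m3 : t ^ lam γ * (1 - y ^ 2) ^ lam γ ≤ (1 - (q + t * y) ^ 2) ^ lam γ := by
            rw [← Real.mul_rpow ht0.le (by nlinarith)]
            apply Real.rpow_le_rpow (mul_nonneg ht0.le (by nlinarith)) _ hlam.le
            have e6 : 1 - (q + t * y) ^ 2 = t * (1 - y) * (1 + (q + t * y)) := by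
              rw [show q = 1 - t by linarith]; ring
            rw [e6, show t * (1 - y ^ 2) = t * (1 - y) * (1 + y) by ring]
            apply mul_le_mul_of_nonneg_left _ (mul_nonneg ht0.le (by linarith))
            rw [show q = 1 - t by linarith]
            nlinarith
          calc _ ≤ (1 - y ^ 2) ^ lam γ * (t ^ (lam γ + 1) * h (q + t * y)) :=
                mul_le_mul_of_nonneg_left m2 (weight_nonneg (by linarith) hy1)
            _ = t * ((t ^ lam γ * (1 - y ^ 2) ^ lam γ) * h (q + t * y)) := by
                rw [Real.rpow_add ht0, Real.rpow_one]; ring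
            _ ≤ _ := by gcongr
      _ = ∫ z in q..1, (1 - z ^ 2) ^ lam γ * h z := by
          rw [intervalIntegral.integral_const_mul]
          have := intervalIntegral.mul_integral_comp_add_mul (a := (0 : ℝ)) (b := 1)
            (f := fun z => (1 - z ^ 2) ^ lam γ * h z) (c := t) (d := q)
          rw [this, mul_zero, mul_one, add_zero, hqt]
      -- The integrand is nonnegative, so the missing interval `[0, q]` may be added.
      _ ≤ _ := by
          rw [← intervalIntegral.integral_add_adjacent_intervals
            (hφ.intervalIntegrable 0 q) (hφ.intervalIntegrable q 1)]
          apply le_add_of_nonneg_left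
          apply intervalIntegral.integral_nonneg hq0.le
          intro z hz
          exact mul_nonneg (weight_nonneg (by linarith [hz.1]) (by linarith [hz.2]))
            (hh0 z hz.1)
  have h2 := mul_le_mul_of_nonneg_left (div_le_div_of_nonneg_right key hj.le) hρ
  refine h2.trans (le_of_eq ?_)
  unfold fluxRatio
  have e : ∀ z, (1 - z ^ 2) ^ lam γ * h z = u * ((1 - z ^ 2) ^ lam γ *
      (2 * (trunc M p (W * z) + theta γ * (W * z) * truncDeriv M p (W * z)))) := by
    intro z; simp only [hh]; ring
  simp only [e]
  rw [intervalIntegral.integral_const_mul]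
  ring

/-- The entropy flux of a boundary state is bounded by a multiple of its mass flux which
depends on the junction state only. -/
lemma IsBoundaryState.meanFlux_le (hκ : 0 < κ) (h₁ : 1 < γ) (h₃ : γ < 3) (hM : 0 ≤ M)
    (hp : IsAdmissibleExponent γ p) {W : ℝ} (hW : 0 ≤ W) {s : ℝ × ℝ} (hs : 0 ≤ s.1)
    (h : IsBoundaryState κ γ W s) :
    meanFlux κ γ (trunc M p) s ≤ fluxRatio γ M p W * (s.1 * s.2) := by
  obtain ⟨ρ, u⟩ := s
  rcases h with ⟨a, b, c⟩ | ⟨a, b⟩ | ⟨a, b, c⟩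
  · exact meanFlux_le_of_outflow h₁ h₃ hM hp hs a b c
  · have := meanFlux_le_of_subsonic_inflow (p := p) h₁ h₃ hM hp.two_le hs (neg_nonneg.2 a) hW b
    simpa using this
  · have := meanFlux_le_of_supersonic_inflow (p := p) hκ h₁ h₃ hM hp hs hW b c
    simpa using this

end Junction

/-! ### Shocks -/

section Shock

variable {κ γ : ℝ}

lemma sq_shockJump (hκ : 0 < κ) (h₁ : 1 < γ) {r m : ℝ} (hr : 0 < r) (hrm : r ≤ m) :
    shockJump κ γ m r ^ 2 = κ * (m ^ γ - r ^ γ) * (m - r) / (m * r) := by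
  unfold shockJump
  have : r ^ γ ≤ m ^ γ := Real.rpow_le_rpow hr.le hrm (by linarith)
  have e : κ * (r ^ γ - m ^ γ) * (r - m) / (r * m) = κ * (m ^ γ - r ^ γ) * (m - r) / (m * r) := by
    rw [mul_comm r m]; ring
  rw [e, Real.sq_sqrt]
  have : 0 < m := hr.trans_le hrm
  exact div_nonneg (mul_nonneg (mul_nonneg hκ.le (by linarith)) (by linarith)) (by positivity)

lemma shockJump_nonneg (r m : ℝ) : 0 ≤ shockJump κ γ r m := Real.sqrt_nonneg _

/-- Cauchy-Schwarz: the velocity jump of a shock exceeds the one of a rarefaction. -/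
lemma width_sub_le_shockJump (hκ : 0 < κ) (h₁ : 1 < γ) {r m : ℝ} (hr : 0 < r) (hrm : r ≤ m) :
    width κ γ m - width κ γ r ≤ shockJump κ γ m r := by
  have hm : 0 < m := hr.trans_le hrm
  have hθ := theta_pos h₁
  refine (le_abs_self _).trans (abs_le_of_sq_le_sq ?_ (shockJump_nonneg _ _))
  rw [sq_shockJump hκ h₁ hr hrm]
  have h0 : (0 : ℝ) ∉ Set.uIcc r m := by
    rw [Set.uIcc_of_le hrm]; exact fun h => absurd h.1 (not_le.2 hr)
  have hi : ∀ s : ℝ, IntervalIntegrable (fun x : ℝ => x ^ s) volume r m :=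
    fun s => intervalIntegral.intervalIntegrable_rpow (Or.inr h0)
  -- The quadratic polynomial in `c` is `∫ (c x^θ - x⁻¹)² dx ≥ 0`, as `x^(2θ) = x^(γ-1)`. Its
  -- discriminant gives `(∫ x^(θ-1))² ≤ ∫ x^(γ-1) * ∫ x^(-2)`.
  have disc := discrim_le_zero (a := ∫ x in r..m, x ^ (γ - 1))
    (b := -2 * ∫ x in r..m, x ^ (theta γ - 1)) (c := ∫ x in r..m, x ^ (-2 : ℝ)) (by
      intro c
      have e : (∫ x in r..m, x ^ (γ - 1)) * (c * c) + -2 * (∫ x in r..m, x ^ (theta γ - 1)) * c +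
          (∫ x in r..m, x ^ (-2 : ℝ)) =
          ∫ x in r..m, (x ^ (γ - 1) * (c * c) + -2 * x ^ (theta γ - 1) * c + x ^ (-2 : ℝ)) := by
        rw [intervalIntegral.integral_add (((hi _).mul_const _).add
          (((hi _).const_mul _).mul_const _)) (hi _),
          intervalIntegral.integral_add ((hi _).mul_const _) (((hi _).const_mul _).mul_const _),
          intervalIntegral.integral_mul_const, intervalIntegral.integral_mul_const,
          intervalIntegral.integral_const_mul]
      rw [e]
      apply intervalIntegral.integral_nonneg hrm
      intro x hx
      have hx0 : 0 < x := hr.trans_le hx.1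
      have e1 : x ^ (γ - 1) = x ^ theta γ * x ^ theta γ := by
        rw [← Real.rpow_add hx0]; congr 1; unfold theta; ring
      have e2 : x ^ (theta γ - 1) = x ^ theta γ * x⁻¹ := by
        rw [Real.rpow_sub_one hx0.ne', div_eq_mul_inv]
      have e3 : x ^ (-2 : ℝ) = x⁻¹ * x⁻¹ := by
        rw [Real.rpow_neg hx0.le, ← mul_inv, Real.rpow_two, sq]
      rw [e1, e2, e3]
      nlinarith [sq_nonneg (c * x ^ theta γ - x⁻¹)])
  unfold discrim at disc
  rw [integral_rpow (Or.inl (by linarith)), integral_rpow (Or.inl (by linarith)),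
    integral_rpow (Or.inr ⟨by norm_num, h0⟩)] at disc
  have e4 : ∀ x : ℝ, 0 < x → x ^ ((-2 : ℝ) + 1) = x⁻¹ := fun x hx => by
    rw [show (-2 : ℝ) + 1 = -1 by norm_num, Real.rpow_neg_one]
  rw [e4 r hr, e4 m hm, sub_add_cancel, sub_add_cancel] at disc
  have hk := theta_mul_aConst_sq hκ h₁
  have hγ : 0 < γ := by linarith
  have d2 : ((m ^ theta γ - r ^ theta γ) / theta γ) ^ 2 ≤
      (m ^ γ - r ^ γ) / γ * ((m - r) / (m * r)) := by
    have e5 : (m⁻¹ - r⁻¹) / (-2 + 1) = (m - r) / (m * r) := by field_simp; ring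
    rw [e5] at disc
    linarith
  unfold width
  calc (aConst κ γ * m ^ theta γ - aConst κ γ * r ^ theta γ) ^ 2
      = (theta γ * aConst κ γ) ^ 2 * ((m ^ theta γ - r ^ theta γ) / theta γ) ^ 2 := by
        field_simp
    _ ≤ κ * γ * ((m ^ γ - r ^ γ) / γ * ((m - r) / (m * r))) := by rw [hk]; gcongr
    _ = _ := by field_simp

/-- The state behind a receding shock is supersonic, with a quantitative bound. -/
lemma supersonic_of_shock (hκ : 0 < κ) (h₁ : 1 < γ) (h₃ : γ < 3) {r m Um Ur : ℝ} (hr : 0 < r)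
    (hrm : r < m) (hUm : 0 ≤ Um) (hUr : Ur = Um + shockJump κ γ m r) (hflux : r * Ur ≤ m * Um) :
    theta γ * width κ γ r ≤ Ur ∧
      (1 + theta γ ^ 2 / (2 * γ)) * width κ γ m ≤ Ur + width κ γ r := by
  have hm : 0 < m := hr.trans hrm
  have hθ := theta_pos h₁
  have hθ1 := theta_lt_one h₃
  have hγ : 0 < γ := by linarith
  have hJ := shockJump_nonneg (κ := κ) (γ := γ) m r
  have hUr0 : 0 ≤ Ur := by linarith
  have hJ2 := sq_shockJump hκ h₁ hr hrm.le
  have hJle : m * shockJump κ γ m r ≤ (m - r) * Ur := by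
    have : shockJump κ γ m r = Ur - Um := by linarith
    rw [this]; linarith
  have hmr : 0 < m - r := by linarith
  -- The mass flux inequality bounds the jump by `(m - r) Ur / m`; squaring and inserting the
  -- Rankine-Hugoniot formula gives a lower bound for `Ur` in terms of the pressures.
  have hE : κ * (m ^ γ - r ^ γ) * m ≤ Ur ^ 2 * ((m - r) * r) := by
    have h := pow_le_pow_left₀ (by positivity) hJle 2
    rw [mul_pow, hJ2, mul_pow] at h
    have e : m ^ 2 * (κ * (m ^ γ - r ^ γ) * (m - r) / (m * r)) =
        (m - r) / r * (κ * (m ^ γ - r ^ γ) * m) := by field_simp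
    rw [e, show (m - r) ^ 2 * Ur ^ 2 = (m - r) / r * (Ur ^ 2 * ((m - r) * r)) by field_simp] at h
    exact le_of_mul_le_mul_left h (by positivity)
  have hw : ∀ {x : ℝ}, 0 < x → (theta γ * width κ γ x) ^ 2 = κ * γ * x ^ (γ - 1) := by
    intro x hx
    rw [mul_pow, width_sq hx.le, ← mul_assoc, ← mul_pow, theta_mul_aConst_sq hκ h₁]
  have hpow : ∀ {x : ℝ}, 0 < x → x ^ γ = x ^ (γ - 1) * x := by
    intro x hx
    rw [Real.rpow_sub_one hx.ne', div_mul_cancel₀ _ hx.ne']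
  constructor
  · refine (le_abs_self _).trans (abs_le_of_sq_le_sq ?_ hUr0)
    rw [hw hr]
    have bern : γ * r ^ (γ - 1) * (m - r) ≤ m ^ γ - r ^ γ := by
      have := one_add_mul_self_le_rpow_one_add (s := (m - r) / r)
        (by linarith [div_pos hmr hr]) h₁.le
      rw [show 1 + (m - r) / r = m / r by field_simp; ring, Real.div_rpow hm.le hr.le,
        le_div_iff₀ (by positivity), hpow hr] at this
      have e : (1 + γ * ((m - r) / r)) * (r ^ (γ - 1) * r) =
        r ^ (γ - 1) * r + γ * r ^ (γ - 1) * (m - r) := by field_simp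
      rw [e] at this
      rw [hpow hr]
      linarith
    have h1 : κ * (γ * r ^ (γ - 1) * (m - r)) * r ≤ Ur ^ 2 * ((m - r) * r) := by
      refine le_trans ?_ hE
      have h0 : 0 ≤ κ * (γ * r ^ (γ - 1) * (m - r)) := by positivity
      have h1 := mul_le_mul_of_nonneg_left bern hκ.le
      exact mul_le_mul h1 hrm.le hr.le (h0.trans h1)
    have e : κ * (γ * r ^ (γ - 1) * (m - r)) * r = κ * γ * r ^ (γ - 1) * ((m - r) * r) := by ring
    rw [e] at h1
    exact le_of_mul_le_mul_right h1 (by positivity)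
  · have hA := width_pos hκ h₁ hm
    set A := width κ γ m with hAdef
    set e := theta γ ^ 2 / γ with he
    have he0 : 0 < e := by positivity
    have he1 : e ≤ 1 := by
      rw [he, div_le_one hγ]; nlinarith
    have hk : theta γ ^ 2 / (2 * γ) = e / 2 := by rw [he]; field_simp
    rw [hk]
    have hEA : e * A ^ 2 * m ≤ Ur ^ 2 * r := by
      have h1 : m ^ (γ - 1) * (m - r) ≤ m ^ γ - r ^ γ := by
        rw [hpow hm, hpow hr]
        have : r ^ (γ - 1) ≤ m ^ (γ - 1) := Real.rpow_le_rpow hr.le hrm.le (by linarith)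
        nlinarith
      have h2 : κ * (m ^ (γ - 1) * (m - r)) * m ≤ Ur ^ 2 * ((m - r) * r) :=
        le_trans (by gcongr) hE
      have h3 : κ * m ^ (γ - 1) = e * A ^ 2 := by
        have := hw hm
        rw [← hAdef] at this
        rw [he]
        field_simp
        linarith
      have h4 : (m - r) * (e * A ^ 2 * m) ≤ (m - r) * (Ur ^ 2 * r) := by
        rw [← h3]; linarith
      exact le_of_mul_le_mul_left h4 hmr
    have hAr := width_nonneg hκ h₁ hr.le
    -- If `r` is small relative to `m`, the bound `hEA` alone gives `Ur ≥ 2A ≥ (1 + e/2) A`.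
    -- Otherwise the mass flux inequality gives `Um ≥ (e/2) A`, and the jump is at least `A - width
    -- r`.
    rcases le_or_gt (4 * r) (e * m) with hq | hq
    · have h1 : (2 * A) ^ 2 ≤ Ur ^ 2 := by
        have : (2 * A) ^ 2 * r ≤ Ur ^ 2 * r := by
          refine le_trans ?_ hEA
          nlinarith [sq_nonneg A]
        exact le_of_mul_le_mul_right this hr
      have h2 := (le_abs_self _).trans (abs_le_of_sq_le_sq h1 hUr0)
      nlinarith
    · have h1 : A - width κ γ r ≤ shockJump κ γ m r := width_sub_le_shockJump hκ h₁ hr hrm.le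
      have h2 : e / 2 * A ≤ Um := by
        refine (le_abs_self _).trans (abs_le_of_sq_le_sq ?_ hUm)
        have h3 := pow_le_pow_left₀ (by positivity) hflux 2
        rw [mul_pow, mul_pow] at h3
        have h4 : r * (e * A ^ 2 * m) ≤ m ^ 2 * Um ^ 2 := by
          refine le_trans ?_ h3
          rw [show r ^ 2 * Ur ^ 2 = r * (Ur ^ 2 * r) by ring]
          gcongr
        have h5 : m * (e * A ^ 2 * r) ≤ m * (m * Um ^ 2) := by linarith
        have h6 := le_of_mul_le_mul_left h5 hm
        have h7 : m * (e / 2 * A) ^ 2 ≤ m * Um ^ 2 := by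
          refine le_trans ?_ h6
          have := mul_le_mul_of_nonneg_left hq.le (by positivity : 0 ≤ e * A ^ 2 / 4)
          linarith
        exact le_of_mul_le_mul_left h7 hm
      linarith

end Shock

/-! ### Lax solutions -/

section Lax

variable {κ γ : ℝ}

lemma omega1_eq (s : ℝ × ℝ) : omega1 κ γ s = s.2 - width κ γ s.1 := rfl

lemma omega2_eq (s : ℝ × ℝ) : omega2 κ γ s = s.2 + width κ γ s.1 := rfl

lemma lambda1_eq (h₁ : 1 < γ) (s : ℝ × ℝ) :
    lambda1 κ γ s = s.2 - theta γ * width κ γ s.1 := by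
  unfold lambda1 width; rw [sqrt_eq h₁, mul_assoc]

lemma lambda2_eq (h₁ : 1 < γ) (s : ℝ × ℝ) :
    lambda2 κ γ s = s.2 + theta γ * width κ γ s.1 := by
  unfold lambda2 width; rw [sqrt_eq h₁, mul_assoc]

lemma continuous_fan1 (h₁ : 1 < γ) (l : ℝ × ℝ) : Continuous (fan1 κ γ l) := by
  unfold fan1
  have h0 : 0 ≤ 1 / theta γ := (one_div_pos.2 (theta_pos h₁)).le
  refine Continuous.prodMk (Continuous.rpow_const (by fun_prop) fun _ => Or.inr h0) (by fun_prop)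

lemma continuous_fan2 (h₁ : 1 < γ) (r : ℝ × ℝ) : Continuous (fan2 κ γ r) := by
  unfold fan2
  have h0 : 0 ≤ 1 / theta γ := (one_div_pos.2 (theta_pos h₁)).le
  refine Continuous.prodMk (Continuous.rpow_const (by fun_prop) fun _ => Or.inr h0) (by fun_prop)

lemma width_rpow (h₁ : 1 < γ) {y : ℝ} (hy : 0 ≤ y) :
    width κ γ (y ^ (1 / theta γ)) = aConst κ γ * y := by
  unfold width
  rw [← Real.rpow_mul hy, one_div_mul_cancel (theta_pos h₁).ne', Real.rpow_one]

/-- Inside the 1-fan: `ω₂` is constant and `λ₁ = ξ`. -/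
lemma fan1_spec (hκ : 0 < κ) (h₁ : 1 < γ) {l : ℝ × ℝ} {ξ : ℝ} (hξ : ξ ≤ omega2 κ γ l) :
    0 ≤ (fan1 κ γ l ξ).1 ∧
    (fan1 κ γ l ξ).2 + width κ γ (fan1 κ γ l ξ).1 = omega2 κ γ l ∧
    (fan1 κ γ l ξ).2 - theta γ * width κ γ (fan1 κ γ l ξ).1 = ξ ∧
    (1 + theta γ) * width κ γ (fan1 κ γ l ξ).1 = omega2 κ γ l - ξ := by
  have ha := aConst_pos hκ h₁
  have hθ := theta_pos h₁
  have hd : 0 < aConst κ γ + Real.sqrt (κ * γ) := by positivity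
  set y := (omega2 κ γ l - ξ) / (aConst κ γ + Real.sqrt (κ * γ)) with hy
  have hy0 : 0 ≤ y := div_nonneg (by linarith) hd.le
  have e : y * (aConst κ γ + Real.sqrt (κ * γ)) = omega2 κ γ l - ξ := div_mul_cancel₀ _ hd.ne'
  have e1 : fan1 κ γ l ξ = (y ^ (1 / theta γ), ξ + Real.sqrt (κ * γ) * y) := rfl
  rw [e1]
  simp only
  rw [width_rpow h₁ hy0]
  rw [sqrt_eq h₁] at e ⊢
  exact ⟨Real.rpow_nonneg hy0 _, by linarith, by ring, by linarith⟩

/-- Inside the 2-fan: `ω₁` is constant and `λ₂ = ξ`. -/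
lemma fan2_spec (hκ : 0 < κ) (h₁ : 1 < γ) {r : ℝ × ℝ} {ξ : ℝ} (hξ : omega1 κ γ r ≤ ξ) :
    0 ≤ (fan2 κ γ r ξ).1 ∧
    (fan2 κ γ r ξ).2 - width κ γ (fan2 κ γ r ξ).1 = omega1 κ γ r ∧
    (fan2 κ γ r ξ).2 + theta γ * width κ γ (fan2 κ γ r ξ).1 = ξ ∧
    (1 + theta γ) * width κ γ (fan2 κ γ r ξ).1 = ξ - omega1 κ γ r := by
  have ha := aConst_pos hκ h₁
  have hθ := theta_pos h₁
  have hd : 0 < aConst κ γ + Real.sqrt (κ * γ) := by positivity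
  set y := (ξ - omega1 κ γ r) / (aConst κ γ + Real.sqrt (κ * γ)) with hy
  have hy0 : 0 ≤ y := div_nonneg (by linarith) hd.le
  have e : y * (aConst κ γ + Real.sqrt (κ * γ)) = ξ - omega1 κ γ r := div_mul_cancel₀ _ hd.ne'
  have e1 : fan2 κ γ r ξ = (y ^ (1 / theta γ), ξ - Real.sqrt (κ * γ) * y) := rfl
  rw [e1]
  simp only
  rw [width_rpow h₁ hy0]
  rw [sqrt_eq h₁] at e ⊢
  exact ⟨Real.rpow_nonneg hy0 _, by linarith, by ring, by linarith⟩

lemma tendsto_of_eq_on_Ioo {w f : ℝ → ℝ × ℝ} {δ : ℝ} (hδ : 0 < δ) (hf : ContinuousAt f 0)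
    (h : ∀ ξ, 0 < ξ → ξ < δ → w ξ = f ξ) : Tendsto w (𝓝[>] 0) (𝓝 (f 0)) := by
  refine (hf.tendsto.mono_left nhdsWithin_le_nhds).congr' ?_
  filter_upwards [Ioo_mem_nhdsGT hδ] with ξ hξ
  exact (h ξ hξ.1 hξ.2).symm

/-- A Lax solution whose left state has velocity `0` has a limit at `x / t = 0+`, which is
classified, and the mass flux can only be nonpositive if the right state moves fast enough. -/
lemma IsLaxProfile.exists_trace (hκ : 0 < κ) (h₁ : 1 < γ) (h₃ : γ < 3) {ρ : ℝ} (hρ : 0 ≤ ρ)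
    {r : ℝ × ℝ} {w : ℝ → ℝ × ℝ} (hw : IsLaxProfile κ γ (ρ, 0) r w) :
    ∃ s, Tendsto w (𝓝[>] 0) (𝓝 s) ∧ 0 ≤ s.1 ∧ IsBoundaryState κ γ (width κ γ ρ) s ∧
      (s.1 * s.2 ≤ 0 → width κ γ ρ = 0 ∨ width κ γ ρ ≤ -omega1 κ γ r) := by
  have hθ := theta_pos h₁
  have hθ1 := theta_lt_one h₃
  have hW := width_nonneg hκ h₁ hρ
  -- The constant `θ²/(2γ)` is dictated by shocks; sonic and supersonic states of 2-rarefactions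
  -- give the larger factor `1 + θ`.
  have hk : theta γ ^ 2 / (2 * γ) ≤ theta γ := by
    rw [div_le_iff₀ (by linarith)]; nlinarith
  have hl1 : lambda1 κ γ (ρ, 0) = -(theta γ * width κ γ ρ) := by rw [lambda1_eq h₁]; simp
  have ho2 : omega2 κ γ (ρ, 0) = width κ γ ρ := by rw [omega2_eq]; simp
  -- the sonic state of the 1-fan
  have sonic1 : 0 < ρ → 0 ≤ (fan1 κ γ (ρ, 0) 0).1 ∧
      IsBoundaryState κ γ (width κ γ ρ) (fan1 κ γ (ρ, 0) 0) ∧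
      0 < (fan1 κ γ (ρ, 0) 0).1 * (fan1 κ γ (ρ, 0) 0).2 := by
    intro hρ0
    have hW0 := width_pos hκ h₁ hρ0
    obtain ⟨f1, f2, f3, f4⟩ := fan1_spec (ξ := 0) hκ h₁ (ho2 ▸ hW)
    rw [ho2] at f2 f4
    have f5 : 0 < width κ γ (fan1 κ γ (ρ, 0) 0).1 := by
      by_contra! h
      nlinarith
    have f6 : (fan1 κ γ (ρ, 0) 0).1 ≠ 0 := by
      intro h; rw [h, width_zero h₁] at f5; exact lt_irrefl _ f5
    have f7 : 0 < theta γ * width κ γ (fan1 κ γ (ρ, 0) 0).1 := by positivity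
    refine ⟨f1, Or.inl ⟨by linarith, by linarith, by linarith⟩,
      mul_pos (lt_of_le_of_ne f1 f6.symm) (by linarith)⟩
  rcases hw with ⟨m, ⟨hl0, hm0, hm⟩, ⟨-, hr0, hrm⟩, hw⟩ | ⟨hvac, hw⟩
  · simp only at hl0 hm0 hm hr0
    have hAm := width_pos hκ h₁ hm0
    have hAr := width_pos hκ h₁ hr0
    have hW0 := width_pos hκ h₁ hl0
    rcases lt_or_ge 0 m.2 with hm2 | hm2
    · -- outflow through a 1-rarefaction
      have hmρ : m.1 ≤ ρ ∧ m.2 + width κ γ m.1 = width κ γ ρ := by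
        rcases hm with ⟨h1, h2⟩ | ⟨h1, h2⟩
        · exact ⟨h1, by unfold width; linarith⟩
        · linarith [shockJump_nonneg (κ := κ) (γ := γ) ρ m.1]
      have hw' : ∀ ξ, 0 < ξ → ξ < m.2 →
          w ξ = if ξ < lambda1 κ γ m then fan1 κ γ (ρ, 0) ξ else m := by
        intro ξ h1 h2
        rw [hw ξ, if_pos h2, wave1, if_pos hmρ.1, if_neg]
        rw [hl1, not_le]
        exact lt_of_le_of_lt (by simp; positivity) h1
      rcases lt_or_ge 0 (lambda1 κ γ m) with hs | hs
      · obtain ⟨s1, s2, s3⟩ := sonic1 hl0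
        refine ⟨_, tendsto_of_eq_on_Ioo (lt_min hm2 hs) (continuous_fan1 h₁ _).continuousAt
          (fun ξ h1 h2 => ?_), s1, s2, fun h => absurd h (not_le.2 s3)⟩
        rw [hw' ξ h1 (h2.trans_le (min_le_left _ _)), if_pos (h2.trans_le (min_le_right _ _))]
      · refine ⟨m, tendsto_of_eq_on_Ioo (f := fun _ => m) hm2 continuousAt_const
          (fun ξ h1 h2 => ?_), hm0.le, Or.inl ⟨hm2.le, ?_, hmρ.2⟩,
          fun h => absurd h (not_le.2 (mul_pos hm0 hm2))⟩
        · rw [hw' ξ h1 h2, if_neg (by linarith)]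
        · rw [lambda1_eq h₁] at hs; linarith
    -- When the middle state does not move outwards, a 1-rarefaction has `width m = W - u(m) ≥ W`
    -- and a 1-shock increases the density.
    · have hWm : width κ γ ρ ≤ width κ γ m.1 := by
        rcases hm with ⟨h1, h2⟩ | ⟨h1, h2⟩
        · unfold width at *; linarith
        · exact width_mono hκ h₁ hρ h1.le
      have hw' : ∀ ξ, 0 < ξ → w ξ = wave2 κ γ m r ξ := by
        intro ξ h1
        rw [hw ξ, if_neg (by linarith)]
      rcases hrm with ⟨h1, h2⟩ | ⟨h1, h2⟩
      · -- 2-rarefaction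
        have ho1 : omega1 κ γ r = m.2 - width κ γ m.1 := by
          rw [omega1_eq]; unfold width; linarith
        have hfast : ∀ s : ℝ × ℝ, width κ γ ρ = 0 ∨ width κ γ ρ ≤ -omega1 κ γ r := by
          intro _; right; rw [ho1]; linarith
        rcases lt_or_ge 0 (lambda2 κ γ m) with hs | hs
        · refine ⟨m, tendsto_of_eq_on_Ioo (f := fun _ => m) hs continuousAt_const
            (fun ξ k1 k2 => ?_), hm0.le, Or.inr (Or.inl ⟨hm2, hWm⟩), fun _ => hfast r⟩
          rw [hw' ξ k1, wave2, if_pos h1, if_pos k2.le]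
        · rw [lambda2_eq h₁] at hs
          have hQ : ∀ s : ℝ × ℝ, s.2 - width κ γ s.1 = omega1 κ γ r →
              s.2 + theta γ * width κ γ s.1 ≤ 0 → 0 ≤ s.1 →
              IsBoundaryState κ γ (width κ γ ρ) s := by
            intro s k1 k2 k3
            have k4 := width_nonneg hκ h₁ k3
            have k5 : 0 ≤ theta γ * width κ γ s.1 := by positivity
            refine Or.inr (Or.inr ⟨by linarith, by linarith, ?_⟩)
            have k6 : (1 + theta γ ^ 2 / (2 * γ)) * width κ γ ρ ≤
                (1 + theta γ) * width κ γ m.1 := by gcongr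
            rw [ho1] at k1
            linarith
          have hw'' : ∀ ξ, 0 < ξ →
              w ξ = if ξ < lambda2 κ γ r then fan2 κ γ r ξ else r := by
            intro ξ k1
            rw [hw' ξ k1, wave2, if_pos h1, if_neg]
            rw [lambda2_eq h₁]; linarith
          rcases lt_or_ge 0 (lambda2 κ γ r) with hs' | hs'
          · have k0 : omega1 κ γ r ≤ 0 := by rw [ho1]; linarith
            obtain ⟨f1, f2, f3, f4⟩ := fan2_spec hκ h₁ k0
            refine ⟨_, tendsto_of_eq_on_Ioo hs' (continuous_fan2 h₁ r).continuousAt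
              (fun ξ k1 k2 => ?_), f1, hQ _ f2 f3.le f1, fun _ => hfast r⟩
            rw [hw'' ξ k1, if_pos k2]
          · refine ⟨r, tendsto_of_eq_on_Ioo (f := fun _ => r) one_pos continuousAt_const
              (fun ξ k1 k2 => ?_), hr0.le, hQ r rfl ?_ hr0.le, fun _ => hfast r⟩
            · rw [hw'' ξ k1, if_neg (by linarith)]
            · rwa [lambda2_eq h₁] at hs'
      · -- 2-shock
        have hJ : width κ γ m.1 - width κ γ r.1 ≤ shockJump κ γ m.1 r.1 :=
          width_sub_le_shockJump hκ h₁ hr0 h1.le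
        have hfast : width κ γ ρ = 0 ∨ width κ γ ρ ≤ -omega1 κ γ r := by
          right; rw [omega1_eq]; linarith
        have hw'' : ∀ ξ, 0 < ξ → w ξ = if ξ < shockSpeed m r then m else r := by
          intro ξ k1
          rw [hw' ξ k1, wave2, if_neg (not_le.2 h1)]
        rcases lt_or_ge 0 (shockSpeed m r) with hs | hs
        · refine ⟨m, tendsto_of_eq_on_Ioo (f := fun _ => m) hs continuousAt_const
            (fun ξ k1 k2 => ?_), hm0.le, Or.inr (Or.inl ⟨hm2, hWm⟩), fun _ => hfast⟩
          rw [hw'' ξ k1, if_pos k2]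
        · have hflux : r.1 * (-r.2) ≤ m.1 * (-m.2) := by
            unfold shockSpeed at hs
            rw [div_nonpos_iff] at hs
            rcases hs with hs | hs <;> linarith
          obtain ⟨k1, k2⟩ := supersonic_of_shock (Um := -m.2) (Ur := -r.2) hκ h₁ h₃ hr0 h1
            (by linarith) (by linarith) hflux
          refine ⟨r, tendsto_of_eq_on_Ioo (f := fun _ => r) one_pos continuousAt_const
              (fun ξ k1 k2 => ?_), hr0.le, Or.inr (Or.inr ⟨?_, k1, le_trans ?_ k2⟩), fun _ => hfast⟩
          · rw [hw'' ξ k1, if_neg (by linarith)]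
          · linarith [shockJump_nonneg (κ := κ) (γ := γ) m.1 r.1]
          · have : 0 < γ := by linarith
            gcongr
  · rcases hρ.eq_or_lt with rfl | hρ0
    · rw [width_zero h₁] at *
      have hQ : ∀ s : ℝ × ℝ, s.2 + theta γ * width κ γ s.1 ≤ 0 → 0 ≤ s.1 →
          IsBoundaryState κ γ 0 s := by
        intro s k2 k3
        have k4 := width_nonneg hκ h₁ k3
        have k5 : 0 ≤ theta γ * width κ γ s.1 := by positivity
        exact Or.inr (Or.inr ⟨by linarith, by linarith, by linarith⟩)
      have hw' : ∀ ξ, w ξ = if 0 < r.1 ∧ omega1 κ γ r < ξ then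
          if ξ < lambda2 κ γ r then fan2 κ γ r ξ else r else (0, 0) := by
        intro ξ
        rw [hw ξ, vacuumFans, if_neg (by simp)]
      by_cases hr1 : 0 < r.1 ∧ omega1 κ γ r ≤ 0
      · have hw'' : ∀ ξ, 0 < ξ → w ξ = if ξ < lambda2 κ γ r then fan2 κ γ r ξ else r := by
          intro ξ k1
          rw [hw', if_pos ⟨hr1.1, hr1.2.trans_lt k1⟩]
        rcases lt_or_ge 0 (lambda2 κ γ r) with hs' | hs'
        · obtain ⟨f1, f2, f3, f4⟩ := fan2_spec hκ h₁ hr1.2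
          refine ⟨_, tendsto_of_eq_on_Ioo hs' (continuous_fan2 h₁ r).continuousAt
            (fun ξ k1 k2 => ?_), f1, hQ _ f3.le f1, fun _ => Or.inl rfl⟩
          rw [hw'' ξ k1, if_pos k2]
        · refine ⟨r, tendsto_of_eq_on_Ioo (f := fun _ => r) one_pos continuousAt_const
            (fun ξ k1 k2 => ?_), hr1.1.le, hQ r ?_ hr1.1.le, fun _ => Or.inl rfl⟩
          · rw [hw'' ξ k1, if_neg (by linarith)]
          · rwa [lambda2_eq h₁] at hs'
      · obtain ⟨δ, hδ, hδ'⟩ : ∃ δ : ℝ, 0 < δ ∧ (0 < r.1 → δ ≤ omega1 κ γ r) := by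
          by_cases h : 0 < r.1
          · exact ⟨omega1 κ γ r, by_contra fun h' => hr1 ⟨h, not_lt.1 h'⟩, fun _ => le_rfl⟩
          · exact ⟨1, one_pos, fun h' => absurd h' h⟩
        refine ⟨(0, 0), tendsto_of_eq_on_Ioo (f := fun _ => (0, 0)) hδ continuousAt_const
          (fun ξ k1 k2 => ?_), le_rfl, hQ _ (by simp [width_zero h₁]) le_rfl, fun _ => Or.inl rfl⟩
        rw [hw', if_neg]
        rintro ⟨k3, k4⟩
        linarith [hδ' k3]
    -- The 1-fan of `(ρ, 0)` occupies the rays between `-θ W` and `W`, so the ray `x / t = 0` lies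
    -- inside it and the trace is sonic.
    · obtain ⟨s1, s2, s3⟩ := sonic1 hρ0
      have hW0 := width_pos hκ h₁ hρ0
      refine ⟨_, tendsto_of_eq_on_Ioo hW0 (continuous_fan1 h₁ _).continuousAt
        (fun ξ k1 k2 => ?_), s1, s2, fun h => absurd h (not_le.2 s3)⟩
      rw [hw, vacuumFans, if_pos ⟨hρ0, by rwa [ho2]⟩, if_neg]
      rw [hl1, not_le]
      have : 0 < theta γ * width κ γ ρ := by positivity
      linarith

end Lax

/-! ### The Riemann problem -/

/-- The states whose Riemann invariants are bounded by `M`. -/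
def InBounds (κ γ M : ℝ) (s : ℝ × ℝ) : Prop :=
  s ∈ stateSpace ∧ -M ≤ omega1 κ γ s ∧ omega2 κ γ s ≤ M

section Riemann

variable {κ γ M : ℝ}

lemma stateSpace_nonneg {s : ℝ × ℝ} (hs : s ∈ stateSpace) : 0 ≤ s.1 := by
  rcases hs with h | ⟨h, -⟩
  · exact h.le
  · exact h.ge

lemma InBounds.conclusion (hκ : 0 < κ) (h₁ : 1 < γ) {s : ℝ × ℝ} (h : InBounds κ γ M s) :
    -M ≤ omega1 κ γ s ∧ omega1 κ γ s ≤ omega2 κ γ s ∧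
      (s ≠ (0, 0) → omega1 κ γ s < omega2 κ γ s) ∧ omega2 κ γ s ≤ M := by
  obtain ⟨hs, h1, h2⟩ := h
  refine ⟨h1, ?_, fun hne => ?_, h2⟩
  · rw [omega1_eq, omega2_eq]
    linarith [width_nonneg hκ h₁ (stateSpace_nonneg hs)]
  · rcases hs with h | ⟨h, h'⟩
    · rw [omega1_eq, omega2_eq]
      linarith [width_pos hκ h₁ h]
    · exact absurd (Prod.ext h h') hne

lemma inBounds_vacuum (h₁ : 1 < γ) (hM : 0 ≤ M) : InBounds κ γ M (0, 0) :=
  ⟨Or.inr ⟨rfl, rfl⟩, by rw [omega1_eq]; simp [width_zero h₁, hM],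
    by rw [omega2_eq]; simp [width_zero h₁, hM]⟩

lemma pos_of_omega_lt (h₁ : 1 < γ) {s : ℝ × ℝ} (hs : s ∈ stateSpace)
    (h : omega1 κ γ s < omega2 κ γ s) : 0 < s.1 := by
  rcases hs with h' | ⟨h', -⟩
  · exact h'
  · rw [omega1_eq, omega2_eq, h', width_zero h₁] at h
    linarith

/-- `λ₁ = ξ > 0` forces `u > 0`, so `ω₁ = 2u - ω₂ ≥ -M`. -/
lemma inBounds_fan1 (hκ : 0 < κ) (h₁ : 1 < γ) {l : ℝ × ℝ} {ξ : ℝ} (hξ0 : 0 < ξ)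
    (hξ : ξ < omega2 κ γ l) (hl : omega2 κ γ l ≤ M) : InBounds κ γ M (fan1 κ γ l ξ) := by
  have hθ := theta_pos h₁
  obtain ⟨f1, f2, f3, f4⟩ := fan1_spec hκ h₁ hξ.le
  have f5 := width_nonneg hκ h₁ f1
  have f6 : 0 ≤ theta γ * width κ γ (fan1 κ γ l ξ).1 := by positivity
  refine ⟨Or.inl (lt_of_le_of_ne f1 fun h => ?_), ?_, ?_⟩
  · rw [← h, width_zero h₁] at f4; linarith
  · rw [omega1_eq]; linarith
  · rw [omega2_eq]; linarith

/-- Along the fan `ω₁` is constant, and the half-width is at most that of `r` before the ray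
`λ₂(r)`, so `ω₂` does not exceed `ω₂(r)`. -/
lemma inBounds_fan2 (hκ : 0 < κ) (h₁ : 1 < γ) {r : ℝ × ℝ} {ξ : ℝ}
    (hξ : omega1 κ γ r < ξ) (hξ' : ξ < lambda2 κ γ r) (hr : InBounds κ γ M r) :
    InBounds κ γ M (fan2 κ γ r ξ) := by
  have hθ := theta_pos h₁
  obtain ⟨f1, f2, f3, f4⟩ := fan2_spec hκ h₁ hξ.le
  obtain ⟨-, r1, r2⟩ := hr
  rw [omega1_eq] at r1 f2 f4 hξ
  rw [omega2_eq] at r2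
  rw [lambda2_eq h₁] at hξ'
  have f7 : width κ γ (fan2 κ γ r ξ).1 ≤ width κ γ r.1 := by
    by_contra! h
    nlinarith
  refine ⟨Or.inl (lt_of_le_of_ne f1 fun h => ?_), ?_, ?_⟩
  · rw [← h, width_zero h₁] at f4; linarith
  · rw [omega1_eq]; linarith
  · rw [omega2_eq]; linarith

/-- Bounds for Lax solutions whose left state has velocity `0`. -/
lemma IsLaxProfile.inBounds (hκ : 0 < κ) (h₁ : 1 < γ) {ρ : ℝ} (hρ : 0 ≤ ρ) {r : ℝ × ℝ}
    {w : ℝ → ℝ × ℝ} (hw : IsLaxProfile κ γ (ρ, 0) r w) (hW : width κ γ ρ ≤ M)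
    (hr0 : 0 < r.1) (hr : InBounds κ γ M r) {ξ : ℝ} (hξ : 0 < ξ) : InBounds κ γ M (w ξ) := by
  have hθ := theta_pos h₁
  have hWn := width_nonneg hκ h₁ hρ
  have ho2 : omega2 κ γ (ρ, 0) = width κ γ ρ := by rw [omega2_eq]; simp
  have hl1 : lambda1 κ γ (ρ, 0) < ξ := by
    rw [lambda1_eq h₁]
    have : 0 ≤ theta γ * width κ γ ρ := by positivity
    simp only
    linarith
  have hr1 := hr.2.1
  rcases hw with ⟨m, ⟨hl0, hm0, hm⟩, ⟨-, -, hrm⟩, hw⟩ | ⟨hvac, hw⟩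
  · simp only at hl0 hm0 hm
    have hAm := width_pos hκ h₁ hm0
    have hom : omega1 κ γ r ≤ m.2 - width κ γ m.1 := by
      rw [omega1_eq]
      rcases hrm with ⟨h1, h2⟩ | ⟨h1, h2⟩
      · rw [h2]; unfold width; linarith
      · linarith [width_sub_le_shockJump hκ h₁ hr0 h1.le]
    have hmρ : 0 < m.2 → m.1 ≤ ρ ∧ m.2 + width κ γ m.1 = width κ γ ρ := by
      intro h
      rcases hm with ⟨h1, h2⟩ | ⟨h1, h2⟩
      · exact ⟨h1, by unfold width; linarith⟩
      · linarith [shockJump_nonneg (κ := κ) (γ := γ) ρ m.1]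
    -- A 2-wave gives `ω₁(m) ≥ ω₁(r)`. The upper bound is `ω₂(m) = W` for outflow; otherwise `u(m) ≤
    -- 0` gives `ω₂(m) ≤ -ω₁(m)`.
    have hmM : InBounds κ γ M m := by
      refine ⟨Or.inl hm0, by rw [omega1_eq]; linarith, ?_⟩
      rw [omega2_eq]
      rcases lt_or_ge 0 m.2 with h | h
      · linarith [hmρ h]
      · linarith
    rw [hw ξ]
    split_ifs with h
    · obtain ⟨k1, k2⟩ := hmρ (hξ.trans h)
      rw [wave1, if_pos k1, if_neg (not_le.2 hl1)]
      split_ifs with h'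
      · apply inBounds_fan1 hκ h₁ hξ _ (ho2 ▸ hW)
        rw [ho2]
        linarith
      · exact hmM
    · unfold wave2
      split_ifs with h1 h2 h3 h4
      · exact hmM
      · refine inBounds_fan2 hκ h₁ ?_ h3 hr
        rw [lambda2_eq h₁] at h2
        have : 0 < theta γ * width κ γ m.1 := by positivity
        linarith
      · exact hr
      · exact hmM
      · exact hr
  · rw [hw ξ]
    unfold vacuumFans
    split_ifs with h1 h2 h3 h4
    · exact absurd h2 (not_le.2 hl1)
    · exact inBounds_fan1 hκ h₁ hξ h1.2 (ho2 ▸ hW)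
    · exact inBounds_fan2 hκ h₁ h3.2 h4 hr
    · exact hr
    · exact inBounds_vacuum h₁ (hWn.trans hW)

/-- Intervals `(0, δ)` have positive measure; this makes essential limits unique. -/
instance : (𝓝[>] (0 : ℝ) ⊓ ae volume).NeBot := by
  rw [inf_comm, Filter.neBot_iff, ne_eq, ← Filter.empty_mem_iff_bot, Filter.mem_inf_iff]
  rintro ⟨s, hs, t, ht, h⟩
  obtain ⟨δ, hδ, hδt⟩ := mem_nhdsGT_iff_exists_Ioo_subset.1 ht
  have h1 : volume (Set.Ioo 0 δ) ≤ volume sᶜ := by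
    apply measure_mono
    intro x hx hxs
    have : x ∈ s ∩ t := ⟨hxs, hδt hx⟩
    rw [← h] at this
    exact this
  rw [mem_ae_iff.1 hs, Real.volume_Ioo, nonpos_iff_eq_zero, ENNReal.ofReal_eq_zero] at h1
  simp only [Set.mem_Ioi] at hδ
  linarith

/-- The mass flux of the essential right trace of a function which agrees a.e. with one that has
a right limit. -/
lemma IsRightTrace.flux_eq {f g : ℝ → ℝ × ℝ} {b s : ℝ × ℝ} (h : IsRightTrace f b)
    (hg : Tendsto g (𝓝[>] 0) (𝓝 s)) (hfg : ∀ᵐ x ∂(volume.restrict (Set.Ioi (0 : ℝ))), f x = g x) :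
    b.1 * b.2 = s.1 * s.2 := by
  have h1 : Tendsto (fun x => conserved (g x)) (𝓝[>] 0 ⊓ ae volume) (𝓝 (conserved s)) := by
    have hc : Continuous conserved := by unfold conserved; fun_prop
    exact (hc.continuousAt.tendsto.comp hg).mono_left inf_le_left
  have h2 : (fun x => conserved (f x)) =ᶠ[𝓝[>] 0 ⊓ ae volume] fun x => conserved (g x) := by
    rw [ae_restrict_iff' measurableSet_Ioi] at hfg
    have k1 : ∀ᶠ x in 𝓝[>] (0 : ℝ) ⊓ ae volume, x ∈ Set.Ioi (0 : ℝ) :=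
      (eventually_mem_nhdsWithin).filter_mono inf_le_left
    have k2 := hfg.filter_mono (inf_le_right (a := 𝓝[>] (0 : ℝ)))
    filter_upwards [k1, k2] with x k1 k2
    rw [k2 k1]
  exact congrArg Prod.snd (tendsto_nhds_unique (h.2.congr' h2) h1)

lemma pipe_eq_prod (T : EReal) : volume.restrict (pipe T) =
    (volume.restrict (openTimes T)).prod (volume.restrict (Set.Ioi (0 : ℝ))) := by
  unfold pipe
  rw [Measure.volume_eq_prod, Measure.prod_restrict]

lemma openTimes_top : openTimes ⊤ = Set.Ioi 0 := by
  ext t; simp [openTimes]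

/-- Not all mass fluxes at the junction can be positive. In a pipe with nonpositive flux,
`exists_trace` bounds `W` by `-ω₁` of the initial state unless `W = 0`, so `W ≤ M`, and this single
bound serves all pipes. -/
theorem riemann_bounds (hκ : 0 < κ) (h₁ : 1 < γ) (h₃ : γ < 3) {d : ℕ} {A : Fin d → ℝ}
    (hA : ∀ k, 0 < A k) {i : Fin d → ℝ × ℝ} {s : Fin d → ℝ → ℝ → ℝ × ℝ}
    (hs : IsRiemannSolution κ γ A i s)
    (hi : ∀ k, -M ≤ omega1 κ γ (i k) ∧ omega1 κ γ (i k) < omega2 κ γ (i k) ∧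
      omega2 κ γ (i k) ≤ M) (k : Fin d) :
    ∀ᵐ z ∂(volume.restrict (pipe ⊤)), InBounds κ γ M (s k z.1 z.2) := by
  obtain ⟨ρ, hρ, hlax⟩ := hs.lax
  choose w hw hsw using hlax
  choose s₀ hs₀ _ _ hfast using fun k => (hw k).exists_trace hκ h₁ h₃ hρ
  have hM : 0 ≤ M := by linarith [hi k]
  have hW : width κ γ ρ ≤ M := by
    have hae : ∀ᵐ t ∂(volume.restrict (Set.Ioi (0 : ℝ))), ∀ k,
        ∀ᵐ x ∂(volume.restrict (Set.Ioi (0 : ℝ))), s k t x = w k (x / t) := by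
      rw [ae_all_iff]
      intro k
      have := hsw k
      rw [pipe_eq_prod, openTimes_top] at this
      exact Measure.ae_ae_of_ae_prod this
    have hne : (ae (volume.restrict (Set.Ioi (0 : ℝ)))).NeBot := by
      rw [ae_neBot]
      simp
    obtain ⟨t, ht, ⟨b, hb, hsum⟩, ht0⟩ :=
      (hae.and (hs.mass_junction.and (ae_restrict_mem measurableSet_Ioi))).exists
    have hflux : ∀ k, (b k).1 * (b k).2 = (s₀ k).1 * (s₀ k).2 := by
      intro k
      refine (hb k).flux_eq (g := fun x => w k (x / t)) ((hs₀ k).comp ?_) (ht k)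
      refine tendsto_nhdsWithin_iff.2 ⟨?_, ?_⟩
      · have : Tendsto (fun x : ℝ => x / t) (𝓝 0) (𝓝 (0 / t)) :=
          (continuous_id.div_const t).tendsto 0
        rw [zero_div] at this
        exact this.mono_left nhdsWithin_le_nhds
      · filter_upwards [self_mem_nhdsWithin] with x hx
        exact div_pos (Set.mem_Ioi.1 hx) (Set.mem_Ioi.1 ht0)
    obtain ⟨k', hk'⟩ : ∃ k', (s₀ k').1 * (s₀ k').2 ≤ 0 := by
      by_contra! h
      have : 0 < ∑ k, A k * ((b k).1 * (b k).2) :=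
        Finset.sum_pos (fun k _ => mul_pos (hA k) (by rw [hflux k]; exact h k)) ⟨k, Finset.mem_univ k⟩
      linarith
    rcases hfast k' hk' with h | h
    · rw [h]; exact hM
    · linarith [(hi k').1]
  filter_upwards [hsw k, ae_restrict_mem (measurableSet_Ioi.prod measurableSet_Ioi |> fun h => by
    unfold pipe; rw [openTimes_top]; exact h)] with z hz hz0
  have hz1 : 0 < z.1 := by
    have := hz0.1; rw [openTimes_top] at this; exact this
  rw [hz]
  exact (hw k).inBounds hκ h₁ hρ hW (pos_of_omega_lt h₁ (hs.initial_mem k) (hi k).2.1)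
    ⟨hs.initial_mem k, (hi k).1, (hi k).2.2⟩ (div_pos hz0.2 hz1)

end Riemann

/-! ### Estimates for the entropies -/

section Estimates

variable {κ γ M : ℝ} {p : ℕ}

/-- Bounded states. -/
def IsBoundedState (C : ℝ) (s : ℝ × ℝ) : Prop := 0 ≤ s.1 ∧ s.1 ≤ C ∧ |s.2| ≤ C

lemma continuous_kineticMean (h₁ : 1 < γ) (h₃ : γ < 3) {f : ℝ × ℝ → ℝ → ℝ}
    (hf : Continuous (Function.uncurry f)) : Continuous fun s => kineticMean γ (f s) := by
  unfold kineticMean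
  apply Continuous.div_const
  apply intervalIntegral.continuous_parametric_intervalIntegral_of_continuous'
  exact ((continuous_weight h₁ h₃).comp continuous_snd).mul hf

lemma continuous_meanEta (h₁ : 1 < γ) (h₃ : γ < 3) : Continuous (meanEta κ γ (trunc M p)) := by
  have := continuous_width (κ := κ) h₁
  have := continuous_trunc (M := M) (p := p)
  unfold meanEta
  refine continuous_fst.mul (continuous_kineticMean h₁ h₃ ?_)
  simp only [Function.uncurry_def]
  fun_prop

lemma continuous_meanFlux (h₁ : 1 < γ) (h₃ : γ < 3) : Continuous (meanFlux κ γ (trunc M p)) := by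
  have := continuous_width (κ := κ) h₁
  have := continuous_trunc (M := M) (p := p)
  unfold meanFlux
  refine continuous_fst.mul (continuous_kineticMean h₁ h₃ ?_)
  simp only [Function.uncurry_def]
  fun_prop

lemma meanEta_nonneg (h₁ : 1 < γ) (h₃ : γ < 3) {s : ℝ × ℝ} (hs : 0 ≤ s.1) :
    0 ≤ meanEta κ γ (trunc M p) s := by
  refine mul_nonneg hs ?_
  rw [← kineticMean_const h₁ h₃ 0]
  have := continuous_trunc (M := M) (p := p)
  exact kineticMean_mono h₁ h₃ continuous_const (by fun_prop) fun _ _ => trunc_nonneg _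

lemma abs_velocity_le (hκ : 0 < κ) (h₁ : 1 < γ) {C θ : ℝ} (hθ : 0 ≤ θ) (hθ1 : θ ≤ 1) {s : ℝ × ℝ}
    (hs : IsBoundedState C s) {y : ℝ} (hy : y ∈ Set.Icc (-1 : ℝ) 1) :
    |s.2 + θ * (width κ γ s.1 * y)| ≤ C + width κ γ C := by
  have hA := width_nonneg hκ h₁ hs.1
  have hAC := width_mono hκ h₁ hs.1 hs.2.1
  refine (abs_add_le _ _).trans (add_le_add hs.2.2 ?_)
  rw [abs_mul, abs_mul, abs_of_nonneg hθ, abs_of_nonneg hA]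
  have hy1 : |y| ≤ 1 := abs_le.2 hy
  calc θ * (width κ γ s.1 * |y|) ≤ 1 * (width κ γ s.1 * 1) := by gcongr
    _ ≤ _ := by linarith

/-- Finite speed: the flux is bounded by the maximal speed times the entropy. -/
lemma abs_meanFlux_le (hκ : 0 < κ) (h₁ : 1 < γ) (h₃ : γ < 3) {C : ℝ} {s : ℝ × ℝ}
    (hs : IsBoundedState C s) :
    |meanFlux κ γ (trunc M p) s| ≤ (C + width κ γ C) * meanEta κ γ (trunc M p) s := by
  have hS := continuous_trunc (M := M) (p := p)
  have hb : ∀ y ∈ Set.Icc (-1 : ℝ) 1, |(s.2 + theta γ * (width κ γ s.1 * y)) *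
      trunc M p (s.2 + width κ γ s.1 * y)| ≤
      (C + width κ γ C) * trunc M p (s.2 + width κ γ s.1 * y) := by
    intro y hy
    rw [abs_mul, abs_of_nonneg (trunc_nonneg _)]
    exact mul_le_mul_of_nonneg_right
      (abs_velocity_le hκ h₁ (theta_pos h₁).le (theta_lt_one h₃).le hs hy) (trunc_nonneg _)
  unfold meanFlux meanEta
  rw [abs_mul, abs_of_nonneg hs.1, mul_left_comm, ← kineticMean_const_mul]
  refine mul_le_mul_of_nonneg_left (abs_le.2 ⟨?_, ?_⟩) hs.1
  · rw [← neg_one_mul, ← kineticMean_const_mul]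
    refine kineticMean_mono h₁ h₃ (by fun_prop) (by fun_prop) fun y hy => ?_
    rw [neg_one_mul]
    exact (abs_le.1 (hb y hy)).1
  · exact kineticMean_mono h₁ h₃ (by fun_prop) (by fun_prop) fun y hy => (abs_le.1 (hb y hy)).2

lemma abs_trunc_sub_le (hM : 0 ≤ M) {B v w : ℝ} (hv : |v| ≤ B) (hw : |w| ≤ B) :
    |trunc M p v - trunc M p w| ≤ p * B ^ (p - 1) * |v - w| := by
  unfold trunc
  have hB : 0 ≤ B := (abs_nonneg v).trans hv
  have h1 : |max (|v| - M) 0 - max (|w| - M) 0| ≤ |v - w| := by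
    refine (abs_max_sub_max_le_abs _ _ _).trans ?_
    rw [sub_sub_sub_cancel_right]
    exact abs_abs_sub_abs_le v w
  have h2 : ∀ x : ℝ, |x| ≤ B → |max (|x| - M) 0| ≤ B := by
    intro x hx
    rw [abs_of_nonneg (le_max_right _ _)]
    exact max_le (by linarith) hB
  refine (abs_pow_sub_pow_le _ _ _).trans ?_
  calc _ ≤ |v - w| * p * B ^ (p - 1) := by
        gcongr
        exact max_le (h2 v hv) (h2 w hw)
    _ = _ := by ring

/-- After division by `y`, this is `|r^θ - 1| ≤ |r - 1|` for `r = x/y`. The half-width is only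
Hölder continuous at vacuum; the factor of density restores a Lipschitz bound. -/
lemma mul_abs_rpow_sub_le {θ x y : ℝ} (hθ : 0 < θ) (hθ1 : θ ≤ 1) (hx : 0 ≤ x) (hy : 0 ≤ y) :
    y * |x ^ θ - y ^ θ| ≤ y ^ θ * |x - y| := by
  rcases hy.eq_or_lt with rfl | hy
  · simp [Real.zero_rpow hθ.ne']
  have hr : 0 ≤ x / y := div_nonneg hx hy.le
  have key : |(x / y) ^ θ - 1| ≤ |x / y - 1| := by
    rcases le_total 1 (x / y) with h | h
    · have h1 : 1 ≤ (x / y) ^ θ := Real.one_le_rpow h hθ.le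
      have h2 : (x / y) ^ θ ≤ x / y := by
        simpa using Real.rpow_le_rpow_of_exponent_le h hθ1
      rw [abs_of_nonneg (by linarith), abs_of_nonneg (by linarith)]
      linarith
    · have h1 : (x / y) ^ θ ≤ 1 := Real.rpow_le_one hr h hθ.le
      have h2 : x / y ≤ (x / y) ^ θ := by
        rcases hr.eq_or_lt with h0 | h0
        · rw [← h0, Real.zero_rpow hθ.ne']
        · simpa using Real.rpow_le_rpow_of_exponent_ge h0 h hθ1
      rw [abs_of_nonpos (by linarith), abs_of_nonpos (by linarith)]
      linarith
  have hyθ : 0 < y ^ θ := Real.rpow_pos_of_pos hy _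
  have h3 := mul_le_mul_of_nonneg_left key (mul_nonneg hy.le hyθ.le)
  rw [Real.div_rpow hx hy.le] at h3
  calc y * |x ^ θ - y ^ θ| = y * y ^ θ * |x ^ θ / y ^ θ - 1| := by
        rw [mul_assoc, ← abs_of_pos hyθ, ← abs_mul, abs_of_pos hyθ]
        congr 2; field_simp
    _ ≤ _ := h3
    _ = y ^ θ * |x - y| := by
        rw [mul_comm y, mul_assoc, ← abs_of_pos hy, ← abs_mul, abs_of_pos hy]
        congr 2; field_simp

/-- Averages of locally Lipschitz functions are Lipschitz in the conserved quantities. -/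
lemma abs_mul_kineticMean_sub_le (hκ : 0 < κ) (h₁ : 1 < γ) (h₃ : γ < 3) {C K : ℝ}
    (hK : 0 ≤ K) {f : ℝ → ℝ → ℝ → ℝ} (hf : ∀ u A, Continuous (f u A))
    (hbound : ∀ s, IsBoundedState C s → ∀ y ∈ Set.Icc (-1 : ℝ) 1, |f s.2 (width κ γ s.1) y| ≤ K)
    (hlip : ∀ s s', IsBoundedState C s → IsBoundedState C s' → ∀ y ∈ Set.Icc (-1 : ℝ) 1,
      |f s.2 (width κ γ s.1) y - f s'.2 (width κ γ s'.1) y| ≤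
        K * (|s.2 - s'.2| + |width κ γ s.1 - width κ γ s'.1|))
    {s s' : ℝ × ℝ} (hs : IsBoundedState C s) (hs' : IsBoundedState C s') :
    |s.1 * kineticMean γ (f s.2 (width κ γ s.1)) - s'.1 * kineticMean γ (f s'.2 (width κ γ s'.1))|
      ≤ K * (2 + C + width κ γ C) * ‖conserved s - conserved s'‖ := by
  have hθ := theta_pos h₁
  have ha := aConst_pos hκ h₁
  have hn1 : |s.1 - s'.1| ≤ ‖conserved s - conserved s'‖ := by
    simp [conserved]
  have hn2 : |s.1 * s.2 - s'.1 * s'.2| ≤ ‖conserved s - conserved s'‖ := by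
    simp [conserved]
  set n := ‖conserved s - conserved s'‖ with hn
  have hn0 : 0 ≤ n := norm_nonneg _
  set m := kineticMean γ (f s.2 (width κ γ s.1))
  set m' := kineticMean γ (f s'.2 (width κ γ s'.1))
  have b1 : |m| ≤ K := abs_kineticMean_le h₁ h₃ (hf _ _) (hbound s hs)
  have b2 : |m - m'| ≤ K * (|s.2 - s'.2| + |width κ γ s.1 - width κ γ s'.1|) := by
    rw [← kineticMean_sub h₁ h₃ (hf _ _) (hf _ _)]
    exact abs_kineticMean_le h₁ h₃ ((hf _ _).sub (hf _ _)) (hlip s s' hs hs')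
  -- Velocities are not controlled near vacuum, but `ρ'(u - u')` is a combination of differences of
  -- momentum and density.
  have b3 : s'.1 * |s.2 - s'.2| ≤ (1 + C) * n := by
    rw [← abs_of_nonneg hs'.1, ← abs_mul]
    calc |s'.1 * (s.2 - s'.2)| = |(s.1 * s.2 - s'.1 * s'.2) - (s.1 - s'.1) * s.2| := by
          congr 1; ring
      _ ≤ |s.1 * s.2 - s'.1 * s'.2| + |(s.1 - s'.1) * s.2| := abs_sub _ _
      _ ≤ n + n * C := by
          rw [abs_mul]
          gcongr
          exact hs.2.2
      _ = _ := by ring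
  have b4 : s'.1 * |width κ γ s.1 - width κ γ s'.1| ≤ width κ γ C * n := by
    have := mul_abs_rpow_sub_le hθ (theta_lt_one h₃).le hs.1 hs'.1
    have e : |width κ γ s.1 - width κ γ s'.1| =
        aConst κ γ * |s.1 ^ theta γ - s'.1 ^ theta γ| := by
      unfold width
      rw [← mul_sub, abs_mul, abs_of_pos ha]
    rw [e, mul_left_comm]
    calc _ ≤ aConst κ γ * (s'.1 ^ theta γ * |s.1 - s'.1|) := by gcongr
      _ = width κ γ s'.1 * |s.1 - s'.1| := by unfold width; ring
      _ ≤ _ := by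
        gcongr
        · exact width_nonneg hκ h₁ (hs'.1.trans hs'.2.1)
        · exact width_mono hκ h₁ hs'.1 hs'.2.1
  calc |s.1 * m - s'.1 * m'| = |(s.1 - s'.1) * m + s'.1 * (m - m')| := by congr 1; ring
    _ ≤ |(s.1 - s'.1) * m| + |s'.1 * (m - m')| := abs_add_le _ _
    _ ≤ n * K + s'.1 * (K * (|s.2 - s'.2| + |width κ γ s.1 - width κ γ s'.1|)) := by
        rw [abs_mul, abs_mul, abs_of_nonneg hs'.1]
        gcongr
        exact hs'.1
    _ = n * K + K * (s'.1 * |s.2 - s'.2| + s'.1 * |width κ γ s.1 - width κ γ s'.1|) := by ring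
    _ ≤ n * K + K * ((1 + C) * n + width κ γ C * n) := by gcongr
    _ = _ := by ring

/-- On bounded states, entropy and flux are bounded and Lipschitz in the conserved quantities. -/
lemma exists_lipschitz (hκ : 0 < κ) (h₁ : 1 < γ) (h₃ : γ < 3) (hM : 0 ≤ M) {C : ℝ} (hC : 0 ≤ C) :
    ∃ K, 0 ≤ K ∧ (∀ s s', IsBoundedState C s → IsBoundedState C s' →
      |meanEta κ γ (trunc M p) s - meanEta κ γ (trunc M p) s'| ≤
        K * ‖conserved s - conserved s'‖) ∧
      ∀ s s', IsBoundedState C s → IsBoundedState C s' →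
      |meanFlux κ γ (trunc M p) s - meanFlux κ γ (trunc M p) s'| ≤
        K * ‖conserved s - conserved s'‖ := by
  have hθ := theta_pos h₁
  have hS := continuous_trunc (M := M) (p := p)
  set B := C + width κ γ C with hBdef
  have hB : 0 ≤ B := add_nonneg hC (width_nonneg hκ h₁ hC)
  set L : ℝ := p * B ^ (p - 1) with hL
  have hL0 : 0 ≤ L := by positivity
  have hv : ∀ s, IsBoundedState C s → ∀ y ∈ Set.Icc (-1 : ℝ) 1, |s.2 + width κ γ s.1 * y| ≤ B := by
    intro s hs y hy
    simpa using abs_velocity_le hκ h₁ zero_le_one le_rfl hs hy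
  have hSB : ∀ v, |v| ≤ B → |trunc M p v| ≤ B ^ p := by
    intro v hv
    rw [abs_of_nonneg (trunc_nonneg _)]
    unfold trunc
    exact pow_le_pow_left₀ (le_max_right _ _) (max_le (by linarith) hB) _
  have hdist : ∀ (s s' : ℝ × ℝ) (θ y : ℝ), 0 ≤ θ → θ ≤ 1 → y ∈ Set.Icc (-1 : ℝ) 1 →
      |(s.2 + θ * (width κ γ s.1 * y)) - (s'.2 + θ * (width κ γ s'.1 * y))| ≤
        |s.2 - s'.2| + |width κ γ s.1 - width κ γ s'.1| := by
    intro s s' θ y h0 h1 hy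
    have e : (s.2 + θ * (width κ γ s.1 * y)) - (s'.2 + θ * (width κ γ s'.1 * y)) =
      (s.2 - s'.2) + (width κ γ s.1 - width κ γ s'.1) * (θ * y) := by ring
    rw [e]
    refine (abs_add_le _ _).trans (add_le_add le_rfl ?_)
    rw [abs_mul]
    apply mul_le_of_le_one_right (abs_nonneg _)
    rw [abs_mul, abs_of_nonneg h0]
    exact mul_le_one₀ h1 (abs_nonneg _) (abs_le.2 hy)
  have hlip : ∀ s s', IsBoundedState C s → IsBoundedState C s' → ∀ y ∈ Set.Icc (-1 : ℝ) 1,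
      |trunc M p (s.2 + width κ γ s.1 * y) - trunc M p (s'.2 + width κ γ s'.1 * y)| ≤
        L * (|s.2 - s'.2| + |width κ γ s.1 - width κ γ s'.1|) := by
    intro s s' hs hs' y hy
    refine (abs_trunc_sub_le hM (hv s hs y hy) (hv s' hs' y hy)).trans ?_
    have := hdist s s' 1 y zero_le_one le_rfl hy
    simp only [one_mul] at this
    gcongr
  set K := B ^ p + L + B * B ^ p + B * L with hK
  have hK0 : 0 ≤ K := by positivity
  have k1 : 0 ≤ B ^ p := by positivity
  have k2 : 0 ≤ B * B ^ p := by positivity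
  have k3 : 0 ≤ B * L := by positivity
  refine ⟨K * (2 + C + width κ γ C), by rw [add_assoc]; positivity, fun s s' hs hs' => ?_,
    fun s s' hs hs' => ?_⟩
  · refine abs_mul_kineticMean_sub_le (f := fun u A y => trunc M p (u + A * y)) hκ h₁ h₃ hK0
      (fun u A => by fun_prop) ?_ ?_ hs hs'
    · intro s hs y hy
      refine (hSB _ (hv s hs y hy)).trans (by linarith)
    · intro s s' hs hs' y hy
      exact (hlip s s' hs hs' y hy).trans (by gcongr; linarith)
  · refine abs_mul_kineticMean_sub_le
      (f := fun u A y => (u + theta γ * (A * y)) * trunc M p (u + A * y)) hκ h₁ h₃ hK0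
      (fun u A => by fun_prop) ?_ ?_ hs hs'
    · intro s hs y hy
      rw [abs_mul]
      calc _ ≤ B * B ^ p := mul_le_mul (abs_velocity_le hκ h₁ hθ.le (theta_lt_one h₃).le hs hy)
            (hSB _ (hv s hs y hy)) (abs_nonneg _) hB
        _ ≤ K := by linarith
    · intro s s' hs hs' y hy
      set δ := |s.2 - s'.2| + |width κ γ s.1 - width κ γ s'.1| with hδ
      have hδ0 : 0 ≤ δ := by positivity
      have e1 := hdist s s' (theta γ) y hθ.le (theta_lt_one h₃).le hy
      have e2 := hlip s s' hs hs' y hy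
      have e3 := hSB _ (hv s hs y hy)
      have e4 := abs_velocity_le hκ h₁ hθ.le (theta_lt_one h₃).le hs' hy
      generalize s.2 + theta γ * (width κ γ s.1 * y) = a at *
      generalize s'.2 + theta γ * (width κ γ s'.1 * y) = a' at *
      generalize trunc M p (s.2 + width κ γ s.1 * y) = b at *
      generalize trunc M p (s'.2 + width κ γ s'.1 * y) = b' at *
      calc |a * b - a' * b'| = |(a - a') * b + a' * (b - b')| := by congr 1; ring
        _ ≤ |(a - a') * b| + |a' * (b - b')| := abs_add_le _ _
        _ ≤ δ * B ^ p + B * (L * δ) := by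
          rw [abs_mul, abs_mul]
          exact add_le_add (mul_le_mul e1 e3 (abs_nonneg _) hδ0) (mul_le_mul e4 e2 (abs_nonneg _) hB)
        _ = (B ^ p + B * L) * δ := by ring
        _ ≤ K * δ := by gcongr; linarith

/-- The velocities that enter the average lie between the two Riemann invariants, where `S`
vanishes. -/
lemma meanEta_eq_zero (hκ : 0 < κ) (h₁ : 1 < γ) (h₃ : γ < 3) (hp : p ≠ 0) {s : ℝ × ℝ}
    (hs : InBounds κ γ M s) : meanEta κ γ (trunc M p) s = 0 := by
  obtain ⟨h, h1, h2⟩ := hs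
  rw [omega1_eq] at h1
  rw [omega2_eq] at h2
  have hA := width_nonneg hκ h₁ (stateSpace_nonneg h)
  have hS := continuous_trunc (M := M) (p := p)
  have : |kineticMean γ fun y => trunc M p (s.2 + width κ γ s.1 * y)| ≤ 0 := by
    refine abs_kineticMean_le h₁ h₃ (by fun_prop) fun y hy => ?_
    rw [trunc_eq_zero hp, abs_zero]
    rw [abs_le]
    constructor <;> nlinarith [hy.1, hy.2]
  unfold meanEta
  rw [abs_nonpos_iff.1 this, mul_zero]

/-- The averaging weight is positive on `(-1, 1)`, so a vanishing mean of a nonnegative continuous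
function forces `|v| ≤ M` there and, by closure, at `y = ±1`, where `v` is `ω₂` or `ω₁`. -/
lemma inBounds_of_meanEta_eq_zero (h₁ : 1 < γ) (h₃ : γ < 3) (hM : 0 ≤ M)
    {s : ℝ × ℝ} (hs : s ∈ stateSpace) (h : meanEta κ γ (trunc M p) s = 0) :
    InBounds κ γ M s := by
  rcases hs with hs0 | ⟨h1, h2⟩
  swap
  · have : s = (0, 0) := Prod.ext h1 h2
    rw [this]
    exact inBounds_vacuum h₁ hM
  have hS := continuous_trunc (M := M) (p := p)
  have hw := continuous_weight h₁ h₃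
  unfold meanEta kineticMean at h
  have h2 : ∫ y in (-1 : ℝ)..1, (1 - y ^ 2) ^ lam γ * trunc M p (s.2 + width κ γ s.1 * y) = 0 := by
    rcases mul_eq_zero.1 h with h | h
    · exact absurd h hs0.ne'
    · rcases div_eq_zero_iff.1 h with h | h
      · exact h
      · exact absurd h (jConst_pos h₁ h₃).ne'
  have hin : ∀ y ∈ Set.Ioo (-1 : ℝ) 1, |s.2 + width κ γ s.1 * y| ≤ M := by
    intro y hy
    by_contra hcon
    have hpos : 0 < trunc M p (s.2 + width κ γ s.1 * y) :=
      lt_of_le_of_ne (trunc_nonneg _) fun h0 => hcon (abs_le_of_trunc_eq_zero h0.symm)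
    have : 0 < ∫ y in (-1 : ℝ)..1, (1 - y ^ 2) ^ lam γ * trunc M p (s.2 + width κ γ s.1 * y) := by
      apply intervalIntegral.integral_pos (by norm_num)
      · exact (hw.mul (by fun_prop)).continuousOn
      · intro x hx
        exact mul_nonneg (weight_nonneg hx.1.le hx.2) (trunc_nonneg _)
      · exact ⟨y, ⟨hy.1.le, hy.2.le⟩,
          mul_pos (Real.rpow_pos_of_pos (by nlinarith [hy.1, hy.2]) _) hpos⟩
    linarith
  have hcl : ∀ y ∈ Set.Icc (-1 : ℝ) 1, |s.2 + width κ γ s.1 * y| ≤ M := by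
    rw [← closure_Ioo (by norm_num : (-1 : ℝ) ≠ 1)]
    have : IsClosed {y : ℝ | |s.2 + width κ γ s.1 * y| ≤ M} :=
      isClosed_le (by fun_prop) continuous_const
    exact fun y hy => closure_minimal (fun y hy => hin y hy) this hy
  have e1 := abs_le.1 (hcl 1 (by norm_num))
  have e2 := abs_le.1 (hcl (-1) (by norm_num))
  exact ⟨Or.inl hs0, by rw [omega1_eq]; linarith, by rw [omega2_eq]; linarith⟩

end Estimates

/-! ### Cutoff functions -/

section Cutoff

lemma contDiff_smoothTransition : ContDiff ℝ ∞ Real.smoothTransition :=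
  Real.smoothTransition.contDiff

lemma deriv_smoothTransition_nonneg (x : ℝ) : 0 ≤ deriv Real.smoothTransition x :=
  Real.smoothTransition.monotone.deriv_nonneg

lemma deriv_smoothTransition_of_nonpos {x : ℝ} (hx : x ≤ 0) :
    deriv Real.smoothTransition x = 0 := by
  apply IsLocalMin.deriv_eq_zero
  filter_upwards with y
  rw [Real.smoothTransition.zero_of_nonpos hx]
  exact Real.smoothTransition.nonneg y

/-- A smooth function that increases from `0` to `1` between `1 / (2 (n + 1))` and
`1 / (n + 1)`. -/
noncomputable def cutoff (n : ℕ) (x : ℝ) : ℝ := Real.smoothTransition (2 * (n + 1) * x - 1)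

variable {n : ℕ} {x : ℝ}

lemma contDiff_cutoff : ContDiff ℝ ∞ (cutoff n) :=
  contDiff_smoothTransition.comp (by fun_prop)

lemma continuous_cutoff : Continuous (cutoff n) := contDiff_cutoff.continuous

lemma differentiable_cutoff : Differentiable ℝ (cutoff n) :=
  contDiff_cutoff.differentiable (by simp)

lemma continuous_deriv_cutoff : Continuous (deriv (cutoff n)) :=
  contDiff_cutoff.continuous_deriv (by simp)

lemma cutoff_nonneg : 0 ≤ cutoff n x := Real.smoothTransition.nonneg _

lemma cutoff_le_one : cutoff n x ≤ 1 := Real.smoothTransition.le_one _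

lemma cutoff_monotone : Monotone (cutoff n) := by
  intro x y h
  apply Real.smoothTransition.monotone
  have : (0 : ℝ) ≤ 2 * (n + 1) := by positivity
  nlinarith

/-- Monotonicity in the index lets the integral against a fixed cutoff be bounded by those against
later ones, so no limit of the entropy integral is needed. -/
lemma cutoff_mono_index {m : ℕ} (hmn : m ≤ n) (hx : 0 ≤ x) : cutoff m x ≤ cutoff n x := by
  apply Real.smoothTransition.monotone
  have : (m : ℝ) ≤ n := by exact_mod_cast hmn
  gcongr

lemma cutoff_eq_zero (hx : x ≤ 1 / (2 * (n + 1))) : cutoff n x = 0 := by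
  apply Real.smoothTransition.zero_of_nonpos
  rw [le_div_iff₀ (by positivity)] at hx
  linarith

lemma cutoff_eq_one (hx : 1 / ((n : ℝ) + 1) ≤ x) : cutoff n x = 1 := by
  apply Real.smoothTransition.one_of_one_le
  rw [div_le_iff₀ (by positivity)] at hx
  linarith

lemma exists_cutoff_pos (hx : 0 < x) : ∃ n, 0 < cutoff n x := by
  obtain ⟨n, hn⟩ := exists_nat_one_div_lt hx
  exact ⟨n, by rw [cutoff_eq_one hn.le]; exact one_pos⟩

lemma deriv_cutoff_nonneg : 0 ≤ deriv (cutoff n) x := cutoff_monotone.deriv_nonneg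

lemma deriv_cutoff_of_le (hx : x ≤ 1 / (2 * (n + 1))) : deriv (cutoff n) x = 0 := by
  apply IsLocalMin.deriv_eq_zero
  filter_upwards with y
  rw [cutoff_eq_zero hx]
  exact cutoff_nonneg

lemma deriv_cutoff_of_ge (hx : 1 / ((n : ℝ) + 1) ≤ x) : deriv (cutoff n) x = 0 := by
  apply IsLocalMax.deriv_eq_zero
  filter_upwards with y
  rw [cutoff_eq_one hx]
  exact cutoff_le_one

lemma integral_deriv_cutoff : ∫ x in Set.Ioi (0 : ℝ), deriv (cutoff n) x = 1 := by
  have h0 : cutoff n 0 = 0 := cutoff_eq_zero (by positivity)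
  have := integral_Ioi_of_hasDerivAt_of_nonneg' (a := (0 : ℝ)) (g := cutoff n)
    (fun x _ => (differentiable_cutoff x).hasDerivAt) (fun x _ => deriv_cutoff_nonneg) (l := 1) (by
      apply tendsto_const_nhds.congr'
      filter_upwards [eventually_ge_atTop (1 / ((n : ℝ) + 1))] with x hx
      exact (cutoff_eq_one hx).symm)
  rw [this, h0, sub_zero]

lemma hasCompactSupport_deriv_cutoff : HasCompactSupport (deriv (cutoff n)) := by
  refine HasCompactSupport.intro (isCompact_Icc (a := 1 / (2 * ((n : ℝ) + 1)))
    (b := 1 / ((n : ℝ) + 1))) fun x hx => ?_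
  rw [Set.mem_Icc, not_and_or, not_le, not_le] at hx
  rcases hx with hx | hx
  · exact deriv_cutoff_of_le hx.le
  · exact deriv_cutoff_of_ge hx.le

lemma integrable_deriv_cutoff : Integrable (deriv (cutoff n)) :=
  continuous_deriv_cutoff.integrable_of_hasCompactSupport hasCompactSupport_deriv_cutoff

/-- The derivatives of the cutoff functions are an approximate identity at `0+`. -/
lemma tendsto_integral_mul_deriv_cutoff {h : ℝ → ℝ} {L : ℝ}
    (hm : AEStronglyMeasurable h (volume.restrict (Set.Ioi 0)))
    (hL : Tendsto h (𝓝[>] 0 ⊓ ae volume) (𝓝 L)) :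
    Tendsto (fun n => ∫ x in Set.Ioi (0 : ℝ), h x * deriv (cutoff n) x) atTop (𝓝 L) := by
  rw [Metric.tendsto_atTop]
  intro e he
  have h1 : ∀ᶠ x in 𝓝[>] (0 : ℝ) ⊓ ae volume, |h x - L| ≤ e / 2 := by
    filter_upwards [hL (Metric.closedBall_mem_nhds L (half_pos he))] with x hx
    simpa [Real.dist_eq] using hx
  rw [Filter.eventually_inf] at h1
  obtain ⟨s, hs, t, ht, hst⟩ := h1
  obtain ⟨δ, hδ, hδs⟩ := mem_nhdsGT_iff_exists_Ioo_subset.1 hs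
  obtain ⟨N, hN⟩ := exists_nat_one_div_lt (Set.mem_Ioi.1 hδ)
  refine ⟨N, fun n hn => ?_⟩
  have hk : IntegrableOn (deriv (cutoff n)) (Set.Ioi 0) := integrable_deriv_cutoff.integrableOn
  have hb : ∀ᵐ x ∂(volume.restrict (Set.Ioi (0 : ℝ))),
      ‖(h x - L) * deriv (cutoff n) x‖ ≤ e / 2 * deriv (cutoff n) x := by
    filter_upwards [ae_restrict_mem measurableSet_Ioi, ae_restrict_of_ae ht] with x hx hxt
    rw [norm_mul, Real.norm_eq_abs, Real.norm_eq_abs, abs_of_nonneg (deriv_cutoff_nonneg (x := x))]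
    rcases lt_or_ge x δ with hxδ | hxδ
    · exact mul_le_mul_of_nonneg_right (hst x ⟨hδs ⟨hx, hxδ⟩, hxt⟩) deriv_cutoff_nonneg
    · have : 1 / ((n : ℝ) + 1) ≤ 1 / ((N : ℝ) + 1) := by
        gcongr
      rw [deriv_cutoff_of_ge (by linarith)]
      simp
  have hi : Integrable (fun x => (h x - L) * deriv (cutoff n) x) (volume.restrict (Set.Ioi 0)) :=
    (hk.const_mul (e / 2)).mono' ((hm.sub aestronglyMeasurable_const).mul
      continuous_deriv_cutoff.aestronglyMeasurable) hb
  have e1 : ∫ x in Set.Ioi (0 : ℝ), h x * deriv (cutoff n) x =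
      (∫ x in Set.Ioi (0 : ℝ), (h x - L) * deriv (cutoff n) x) + L := by
    have : ∀ x, h x * deriv (cutoff n) x =
        (h x - L) * deriv (cutoff n) x + L * deriv (cutoff n) x := fun x => by ring
    simp only [this]
    rw [integral_add hi (hk.const_mul L), integral_const_mul, integral_deriv_cutoff, mul_one]
  rw [e1, Real.dist_eq, add_sub_cancel_right]
  have := norm_integral_le_of_norm_le (hk.const_mul (e / 2)) hb
  rw [integral_const_mul, integral_deriv_cutoff, mul_one, Real.norm_eq_abs] at this
  linarith

end Cutoff

/-! ### Test functions -/

section TestFunction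

lemma dt_mul {f g : ℝ × ℝ → ℝ} {z : ℝ × ℝ} (hf : DifferentiableAt ℝ f z)
    (hg : DifferentiableAt ℝ g z) :
    dt (fun z => f z * g z) z = dt f z * g z + f z * dt g z := by
  unfold dt
  rw [fderiv_fun_mul hf hg]
  simp
  ring

lemma dx_mul {f g : ℝ × ℝ → ℝ} {z : ℝ × ℝ} (hf : DifferentiableAt ℝ f z)
    (hg : DifferentiableAt ℝ g z) :
    dx (fun z => f z * g z) z = dx f z * g z + f z * dx g z := by
  unfold dx
  rw [fderiv_fun_mul hf hg]
  simp
  ring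

lemma fderiv_comp_affine {f : ℝ → ℝ} (hf : Differentiable ℝ f) (a b c : ℝ) (z v : ℝ × ℝ) :
    fderiv ℝ (fun z : ℝ × ℝ => f (a + b * z.1 + c * z.2)) z v =
      deriv f (a + b * z.1 + c * z.2) * (b * v.1 + c * v.2) := by
  have h1 : HasFDerivAt (fun z : ℝ × ℝ => a + b * z.1 + c * z.2)
      (b • ContinuousLinearMap.fst ℝ ℝ ℝ + c • ContinuousLinearMap.snd ℝ ℝ ℝ) z :=
    ((hasFDerivAt_fst.const_mul b).const_add a).add (hasFDerivAt_snd.const_mul c)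
  have h2 := (hf (a + b * z.1 + c * z.2)).hasDerivAt.comp_hasFDerivAt z h1
  have h3 := h2.fderiv
  simp only [Function.comp_def] at h3
  rw [h3]
  simp
  ring

lemma fderiv_comp_fst {f : ℝ → ℝ} (hf : Differentiable ℝ f) (z v : ℝ × ℝ) :
    fderiv ℝ (fun z : ℝ × ℝ => f z.1) z v = deriv f z.1 * v.1 := by
  simpa using fderiv_comp_affine hf 0 1 0 z v

lemma fderiv_comp_snd {f : ℝ → ℝ} (hf : Differentiable ℝ f) (z v : ℝ × ℝ) :
    fderiv ℝ (fun z : ℝ × ℝ => f z.2) z v = deriv f z.2 * v.2 := by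
  simpa using fderiv_comp_affine hf 0 0 1 z v

/-- A weight that decreases in time along all signals of speed at most `Λ`, and vanishes for
`t ≥ τ` and for `x + Λ t ≥ R`. -/
noncomputable def weight (Λ τ R : ℝ) (z : ℝ × ℝ) : ℝ :=
  Real.exp (-z.1) * Real.smoothTransition (τ - z.1) * Real.smoothTransition (R - (z.2 + Λ * z.1))

variable {Λ τ R : ℝ}

lemma contDiff_weight : ContDiff ℝ ∞ (weight Λ τ R) := by
  have h := contDiff_smoothTransition
  have h1 : ContDiff ℝ ∞ fun z : ℝ × ℝ => Real.smoothTransition (τ - z.1) :=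
    h.comp (by fun_prop)
  have h2 : ContDiff ℝ ∞ fun z : ℝ × ℝ => Real.smoothTransition (R - (z.2 + Λ * z.1)) :=
    h.comp (by fun_prop)
  have h3 : ContDiff ℝ ∞ fun z : ℝ × ℝ => Real.exp (-z.1) := by fun_prop
  exact (h3.mul h1).mul h2

lemma weight_nonneg' (z : ℝ × ℝ) : 0 ≤ weight Λ τ R z :=
  mul_nonneg (mul_nonneg (Real.exp_pos _).le (Real.smoothTransition.nonneg _))
    (Real.smoothTransition.nonneg _)

lemma weight_le_one {z : ℝ × ℝ} (hz : 0 ≤ z.1) : weight Λ τ R z ≤ 1 :=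
  mul_le_one₀ (mul_le_one₀ (Real.exp_le_one_iff.2 (by linarith))
    (Real.smoothTransition.nonneg _) (Real.smoothTransition.le_one _))
    (Real.smoothTransition.nonneg _) (Real.smoothTransition.le_one _)

lemma weight_pos {z : ℝ × ℝ} (h1 : z.1 < τ) (h2 : z.2 + Λ * z.1 < R) : 0 < weight Λ τ R z :=
  mul_pos (mul_pos (Real.exp_pos _) (Real.smoothTransition.pos_of_pos (by linarith)))
    (Real.smoothTransition.pos_of_pos (by linarith))

lemma weight_eq_zero {z : ℝ × ℝ} (h : τ ≤ z.1 ∨ R ≤ z.2 + Λ * z.1) : weight Λ τ R z = 0 := by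
  unfold weight
  rcases h with h | h
  · rw [Real.smoothTransition.zero_of_nonpos (by linarith : τ - z.1 ≤ 0)]; simp
  · rw [Real.smoothTransition.zero_of_nonpos (by linarith : R - (z.2 + Λ * z.1) ≤ 0)]; simp

lemma differentiable_smoothTransition : Differentiable ℝ Real.smoothTransition :=
  contDiff_smoothTransition.differentiable (by simp)

lemma weight_derivatives (z : ℝ × ℝ) :
    dx (weight Λ τ R) z = -(Real.exp (-z.1) * Real.smoothTransition (τ - z.1) *
      deriv Real.smoothTransition (R - (z.2 + Λ * z.1))) ∧
    dt (weight Λ τ R) z = -weight Λ τ R z - Real.exp (-z.1) *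
      deriv Real.smoothTransition (τ - z.1) * Real.smoothTransition (R - (z.2 + Λ * z.1)) +
      Λ * dx (weight Λ τ R) z := by
  have hs := differentiable_smoothTransition
  have e0 : Differentiable ℝ Real.exp := Real.differentiable_exp
  have e1 : (fun z : ℝ × ℝ => Real.exp (-z.1)) = fun z => Real.exp (0 + -1 * z.1 + 0 * z.2) := by
    ext z; congr 1; ring
  have e2 : (fun z : ℝ × ℝ => Real.smoothTransition (τ - z.1)) =
      fun z => Real.smoothTransition (τ + -1 * z.1 + 0 * z.2) := by
    ext z; congr 1; ring
  have e3 : (fun z : ℝ × ℝ => Real.smoothTransition (R - (z.2 + Λ * z.1))) =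
      fun z => Real.smoothTransition (R + -Λ * z.1 + -1 * z.2) := by
    ext z; congr 1; ring
  have d1 : DifferentiableAt ℝ (fun z : ℝ × ℝ => Real.exp (-z.1)) z := by fun_prop
  have d2 : DifferentiableAt ℝ (fun z : ℝ × ℝ => Real.smoothTransition (τ - z.1)) z :=
    (hs _).comp z (by fun_prop)
  have d3 : DifferentiableAt ℝ
      (fun z : ℝ × ℝ => Real.smoothTransition (R - (z.2 + Λ * z.1))) z :=
    (hs _).comp z (by fun_prop)
  have d12 : DifferentiableAt ℝ
      (fun z : ℝ × ℝ => Real.exp (-z.1) * Real.smoothTransition (τ - z.1)) z := d1.mul d2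
  have f1 : ∀ v, fderiv ℝ (fun z : ℝ × ℝ => Real.exp (-z.1)) z v = Real.exp (-z.1) * -v.1 := by
    intro v
    rw [e1, fderiv_comp_affine e0, Real.deriv_exp]
    simp
  have f2 : ∀ v, fderiv ℝ (fun z : ℝ × ℝ => Real.smoothTransition (τ - z.1)) z v =
      deriv Real.smoothTransition (τ - z.1) * -v.1 := by
    intro v
    rw [e2, fderiv_comp_affine hs]
    congr 2 <;> ring
  have f3 : ∀ v, fderiv ℝ (fun z : ℝ × ℝ => Real.smoothTransition (R - (z.2 + Λ * z.1))) z v =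
      deriv Real.smoothTransition (R - (z.2 + Λ * z.1)) * (-Λ * v.1 - v.2) := by
    intro v
    rw [e3, fderiv_comp_affine hs]
    congr 2 <;> ring
  have hx : dx (weight Λ τ R) z = -(Real.exp (-z.1) * Real.smoothTransition (τ - z.1) *
      deriv Real.smoothTransition (R - (z.2 + Λ * z.1))) := by
    unfold weight
    rw [dx_mul d12 d3, dx_mul d1 d2]
    unfold dx
    rw [f1, f2, f3]
    ring
  refine ⟨hx, ?_⟩
  rw [hx]
  unfold weight
  rw [dt_mul d12 d3, dt_mul d1 d2]
  unfold dt
  rw [f1, f2, f3]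
  ring

lemma dx_weight_nonpos (z : ℝ × ℝ) : dx (weight Λ τ R) z ≤ 0 := by
  rw [(weight_derivatives z).1, neg_nonpos]
  exact mul_nonneg (mul_nonneg (Real.exp_pos _).le (Real.smoothTransition.nonneg _))
    (deriv_smoothTransition_nonneg _)

/-- The factor `exp (-t)` produces the term `-weight`, which puts the entropy integral itself into
the balance; the term with `Λ` absorbs the flux by finite speed. -/
lemma dt_weight_le (z : ℝ × ℝ) :
    dt (weight Λ τ R) z ≤ -weight Λ τ R z + Λ * dx (weight Λ τ R) z := by
  rw [(weight_derivatives z).2]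
  have : 0 ≤ Real.exp (-z.1) * deriv Real.smoothTransition (τ - z.1) *
      Real.smoothTransition (R - (z.2 + Λ * z.1)) :=
    mul_nonneg (mul_nonneg (Real.exp_pos _).le (deriv_smoothTransition_nonneg _))
      (Real.smoothTransition.nonneg _)
  linarith

lemma derivatives_weight_eq_zero {z : ℝ × ℝ} (h : τ ≤ z.1) :
    dx (weight Λ τ R) z = 0 ∧ dt (weight Λ τ R) z = 0 := by
  have h1 : Real.smoothTransition (τ - z.1) = 0 :=
    Real.smoothTransition.zero_of_nonpos (by linarith)
  have h2 : dx (weight Λ τ R) z = 0 := by rw [(weight_derivatives z).1, h1]; simp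
  refine ⟨h2, ?_⟩
  rw [(weight_derivatives z).2, h2, weight_eq_zero (Or.inl h),
    deriv_smoothTransition_of_nonpos (by linarith)]
  simp

/-- The weight, cut off near the boundary and near the initial time. -/
noncomputable def testFn (Λ τ R : ℝ) (n : ℕ) (z : ℝ × ℝ) : ℝ :=
  cutoff n z.1 * weight Λ τ R z * cutoff n z.2

variable {n : ℕ}

lemma testFn_nonneg (z : ℝ × ℝ) : 0 ≤ testFn Λ τ R n z :=
  mul_nonneg (mul_nonneg cutoff_nonneg (weight_nonneg' z)) cutoff_nonneg

lemma contDiff_testFn : ContDiff ℝ ∞ (testFn Λ τ R n) :=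
  ((contDiff_cutoff.comp contDiff_fst).mul contDiff_weight).mul (contDiff_cutoff.comp contDiff_snd)

lemma derivatives_testFn (z : ℝ × ℝ) :
    dt (testFn Λ τ R n) z = deriv (cutoff n) z.1 * weight Λ τ R z * cutoff n z.2 +
      cutoff n z.1 * dt (weight Λ τ R) z * cutoff n z.2 ∧
    dx (testFn Λ τ R n) z = cutoff n z.1 * dx (weight Λ τ R) z * cutoff n z.2 +
      cutoff n z.1 * weight Λ τ R z * deriv (cutoff n) z.2 := by
  have hc := differentiable_cutoff (n := n)
  have d1 : DifferentiableAt ℝ (fun z : ℝ × ℝ => cutoff n z.1) z := (hc _).comp z (by fun_prop)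
  have d2 : DifferentiableAt ℝ (weight Λ τ R) z := contDiff_weight.differentiable (by simp) z
  have d3 : DifferentiableAt ℝ (fun z : ℝ × ℝ => cutoff n z.2) z := (hc _).comp z (by fun_prop)
  have d12 : DifferentiableAt ℝ (fun z : ℝ × ℝ => cutoff n z.1 * weight Λ τ R z) z := d1.mul d2
  unfold testFn
  constructor
  · rw [dt_mul d12 d3, dt_mul d1 d2]
    unfold dt
    rw [fderiv_comp_fst hc, fderiv_comp_snd hc]
    simp
    ring
  · rw [dx_mul d12 d3, dx_mul d1 d2]
    unfold dx
    rw [fderiv_comp_fst hc, fderiv_comp_snd hc]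
    simp

/-- A function that vanishes where `t` or `x` is small or the weight is zero is supported in a
box. -/
lemma eq_zero_of_notMem_box (hΛ : 0 ≤ Λ) {f : ℝ × ℝ → ℝ}
    (h1 : ∀ z : ℝ × ℝ, z.1 ≤ 1 / (2 * ((n : ℝ) + 1)) → f z = 0)
    (h2 : ∀ z : ℝ × ℝ, z.2 ≤ 1 / (2 * ((n : ℝ) + 1)) → f z = 0)
    (h3 : ∀ z : ℝ × ℝ, weight Λ τ R z = 0 → f z = 0) :
    (∀ z ∉ Set.Icc (1 / (2 * ((n : ℝ) + 1))) τ ×ˢ Set.Icc (1 / (2 * ((n : ℝ) + 1))) R,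
      f z = 0) := by
  intro z hz
  by_contra hf
  apply hz
  have k1 : 1 / (2 * ((n : ℝ) + 1)) < z.1 := by
    by_contra! h; exact hf (h1 z h)
  have k2 : 1 / (2 * ((n : ℝ) + 1)) < z.2 := by
    by_contra! h; exact hf (h2 z h)
  have k0 : (0 : ℝ) < 1 / (2 * ((n : ℝ) + 1)) := by positivity
  have k3 : ¬(τ ≤ z.1 ∨ R ≤ z.2 + Λ * z.1) := fun h => hf (h3 z (weight_eq_zero h))
  push Not at k3
  have : 0 ≤ Λ * z.1 := mul_nonneg hΛ (by linarith)
  exact ⟨⟨k1.le, k3.1.le⟩, ⟨k2.le, by linarith⟩⟩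

lemma isTest_testFn (hΛ : 0 ≤ Λ) {T : EReal} (hT : (τ : EReal) < T) :
    IsTest T (testFn Λ τ R n) := by
  have h0 := eq_zero_of_notMem_box (n := n) (τ := τ) (R := R) hΛ
    (f := testFn Λ τ R n) (fun z h => by unfold testFn; rw [cutoff_eq_zero h]; simp)
    (fun z h => by unfold testFn; rw [cutoff_eq_zero h]; simp)
    (fun z h => by unfold testFn; rw [h]; simp)
  have hK := (isCompact_Icc (a := 1 / (2 * ((n : ℝ) + 1))) (b := τ)).prod
    (isCompact_Icc (a := 1 / (2 * ((n : ℝ) + 1))) (b := R))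
  refine ⟨contDiff_testFn, HasCompactSupport.intro hK h0, ?_⟩
  have hsub : tsupport (testFn Λ τ R n) ⊆
      Set.Icc (1 / (2 * ((n : ℝ) + 1))) τ ×ˢ Set.Icc (1 / (2 * ((n : ℝ) + 1))) R := by
    apply closure_minimal _ hK.isClosed
    intro z hz
    by_contra h
    exact hz (h0 z h)
  refine hsub.trans ?_
  rintro z ⟨hz1, hz2⟩
  have k0 : (0 : ℝ) < 1 / (2 * ((n : ℝ) + 1)) := by positivity
  refine ⟨⟨k0.trans_le hz1.1, lt_of_le_of_lt ?_ hT⟩, k0.trans_le hz2.1⟩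
  exact_mod_cast hz1.2

end TestFunction

/-! ### The entropy inequality up to the boundary -/

section Entropy

variable {κ γ M C Λ τ R : ℝ} {p n : ℕ} {T : EReal}

/-- The weight with a concentrated factor at the initial time. -/
noncomputable def initialWeight (Λ τ R : ℝ) (n : ℕ) (z : ℝ × ℝ) : ℝ :=
  deriv (cutoff n) z.1 * weight Λ τ R z * cutoff n z.2

/-- The weight with a concentrated factor at the junction. -/
noncomputable def boundaryWeight (Λ τ R : ℝ) (n : ℕ) (z : ℝ × ℝ) : ℝ :=
  cutoff n z.1 * weight Λ τ R z * deriv (cutoff n) z.2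

lemma integrable_mul_of_compact {μ : Measure (ℝ × ℝ)} [IsLocallyFiniteMeasure μ]
    {f c : ℝ × ℝ → ℝ} {B a b : ℝ} (hf : AEStronglyMeasurable f μ) (hB : ∀ᵐ z ∂μ, |f z| ≤ B)
    (hc : Continuous c) (h0 : ∀ z ∉ Set.Icc a τ ×ˢ Set.Icc b R, c z = 0) :
    Integrable (fun z => f z * c z) μ := by
  have h1 : Integrable c μ := hc.integrable_of_hasCompactSupport
    (HasCompactSupport.intro (isCompact_Icc.prod isCompact_Icc) h0)
  exact h1.bdd_mul hf (c := B) hB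

lemma continuous_weight' : Continuous (weight Λ τ R) := contDiff_weight.continuous

lemma integrable_mul_weights (hΛ : 0 ≤ Λ) {μ : Measure (ℝ × ℝ)} [IsLocallyFiniteMeasure μ]
    {f : ℝ × ℝ → ℝ} {B : ℝ} (hf : AEStronglyMeasurable f μ) (hB : ∀ᵐ z ∂μ, |f z| ≤ B) :
    Integrable (fun z => f z * testFn Λ τ R n z) μ ∧
    Integrable (fun z => f z * initialWeight Λ τ R n z) μ ∧
    Integrable (fun z => f z * boundaryWeight Λ τ R n z) μ ∧
    Integrable (fun z => f z * dt (testFn Λ τ R n) z) μ ∧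
    Integrable (fun z => f z * dx (testFn Λ τ R n) z) μ := by
  have c1 := continuous_cutoff (n := n)
  have c2 := continuous_deriv_cutoff (n := n)
  have c3 := continuous_weight' (Λ := Λ) (τ := τ) (R := R)
  -- A zero of the nonnegative weight is a minimum, so the gradient vanishes too.
  have hdw : ∀ z : ℝ × ℝ, weight Λ τ R z = 0 →
      dt (weight Λ τ R) z = 0 ∧ dx (weight Λ τ R) z = 0 := by
    intro z hz
    have hmin : IsLocalMin (weight Λ τ R) z := by
      filter_upwards with y
      rw [hz]
      exact weight_nonneg' y
    unfold dt dx
    rw [hmin.fderiv_eq_zero]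
    simp
  have key : ∀ c : ℝ × ℝ → ℝ, Continuous c →
      (∀ z : ℝ × ℝ, z.1 ≤ 1 / (2 * ((n : ℝ) + 1)) → c z = 0) →
      (∀ z : ℝ × ℝ, z.2 ≤ 1 / (2 * ((n : ℝ) + 1)) → c z = 0) →
      (∀ z : ℝ × ℝ, weight Λ τ R z = 0 → c z = 0) → Integrable (fun z => f z * c z) μ :=
    fun c hc k1 k2 k3 => integrable_mul_of_compact hf hB hc (eq_zero_of_notMem_box hΛ k1 k2 k3)
  have hfd : Continuous (fderiv ℝ (testFn Λ τ R n)) := contDiff_testFn.continuous_fderiv (by simp)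
  refine ⟨key _ contDiff_testFn.continuous ?_ ?_ ?_,
    key _ (by unfold initialWeight; fun_prop) ?_ ?_ ?_,
    key _ (by unfold boundaryWeight; fun_prop) ?_ ?_ ?_,
    key _ (hfd.clm_apply continuous_const) ?_ ?_ ?_,
    key _ (hfd.clm_apply continuous_const) ?_ ?_ ?_⟩
  · intro z h; simp [testFn, cutoff_eq_zero h]
  · intro z h; simp [testFn, cutoff_eq_zero h]
  · intro z h; simp [testFn, h]
  · intro z h; simp [initialWeight, deriv_cutoff_of_le h]
  · intro z h; simp [initialWeight, cutoff_eq_zero h]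
  · intro z h; simp [initialWeight, h]
  · intro z h; simp [boundaryWeight, cutoff_eq_zero h]
  · intro z h; simp [boundaryWeight, deriv_cutoff_of_le h]
  · intro z h; simp [boundaryWeight, h]
  · intro z h; rw [(derivatives_testFn z).1]; simp [cutoff_eq_zero h, deriv_cutoff_of_le h]
  · intro z h; rw [(derivatives_testFn z).1]; simp [cutoff_eq_zero h]
  · intro z h; rw [(derivatives_testFn z).1]; simp [h, hdw z h]
  · intro z h; rw [(derivatives_testFn z).2]; simp [cutoff_eq_zero h]
  · intro z h; rw [(derivatives_testFn z).2]; simp [cutoff_eq_zero h, deriv_cutoff_of_le h]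
  · intro z h; rw [(derivatives_testFn z).2]; simp [h, hdw z h]

lemma openTimes_coe : openTimes (τ : EReal) = Set.Ioo 0 τ := by
  ext t; simp [openTimes]

lemma measurableSet_openTimes (T : EReal) : MeasurableSet (openTimes T) := by
  have : openTimes T = Set.Ioi 0 ∩ (fun t : ℝ => (t : EReal)) ⁻¹' Set.Iio T := by
    ext t; simp [openTimes]
  rw [this]
  exact measurableSet_Ioi.inter (measurable_coe_real_ereal measurableSet_Iio)

lemma measurableSet_pipe (T : EReal) : MeasurableSet (pipe T) :=
  (measurableSet_openTimes T).prod measurableSet_Ioi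

lemma openTimes_mono {T T' : EReal} (h : T ≤ T') : openTimes T ⊆ openTimes T' :=
  fun _ ht => ⟨ht.1, ht.2.trans_le h⟩

lemma pipe_mono {T T' : EReal} (h : T ≤ T') : pipe T ⊆ pipe T' :=
  Set.prod_mono (openTimes_mono h) subset_rfl

lemma exists_abs_le (h₁ : 1 < γ) (h₃ : γ < 3) (C : ℝ) : ∃ B, 0 ≤ B ∧ ∀ s, IsBoundedState C s →
    |meanEta κ γ (trunc M p) s| ≤ B ∧ |meanFlux κ γ (trunc M p) s| ≤ B := by
  have hK : IsCompact (Set.Icc (0 : ℝ) C ×ˢ Set.Icc (-C) C) := isCompact_Icc.prod isCompact_Icc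
  obtain ⟨B1, h1⟩ := hK.exists_bound_of_continuousOn
    (continuous_meanEta (κ := κ) (M := M) (p := p) h₁ h₃).continuousOn
  obtain ⟨B2, h2⟩ := hK.exists_bound_of_continuousOn
    (continuous_meanFlux (κ := κ) (M := M) (p := p) h₁ h₃).continuousOn
  refine ⟨max 0 (max B1 B2), le_max_left _ _, fun s hs => ?_⟩
  have hm : s ∈ Set.Icc (0 : ℝ) C ×ˢ Set.Icc (-C) C := ⟨⟨hs.1, hs.2.1⟩, abs_le.1 hs.2.2⟩
  exact ⟨(h1 s hm).trans ((le_max_left _ _).trans (le_max_right _ _)),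
    (h2 s hm).trans ((le_max_right _ _).trans (le_max_right _ _))⟩

/-- The entropy inequality for the cut-off weight. -/
lemma IsWeakEntropySolution.integral_testFn_le (hκ : 0 < κ) (h₁ : 1 < γ) (h₃ : γ < 3) (hC : 0 ≤ C)
    {s : ℝ → ℝ → ℝ × ℝ} (hs : IsWeakEntropySolution κ γ T s) (hτ : (τ : EReal) < T)
    (hb : ∀ᵐ z ∂(volume.restrict (pipe τ)), IsBoundedState C (s z.1 z.2)) :
    ∫ z in pipe τ, meanEta κ γ (trunc M p) (s z.1 z.2) * testFn (C + width κ γ C) τ R n z ≤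
      (∫ z in pipe τ, meanEta κ γ (trunc M p) (s z.1 z.2) *
        initialWeight (C + width κ γ C) τ R n z) +
      ∫ z in pipe τ, meanFlux κ γ (trunc M p) (s z.1 z.2) *
        boundaryWeight (C + width κ γ C) τ R n z := by
  set Λ := C + width κ γ C with hΛdef
  have hΛ : 0 ≤ Λ := add_nonneg hC (width_nonneg hκ h₁ hC)
  have hsub : pipe τ ⊆ pipe T := pipe_mono hτ.le
  have hm : AEStronglyMeasurable (fun z : ℝ × ℝ => s z.1 z.2) (volume.restrict (pipe τ)) :=
    hs.measurable.mono_measure (Measure.restrict_mono_set _ hsub)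
  have hmE := (continuous_meanEta (κ := κ) (M := M) (p := p) h₁ h₃).comp_aestronglyMeasurable hm
  have hmG := (continuous_meanFlux (κ := κ) (M := M) (p := p) h₁ h₃).comp_aestronglyMeasurable hm
  obtain ⟨B, -, hB⟩ := exists_abs_le (κ := κ) (M := M) (p := p) h₁ h₃ C
  have hbE : ∀ᵐ z ∂(volume.restrict (pipe τ)), |meanEta κ γ (trunc M p) (s z.1 z.2)| ≤ B :=
    hb.mono fun z hz => (hB _ hz).1
  have hbG : ∀ᵐ z ∂(volume.restrict (pipe τ)), |meanFlux κ γ (trunc M p) (s z.1 z.2)| ≤ B :=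
    hb.mono fun z hz => (hB _ hz).2
  obtain ⟨i1, i2, -, i4, -⟩ := integrable_mul_weights (n := n) (τ := τ) (R := R) hΛ hmE hbE
  obtain ⟨-, -, j3, -, j5⟩ := integrable_mul_weights (n := n) (τ := τ) (R := R) hΛ hmG hbG
  have h0 := hs.entropy (trunc M p) convexOn_trunc (testFn Λ τ R n) (isTest_testFn hΛ hτ)
    testFn_nonneg
  -- The test function and its derivatives vanish for `t ≥ τ`, so only the strip where the solution
  -- is known to be bounded contributes.
  rw [setIntegral_eq_of_subset_of_forall_sdiff_eq_zero (measurableSet_pipe T) hsub (by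
    rintro z ⟨⟨hz1, hz2⟩, hz⟩
    have : τ ≤ z.1 := by
      by_contra! h
      exact hz ⟨⟨hz1.1, by exact_mod_cast h⟩, hz2⟩
    obtain ⟨d1, d2⟩ := derivatives_weight_eq_zero (Λ := Λ) (R := R) this
    rw [(derivatives_testFn z).1, (derivatives_testFn z).2, d1, d2, weight_eq_zero (Or.inl this)]
    simp)] at h0
  have h1 : ∫ z in pipe τ, (eta κ γ (trunc M p) (s z.1 z.2) * dt (testFn Λ τ R n) z +
      entropyFlux κ γ (trunc M p) (s z.1 z.2) * dx (testFn Λ τ R n) z) =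
      ∫ z in pipe τ, (meanEta κ γ (trunc M p) (s z.1 z.2) * dt (testFn Λ τ R n) z +
        meanFlux κ γ (trunc M p) (s z.1 z.2) * dx (testFn Λ τ R n) z) := by
    apply integral_congr_ae
    filter_upwards [hb] with z hz
    rw [eta_eq hκ h₁ h₃ _ hz.1, entropyFlux_eq hκ h₁ h₃ _ hz.1]
  rw [h1] at h0
  have h2 : ∫ z in pipe τ, (meanEta κ γ (trunc M p) (s z.1 z.2) * dt (testFn Λ τ R n) z +
        meanFlux κ γ (trunc M p) (s z.1 z.2) * dx (testFn Λ τ R n) z) ≤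
      ∫ z in pipe τ, (meanEta κ γ (trunc M p) (s z.1 z.2) * initialWeight Λ τ R n z -
        meanEta κ γ (trunc M p) (s z.1 z.2) * testFn Λ τ R n z +
        meanFlux κ γ (trunc M p) (s z.1 z.2) * boundaryWeight Λ τ R n z) := by
    apply integral_mono_ae (i4.add j5) ((i2.sub i1).add j3)
    filter_upwards [hb] with z hz
    have g1 := meanEta_nonneg (κ := κ) (M := M) (p := p) h₁ h₃ hz.1
    have g2 := abs_le.1 (abs_meanFlux_le (M := M) (p := p) hκ h₁ h₃ hz)
    simp only [Pi.add_apply, Pi.sub_apply]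
    rw [(derivatives_testFn z).1, (derivatives_testFn z).2]
    unfold initialWeight boundaryWeight testFn
    have g3 := dt_weight_le (Λ := Λ) (τ := τ) (R := R) z
    have g4 := dx_weight_nonpos (Λ := Λ) (τ := τ) (R := R) z
    have g5 : 0 ≤ cutoff n z.1 * cutoff n z.2 := mul_nonneg cutoff_nonneg cutoff_nonneg
    rw [← hΛdef] at g2
    generalize meanEta κ γ (trunc M p) (s z.1 z.2) = e at *
    generalize meanFlux κ γ (trunc M p) (s z.1 z.2) = g at *
    have g6 := mul_le_mul_of_nonneg_left g3 g1
    -- Finite speed, `|g| ≤ Λ e`, and the monotonicity of the weight in `x`.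
    have g7 : (Λ * e + g) * dx (weight Λ τ R) z ≤ 0 :=
      mul_nonpos_of_nonneg_of_nonpos (by linarith) g4
    have g8 : e * dt (weight Λ τ R) z + g * dx (weight Λ τ R) z ≤ -(e * weight Λ τ R z) := by
      linarith
    have g9 := mul_le_mul_of_nonneg_left g8 g5
    linarith
  have h3 := integral_add (i2.sub i1) j3
  have h4 := integral_sub i2 i1
  simp only [Pi.sub_apply] at h3
  rw [h3, h4] at h2
  linarith

end Entropy

/-! ### The Cauchy problem -/

section Cauchy

variable {κ γ M C Λ τ R : ℝ} {p : ℕ} {T : EReal}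

lemma IsBoundedState.mono {C' : ℝ} {s : ℝ × ℝ} (h : IsBoundedState C s) (hC : C ≤ C') :
    IsBoundedState C' s :=
  ⟨h.1, h.2.1.trans hC, h.2.2.trans hC⟩

/-- States whose Riemann invariants are bounded are bounded. -/
lemma InBounds.isBoundedState (hκ : 0 < κ) (h₁ : 1 < γ) {s : ℝ × ℝ} (h : InBounds κ γ M s) :
    IsBoundedState (M + (M / aConst κ γ) ^ (1 / theta γ)) s := by
  obtain ⟨hs, h1, h2⟩ := h
  rw [omega1_eq] at h1
  rw [omega2_eq] at h2
  have hθ := theta_pos h₁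
  have ha := aConst_pos hκ h₁
  have hρ := stateSpace_nonneg hs
  have hA := width_nonneg hκ h₁ hρ
  have hM : 0 ≤ M := by linarith
  have h3 : 0 ≤ (M / aConst κ γ) ^ (1 / theta γ) := by positivity
  refine ⟨hρ, ?_, abs_le.2 ⟨by linarith, by linarith⟩⟩
  have h4 : s.1 ^ theta γ ≤ M / aConst κ γ := by
    rw [le_div_iff₀ ha]
    unfold width at *
    linarith
  have h5 := Real.rpow_le_rpow (by positivity) h4 (by positivity : 0 ≤ 1 / theta γ)
  rw [← Real.rpow_mul hρ, mul_one_div_cancel hθ.ne', Real.rpow_one] at h5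
  linarith

lemma eventually_trace_of_ae {P : ℝ → Prop} (h : ∀ᵐ x ∂(volume.restrict (Set.Ioi (0 : ℝ))), P x) :
    ∀ᶠ x in 𝓝[>] (0 : ℝ) ⊓ ae volume, P x := by
  rw [ae_restrict_iff' measurableSet_Ioi] at h
  filter_upwards [(eventually_mem_nhdsWithin).filter_mono inf_le_left,
    h.filter_mono (inf_le_right (a := 𝓝[>] (0 : ℝ)))] with x k1 k2
  exact k2 k1

/-- Only `ρ` and `ρ u` converge, so the bound passes to the limit as `|ρ u| ≤ C ρ`. It is divided by
the density if that is positive; at vacuum the velocity is zero by convention. -/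
lemma IsRightTrace.isBoundedState {f : ℝ → ℝ × ℝ} {b : ℝ × ℝ} (h : IsRightTrace f b)
    (hf : ∀ᵐ x ∂(volume.restrict (Set.Ioi (0 : ℝ))), IsBoundedState C (f x)) :
    IsBoundedState C b := by
  have hf' := eventually_trace_of_ae hf
  obtain ⟨hb, hl⟩ := h
  have h1 : Tendsto (fun x => (f x).1) (𝓝[>] 0 ⊓ ae volume) (𝓝 b.1) :=
    hl.fst_nhds
  have h2 : Tendsto (fun x => (f x).1 * (f x).2) (𝓝[>] 0 ⊓ ae volume) (𝓝 (b.1 * b.2)) :=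
    hl.snd_nhds
  have h3 : b.1 ≤ C := le_of_tendsto h1 (hf'.mono fun x hx => hx.2.1)
  have h4 : |b.1 * b.2| ≤ b.1 * C := by
    refine le_of_tendsto_of_tendsto h2.abs (h1.mul_const C) (hf'.mono fun x hx => ?_)
    simp only [abs_mul, abs_of_nonneg hx.1]
    exact mul_le_mul_of_nonneg_left hx.2.2 hx.1
  rcases hb with hb | ⟨hb, hb'⟩
  · refine ⟨hb.le, h3, ?_⟩
    rw [abs_mul, abs_of_pos hb] at h4
    exact le_of_mul_le_mul_left h4 hb
  · exact ⟨hb.ge, h3, by rw [hb', abs_zero]; exact hb ▸ h3⟩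

/-- Near vacuum the trace does not control `u`, so continuity in `(ρ, u)` is not enough; the
Lipschitz bound in the conserved quantities is. -/
lemma IsRightTrace.tendsto_meanFlux (hκ : 0 < κ) (h₁ : 1 < γ) (h₃ : γ < 3) (hM : 0 ≤ M)
    (hC : 0 ≤ C) {f : ℝ → ℝ × ℝ} {b : ℝ × ℝ} (h : IsRightTrace f b)
    (hf : ∀ᵐ x ∂(volume.restrict (Set.Ioi (0 : ℝ))), IsBoundedState C (f x)) :
    Tendsto (fun x => meanFlux κ γ (trunc M p) (f x)) (𝓝[>] 0 ⊓ ae volume)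
      (𝓝 (meanFlux κ γ (trunc M p) b)) := by
  obtain ⟨K, -, -, hK⟩ := exists_lipschitz (p := p) hκ h₁ h₃ hM hC
  rw [tendsto_iff_norm_sub_tendsto_zero]
  have h1 := (tendsto_iff_norm_sub_tendsto_zero.1 h.2).const_mul K
  rw [mul_zero] at h1
  refine squeeze_zero' (Eventually.of_forall fun _ => norm_nonneg _) ?_ h1
  filter_upwards [eventually_trace_of_ae hf] with x hx
  exact hK _ _ hx (h.isBoundedState hf)

/-- The factor depends on the junction density only and can be pulled out of the sum over the pipes.
-/
lemma meanFlux_le_of_mem_boundaryRiemannSet (hκ : 0 < κ) (h₁ : 1 < γ) (h₃ : γ < 3) (hM : 0 ≤ M)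
    (hp : IsAdmissibleExponent γ p) {ρ : ℝ} (hρ : 0 ≤ ρ) {b : ℝ × ℝ}
    (hb : b ∈ boundaryRiemannSet κ γ (ρ, 0)) :
    meanFlux κ γ (trunc M p) b ≤ fluxRatio γ M p (width κ γ ρ) * (b.1 * b.2) := by
  obtain ⟨-, r, -, w, hw, hlim⟩ := hb
  obtain ⟨s, hs, hs0, hs1, -⟩ := hw.exists_trace hκ h₁ h₃ hρ
  rw [tendsto_nhds_unique hlim hs]
  exact hs1.meanFlux_le hκ h₁ h₃ hM hp (width_nonneg hκ h₁ hρ) hs0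

/-- Initial data within the bounds do not contribute to the entropy balance. -/
lemma eventually_integral_initialWeight_le (hκ : 0 < κ) (h₁ : 1 < γ) (h₃ : γ < 3) (hM : 0 ≤ M)
    (hC : 0 ≤ C) (hp : p ≠ 0) (hΛ : 0 ≤ Λ) {s : ℝ → ℝ → ℝ × ℝ} (hτ : (τ : EReal) < T)
    (hm : AEStronglyMeasurable (fun z : ℝ × ℝ => s z.1 z.2) (volume.restrict (pipe τ)))
    (hb : ∀ᵐ z ∂(volume.restrict (pipe τ)), IsBoundedState C (s z.1 z.2))
    (hi : ∀ᵐ x ∂(volume.restrict (Set.Ioi (0 : ℝ))),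
      IsBoundedState C (s 0 x) ∧ InBounds κ γ M (s 0 x))
    (hint : ∀ t ∈ closedTimes T, Integrable (fun x => ‖conserved (s t x) - conserved (s 0 x)‖)
      (volume.restrict (Set.Ioi 0)))
    (hcont : Tendsto (fun t => ∫ x in Set.Ioi 0, ‖conserved (s t x) - conserved (s 0 x)‖)
      (𝓝[closedTimes T] 0) (𝓝 0)) {ε : ℝ} (hε : 0 < ε) :
    ∀ᶠ n in atTop, ∫ z in pipe τ, meanEta κ γ (trunc M p) (s z.1 z.2) *
      initialWeight Λ τ R n z ≤ ε := by
  obtain ⟨K, hK0, hK, -⟩ := exists_lipschitz (p := p) hκ h₁ h₃ hM hC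
  obtain ⟨B, -, hB⟩ := exists_abs_le (κ := κ) (M := M) (p := p) h₁ h₃ C
  have hmE := (continuous_meanEta (κ := κ) (M := M) (p := p) h₁ h₃).comp_aestronglyMeasurable hm
  have hbE : ∀ᵐ z ∂(volume.restrict (pipe τ)), |meanEta κ γ (trunc M p) (s z.1 z.2)| ≤ B :=
    hb.mono fun z hz => (hB _ hz).1
  have h1 := hcont.const_mul K
  rw [mul_zero] at h1
  have h2 := mem_nhdsWithin_iff_exists_mem_nhds_inter.1 (h1 (Iio_mem_nhds hε))
  obtain ⟨u, hu, hu'⟩ := h2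
  obtain ⟨δ, hδ, hδu⟩ := Metric.mem_nhds_iff.1 hu
  obtain ⟨N, hN⟩ := exists_nat_one_div_lt hδ
  filter_upwards [eventually_ge_atTop N] with n hn
  -- The derivative of the time cutoff is then supported in `t < δ`, where the `L¹` distance to the
  -- data is small.
  have hnδ : 1 / ((n : ℝ) + 1) < δ := lt_of_le_of_lt (by gcongr) hN
  obtain ⟨-, i2, -⟩ := integrable_mul_weights (n := n) (τ := τ) (R := R) hΛ hmE hbE
  rw [pipe_eq_prod] at i2 hb ⊢
  rw [integral_prod _ i2]
  have hae : ∀ᵐ t ∂(volume.restrict (openTimes τ)),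
      ∀ᵐ x ∂(volume.restrict (Set.Ioi (0 : ℝ))), IsBoundedState C (s t x) :=
    Measure.ae_ae_of_ae_prod hb
  have hd : Integrable (fun t => ε * deriv (cutoff n) t) (volume.restrict (Set.Ioi 0)) :=
    (integrable_deriv_cutoff.const_mul ε).integrableOn
  have hsub : openTimes (τ : EReal) ⊆ Set.Ioi 0 := fun t ht => ht.1
  calc _ ≤ ∫ t in openTimes τ, ε * deriv (cutoff n) t := by
        refine integral_mono_ae i2.integral_prod_left
          (hd.mono_measure (Measure.restrict_mono_set _ hsub)) ?_
        filter_upwards [hae, ae_restrict_mem (measurableSet_openTimes τ)] with t ht ht0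
        have htT : t ∈ closedTimes T := ⟨ht0.1.le, (ht0.2.trans hτ).le⟩
        have hd0 := deriv_cutoff_nonneg (n := n) (x := t)
        calc _ ≤ ∫ x in Set.Ioi 0, deriv (cutoff n) t * K *
              ‖conserved (s t x) - conserved (s 0 x)‖ := by
              refine integral_mono_of_nonneg ?_ ((hint t htT).const_mul _) ?_
              · filter_upwards [ht] with x hx
                exact mul_nonneg (meanEta_nonneg h₁ h₃ hx.1)
                  (mul_nonneg (mul_nonneg hd0 (weight_nonneg' _)) cutoff_nonneg)
              · filter_upwards [ht, hi] with x hx hx0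
                have e1 := hK _ _ hx hx0.1
                rw [meanEta_eq_zero hκ h₁ h₃ hp hx0.2, sub_zero] at e1
                have e0 := meanEta_nonneg (κ := κ) (M := M) (p := p) h₁ h₃ hx.1
                have e2 : initialWeight Λ τ R n (t, x) ≤ deriv (cutoff n) t := by
                  unfold initialWeight
                  calc _ ≤ deriv (cutoff n) t * 1 * 1 := by
                        gcongr
                        · exact cutoff_nonneg
                        · exact weight_le_one ht0.1.le
                        · exact cutoff_le_one
                    _ = _ := by ring
                calc _ ≤ meanEta κ γ (trunc M p) (s t x) * deriv (cutoff n) t :=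
                      mul_le_mul_of_nonneg_left e2 e0
                  _ ≤ K * ‖conserved (s t x) - conserved (s 0 x)‖ * deriv (cutoff n) t :=
                      mul_le_mul_of_nonneg_right ((le_abs_self _).trans e1) hd0
                  _ = _ := by ring
          _ = deriv (cutoff n) t *
              (K * ∫ x in Set.Ioi 0, ‖conserved (s t x) - conserved (s 0 x)‖) := by
              rw [integral_const_mul, mul_assoc]
          _ ≤ ε * deriv (cutoff n) t := by
              rcases lt_or_ge t δ with h | h
              · rw [mul_comm]
                refine mul_le_mul_of_nonneg_right (le_of_lt ?_) hd0
                exact hu' ⟨hδu (by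
                  rw [Metric.mem_ball, Real.dist_eq, sub_zero, abs_of_pos ht0.1]; exact h), htT⟩
              · rw [deriv_cutoff_of_ge (hnδ.le.trans h)]; simp
    _ ≤ ∫ t in Set.Ioi 0, ε * deriv (cutoff n) t :=
        setIntegral_mono_set hd (ae_of_all _ fun t => mul_nonneg hε.le deriv_cutoff_nonneg)
          (LE.le.eventuallyLE hsub)
    _ = ε := by rw [integral_const_mul, integral_deriv_cutoff, mul_one]

/-- The derivative of the cutoff has total mass `1` and the other factors are at most `1`; the bound
is uniform in `n` and serves as the majorant for dominated convergence in time. -/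
lemma abs_integral_boundaryWeight_le {s : ℝ → ℝ × ℝ} {B t : ℝ} {n : ℕ} (ht : 0 < t)
    (hB : 0 ≤ B) (hs : ∀ᵐ x ∂(volume.restrict (Set.Ioi (0 : ℝ))),
      |meanFlux κ γ (trunc M p) (s x)| ≤ B) :
    |∫ x in Set.Ioi 0, meanFlux κ γ (trunc M p) (s x) * boundaryWeight Λ τ R n (t, x)| ≤ B := by
  have hd : Integrable (fun t => B * deriv (cutoff n) t) (volume.restrict (Set.Ioi 0)) :=
    (integrable_deriv_cutoff.const_mul B).integrableOn
  have := norm_integral_le_of_norm_le (f := fun x => meanFlux κ γ (trunc M p) (s x) *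
    boundaryWeight Λ τ R n (t, x)) hd (by
    filter_upwards [hs] with x hx
    have hd0 := deriv_cutoff_nonneg (n := n) (x := x)
    have e1 : |boundaryWeight Λ τ R n (t, x)| ≤ deriv (cutoff n) x := by
      unfold boundaryWeight
      have := weight_nonneg' (Λ := Λ) (τ := τ) (R := R) (t, x)
      have := cutoff_nonneg (n := n) (x := t)
      rw [abs_of_nonneg (by positivity)]
      calc _ ≤ 1 * 1 * deriv (cutoff n) x := by
            gcongr
            · exact cutoff_le_one
            · exact weight_le_one ht.le
        _ = _ := by ring
    rw [norm_mul]
    exact mul_le_mul hx e1 (abs_nonneg _) hB)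
  rwa [integral_const_mul, integral_deriv_cutoff, mul_one] at this

/-- The junction does not produce entropy. -/
lemma eventually_sum_integral_boundaryWeight_le (hκ : 0 < κ) (h₁ : 1 < γ) (h₃ : γ < 3)
    (hM : 0 ≤ M) (hC : 0 ≤ C) (hp : IsAdmissibleExponent γ p) (hΛ : 0 ≤ Λ) {d : ℕ}
    {A : Fin d → ℝ} (hA : ∀ k, 0 < A k) {s : Fin d → ℝ → ℝ → ℝ × ℝ}
    (hm : ∀ k, AEStronglyMeasurable (fun z : ℝ × ℝ => s k z.1 z.2) (volume.restrict (pipe τ)))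
    (hb : ∀ k, ∀ᵐ z ∂(volume.restrict (pipe τ)), IsBoundedState C (s k z.1 z.2))
    (hj : ∀ᵐ t ∂(volume.restrict (openTimes τ)), ∃ b : Fin d → ℝ × ℝ,
      (∀ k, IsRightTrace (s k t) (b k)) ∧
      (∃ ρstar : ℝ, 0 ≤ ρstar ∧ ∀ k, b k ∈ boundaryRiemannSet κ γ (ρstar, 0)) ∧
      ∑ k, A k * ((b k).1 * (b k).2) = 0) {ε : ℝ} (hε : 0 < ε) :
    ∀ᶠ n in atTop, ∑ k, A k * ∫ z in pipe τ, meanFlux κ γ (trunc M p) (s k z.1 z.2) *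
      boundaryWeight Λ τ R n z ≤ ε := by
  obtain ⟨B, hB0, hB⟩ := exists_abs_le (κ := κ) (M := M) (p := p) h₁ h₃ C
  have hmG := fun k =>
    (continuous_meanFlux (κ := κ) (M := M) (p := p) h₁ h₃).comp_aestronglyMeasurable (hm k)
  have hint : ∀ k n, Integrable (fun z : ℝ × ℝ => meanFlux κ γ (trunc M p) (s k z.1 z.2) *
      boundaryWeight Λ τ R n z) (volume.restrict (pipe τ)) := fun k n =>
    (integrable_mul_weights hΛ (hmG k) ((hb k).mono fun z hz => (hB _ hz).2)).2.2.1
  rw [pipe_eq_prod] at hint hb hmG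
  set F : ℕ → ℝ → ℝ := fun n t => ∑ k, A k * ∫ x in Set.Ioi 0,
    meanFlux κ γ (trunc M p) (s k t x) * boundaryWeight Λ τ R n (t, x) with hF
  have hFint : ∀ n, Integrable (F n) (volume.restrict (openTimes τ)) := fun n =>
    integrable_finsetSum _ fun k _ => (hint k n).integral_prod_left.const_mul (A k)
  have hsum : ∀ n, ∑ k, A k * ∫ z in pipe τ, meanFlux κ γ (trunc M p) (s k z.1 z.2) *
      boundaryWeight Λ τ R n z = ∫ t in openTimes τ, F n t := by
    intro n
    rw [hF, integral_finsetSum _ fun k _ => (hint k n).integral_prod_left.const_mul (A k)]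
    refine Finset.sum_congr rfl fun k _ => ?_
    rw [integral_const_mul, pipe_eq_prod, integral_prod _ (hint k n)]
  have hae : ∀ᵐ t ∂(volume.restrict (openTimes τ)), ∀ k,
      ∀ᵐ x ∂(volume.restrict (Set.Ioi (0 : ℝ))), IsBoundedState C (s k t x) :=
    ae_all_iff.2 fun k => Measure.ae_ae_of_ae_prod (hb k)
  have hmeas : ∀ᵐ t ∂(volume.restrict (openTimes τ)), ∀ k,
      AEStronglyMeasurable (fun x => meanFlux κ γ (trunc M p) (s k t x))
        (volume.restrict (Set.Ioi (0 : ℝ))) :=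
    ae_all_iff.2 fun k => (hmG k).prodMk_left
  -- For a.e. `t` the limit of the spatial sum is only known to be nonpositive. Its positive part
  -- tends to zero, which is all that an upper bound requires.
  have hlim : Tendsto (fun n => ∫ t in openTimes τ, max (F n t) 0) atTop
      (𝓝 (∫ t in openTimes (τ : EReal), (0 : ℝ))) := by
    have hfin : IsFiniteMeasure (volume.restrict (openTimes (τ : EReal))) := by
      rw [openTimes_coe]; infer_instance
    refine tendsto_integral_of_dominated_convergence (fun _ => ∑ k, A k * B)
      (fun n => ((hFint n).sup (integrable_zero _ _ _)).1) (integrable_const _) (fun n => ?_) ?_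
    · filter_upwards [hae, ae_restrict_mem (measurableSet_openTimes τ)] with t ht ht0
      have h1 : F n t ≤ ∑ k, A k * B := by
        refine Finset.sum_le_sum fun k _ => mul_le_mul_of_nonneg_left ?_ (hA k).le
        exact (le_abs_self _).trans (abs_integral_boundaryWeight_le ht0.1 hB0
          ((ht k).mono fun x hx => (hB _ hx).2))
      rw [Real.norm_eq_abs, abs_of_nonneg (le_max_right _ _)]
      exact max_le h1 (Finset.sum_nonneg fun k _ => mul_nonneg (hA k).le hB0)
    · filter_upwards [hae, hmeas, hj, ae_restrict_mem (measurableSet_openTimes τ)] with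
        t ht htm ⟨b, hb1, ⟨ρ, hρ, hb2⟩, hb3⟩ ht0
      set W := weight Λ τ R (t, 0) with hW
      have h1 : Tendsto (fun n => ∑ k, A k * ∫ x in Set.Ioi 0,
          (meanFlux κ γ (trunc M p) (s k t x) * weight Λ τ R (t, x)) * deriv (cutoff n) x) atTop
          (𝓝 (∑ k, A k * (meanFlux κ γ (trunc M p) (b k) * W))) := by
        refine tendsto_finsetSum _ fun k _ => Tendsto.const_mul _ ?_
        have hc : Continuous fun x : ℝ => weight Λ τ R (t, x) :=
          continuous_weight'.comp (by fun_prop)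
        refine tendsto_integral_mul_deriv_cutoff ((htm k).mul hc.aestronglyMeasurable) ?_
        refine ((hb1 k).tendsto_meanFlux hκ h₁ h₃ hM hC (ht k)).mul ?_
        exact (hc.tendsto 0).mono_left (inf_le_left.trans nhdsWithin_le_nhds)
      have h2 : ∑ k, A k * (meanFlux κ γ (trunc M p) (b k) * W) ≤ 0 := by
        have : ∑ k, A k * meanFlux κ γ (trunc M p) (b k) ≤ 0 := by
          calc _ ≤ ∑ k, A k * (fluxRatio γ M p (width κ γ ρ) * ((b k).1 * (b k).2)) :=
                Finset.sum_le_sum fun k _ => mul_le_mul_of_nonneg_left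
                  (meanFlux_le_of_mem_boundaryRiemannSet hκ h₁ h₃ hM hp hρ (hb2 k)) (hA k).le
            _ = fluxRatio γ M p (width κ γ ρ) * ∑ k, A k * ((b k).1 * (b k).2) := by
                rw [Finset.mul_sum]
                exact Finset.sum_congr rfl fun k _ => by ring
            _ = 0 := by rw [hb3, mul_zero]
        simp_rw [← mul_assoc]
        rw [← Finset.sum_mul]
        exact mul_nonpos_of_nonpos_of_nonneg this (weight_nonneg' _)
      have h3 := h1.max (tendsto_const_nhds (x := (0 : ℝ)))
      rw [max_eq_right h2] at h3
      refine squeeze_zero (fun n => le_max_right _ _) (fun n => ?_) h3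
      have h4 : F n t = cutoff n t * ∑ k, A k * ∫ x in Set.Ioi 0,
          (meanFlux κ γ (trunc M p) (s k t x) * weight Λ τ R (t, x)) * deriv (cutoff n) x := by
        rw [hF, Finset.mul_sum]
        refine Finset.sum_congr rfl fun k _ => ?_
        rw [mul_left_comm, ← integral_const_mul (cutoff n t)]
        congr 2
        ext x
        unfold boundaryWeight
        ring
      rw [h4]
      refine max_le ?_ (le_max_right _ _)
      refine (mul_le_mul_of_nonneg_left (le_max_left _ 0) cutoff_nonneg).trans ?_
      exact mul_le_of_le_one_left (le_max_right _ _) cutoff_le_one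
  rw [integral_zero] at hlim
  filter_upwards [hlim (Iio_mem_nhds hε)] with n hn
  rw [hsum]
  refine le_trans ?_ (le_of_lt hn)
  exact integral_mono (hFint n) ((hFint n).sup (integrable_zero _ _ _)) fun t => le_max_left _ _

end Cauchy

/-! ### Vanishing of the entropy and exhaustion of the time interval. -/

section MaximumPrinciple

variable {κ γ M τ : ℝ} {T : EReal}

/-- A common bound for a solution and its initial data. -/
lemma IsCauchySolution.exists_isBoundedState (hκ : 0 < κ) (h₁ : 1 < γ) (hM : 0 ≤ M) {d : ℕ}
    {A : Fin d → ℝ} {U₀ : Fin d → ℝ × ℝ} {i : Fin d → ℝ → ℝ × ℝ} {s : Fin d → ℝ → ℝ → ℝ × ℝ}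
    (hs : IsCauchySolution κ γ A T U₀ i s) (hτ : (τ : EReal) < T) :
    ∃ C, 0 ≤ C ∧ (∀ s, InBounds κ γ M s → IsBoundedState C s) ∧
      ∀ k, ∀ᵐ z ∂(volume.restrict (pipe τ)), IsBoundedState C (s k z.1 z.2) := by
  choose c hc using fun k => (hs.solution k).bounded τ hτ
  have h0 : 0 ≤ M + (M / aConst κ γ) ^ (1 / theta γ) := by
    have := aConst_pos hκ h₁
    positivity
  have h1 : ∀ k, c k ≤ ∑ k, |c k| := fun k => (le_abs_self _).trans
    (Finset.single_le_sum (f := fun k => |c k|) (fun k _ => abs_nonneg (c k)) (Finset.mem_univ k))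
  have h2 : 0 ≤ ∑ k, |c k| := Finset.sum_nonneg fun k _ => abs_nonneg (c k)
  refine ⟨M + (M / aConst κ γ) ^ (1 / theta γ) + ∑ k, |c k|, by linarith,
    fun s hs => (hs.isBoundedState hκ h₁).mono (by linarith), fun k => ?_⟩
  filter_upwards [hc k, ae_mono (Measure.restrict_mono_set _ (pipe_mono hτ.le))
    (hs.solution k).mem_stateSpace] with z hz hz'
  have h3 := h1 k
  exact ⟨stateSpace_nonneg hz', (le_abs_self _).trans (hz.1.trans (by linarith)),
    hz.2.trans (by linarith)⟩

/-- The maximum principle on a finite time interval. -/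
lemma IsCauchySolution.bounds_strip (hκ : 0 < κ) (h₁ : 1 < γ) (h₃ : γ < 3) (hM : 0 ≤ M) {d : ℕ}
    {A : Fin d → ℝ} (hA : ∀ k, 0 < A k) {U₀ : Fin d → ℝ × ℝ} {i : Fin d → ℝ → ℝ × ℝ}
    {s : Fin d → ℝ → ℝ → ℝ × ℝ} (hT : 0 < T) (hs : IsCauchySolution κ γ A T U₀ i s)
    (hi : ∀ k, ∀ᵐ x ∂(volume.restrict (Set.Ioi (0 : ℝ))), InBounds κ γ M (i k x))
    (hτ : (τ : EReal) < T) (k : Fin d) :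
    ∀ᵐ z ∂(volume.restrict (pipe τ)), InBounds κ γ M (s k z.1 z.2) := by
  obtain ⟨p, hp⟩ := exists_isAdmissibleExponent h₁
  have hp0 : p ≠ 0 := by have := hp.two_le; omega
  obtain ⟨C, hC, hCb, hb⟩ := hs.exists_isBoundedState hκ h₁ hM hτ
  have hΛ : 0 ≤ C + width κ γ C := add_nonneg hC (width_nonneg hκ h₁ hC)
  have hsub : pipe τ ⊆ pipe T := pipe_mono hτ.le
  have hm : ∀ k, AEStronglyMeasurable (fun z : ℝ × ℝ => s k z.1 z.2)
      (volume.restrict (pipe τ)) := fun k =>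
    (hs.solution k).measurable.mono_measure (Measure.restrict_mono_set _ hsub)
  have h0 : (0 : ℝ) ∈ closedTimes T := ⟨le_rfl, by simpa using hT.le⟩
  have hinit : ∀ k, ∀ᵐ x ∂(volume.restrict (Set.Ioi (0 : ℝ))),
      IsBoundedState C (s k 0 x) ∧ InBounds κ γ M (s k 0 x) := by
    intro k
    filter_upwards [hi k, hs.initial k] with x h1 h2
    rw [h2]
    exact ⟨hCb _ h1, h1⟩
  have hint : ∀ k, ∀ t ∈ closedTimes T, Integrable
      (fun x => ‖conserved (s k t x) - conserved (s k 0 x)‖) (volume.restrict (Set.Ioi 0)) := by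
    intro k t ht
    have := ((hs.integrable k t ht).sub (hs.integrable k 0 h0)).norm
    simpa using this
  have hj := ae_mono (Measure.restrict_mono_set _ (openTimes_mono hτ.le)) hs.junction
  have hmE := fun k =>
    (continuous_meanEta (κ := κ) (M := M) (p := p) h₁ h₃).comp_aestronglyMeasurable (hm k)
  obtain ⟨B, -, hB⟩ := exists_abs_le (κ := κ) (M := M) (p := p) h₁ h₃ C
  have hE : ∀ (R m : ℕ) k, Integrable (fun z : ℝ × ℝ => meanEta κ γ (trunc M p) (s k z.1 z.2) *
      testFn (C + width κ γ C) τ R m z) (volume.restrict (pipe τ)) := fun R m k =>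
    (integrable_mul_weights hΛ (hmE k) ((hb k).mono fun z hz => (hB _ hz).1)).1
  have hE0 : ∀ (R m : ℕ) k, 0 ≤ᵐ[volume.restrict (pipe τ)] fun z : ℝ × ℝ =>
      meanEta κ γ (trunc M p) (s k z.1 z.2) * testFn (C + width κ γ C) τ R m z := by
    intro R m k
    filter_upwards [hb k] with z hz
    exact mul_nonneg (meanEta_nonneg h₁ h₃ hz.1) (testFn_nonneg z)
  -- The index `m` of the test function stays fixed while the index `n` in the initial and boundary
  -- terms grows.
  have hsum : ∀ R m : ℕ, ∑ k, A k * ∫ z in pipe τ, meanEta κ γ (trunc M p) (s k z.1 z.2) *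
      testFn (C + width κ γ C) τ R m z ≤ 0 := by
    intro R m
    refine le_of_forall_pos_le_add fun ε hε => ?_
    set D := ∑ k, A k with hD
    have hD0 : 0 ≤ D := Finset.sum_nonneg fun k _ => (hA k).le
    -- The initial errors, weighted by the cross-sections, contribute `D` times this amount and the
    -- junction contributes it once more.
    have e1 : 0 < ε / (D + 1) := by positivity
    obtain ⟨n, hn1, hn2, hnm⟩ := ((eventually_all.2 fun k =>
      eventually_integral_initialWeight_le (R := R) hκ h₁ h₃ hM hC hp0 hΛ hτ (hm k) (hb k)
        (hinit k) (hint k) (hs.continuous k 0 h0) e1).and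
      ((eventually_sum_integral_boundaryWeight_le (R := R) hκ h₁ h₃ hM hC hp hΛ hA hm hb hj
        e1).and (eventually_ge_atTop m))).exists
    have e2 : ∀ k, A k * ∫ z in pipe τ, meanEta κ γ (trunc M p) (s k z.1 z.2) *
        testFn (C + width κ γ C) τ R m z ≤ A k * (ε / (D + 1)) +
        A k * ∫ z in pipe τ, meanFlux κ γ (trunc M p) (s k z.1 z.2) *
          boundaryWeight (C + width κ γ C) τ R n z := by
      intro k
      rw [← mul_add]
      refine mul_le_mul_of_nonneg_left ?_ (hA k).le
      refine le_trans (integral_mono_ae (hE R m k) (hE R n k) ?_)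
        (((hs.solution k).integral_testFn_le hκ h₁ h₃ hC hτ (hb k)).trans
          (by linarith [hn1 k]))
      filter_upwards [hb k, ae_restrict_mem (measurableSet_pipe τ)] with z hz hz0
      refine mul_le_mul_of_nonneg_left ?_ (meanEta_nonneg h₁ h₃ hz.1)
      unfold testFn
      have w0 := weight_nonneg' (Λ := C + width κ γ C) (τ := τ) (R := R) z
      have c1 := cutoff_mono_index hnm (le_of_lt hz0.1.1)
      have c2 := cutoff_mono_index hnm (le_of_lt hz0.2)
      exact mul_le_mul (mul_le_mul_of_nonneg_right c1 w0) c2 cutoff_nonneg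
        (mul_nonneg cutoff_nonneg w0)
    refine (Finset.sum_le_sum fun k _ => e2 k).trans ?_
    rw [Finset.sum_add_distrib, ← Finset.sum_mul, ← hD, zero_add]
    refine (add_le_add le_rfl hn2).trans (le_of_eq ?_)
    field_simp
  -- Natural numbers `R` and `m` keep the union of exceptional sets countable.
  have hzero : ∀ᵐ z ∂(volume.restrict (pipe τ)), ∀ R m : ℕ,
      meanEta κ γ (trunc M p) (s k z.1 z.2) * testFn (C + width κ γ C) τ R m z = 0 := by
    refine ae_all_iff.2 fun R => ae_all_iff.2 fun m => ?_
    refine (integral_eq_zero_iff_of_nonneg_ae (hE0 R m k) (hE R m k)).1 (le_antisymm ?_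
      (integral_nonneg_of_ae (hE0 R m k)))
    have := (Finset.single_le_sum (f := fun k => A k * ∫ z in pipe τ,
      meanEta κ γ (trunc M p) (s k z.1 z.2) * testFn (C + width κ γ C) τ R m z)
      (fun k _ => mul_nonneg (hA k).le (integral_nonneg_of_ae (hE0 R m k)))
      (Finset.mem_univ k)).trans (hsum R m)
    exact nonpos_of_mul_nonpos_right this (hA k)
  filter_upwards [hzero, ae_restrict_mem (measurableSet_pipe τ),
    ae_mono (Measure.restrict_mono_set _ hsub) (hs.solution k).mem_stateSpace] with z hz hz0 hzs
  refine inBounds_of_meanEta_eq_zero (p := p) h₁ h₃ hM hzs ?_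
  obtain ⟨m₁, hm₁⟩ := exists_cutoff_pos hz0.1.1
  obtain ⟨m₂, hm₂⟩ := exists_cutoff_pos hz0.2
  obtain ⟨R, hR⟩ := exists_nat_gt (z.2 + (C + width κ γ C) * z.1)
  have c1 := hm₁.trans_le (cutoff_mono_index (le_max_left m₁ m₂) (le_of_lt hz0.1.1))
  have c2 := hm₂.trans_le (cutoff_mono_index (le_max_right m₁ m₂) (le_of_lt hz0.2))
  have hzτ : z.1 < τ := by exact_mod_cast hz0.1.2
  exact (mul_eq_zero.1 (hz R (max m₁ m₂))).resolve_right
    (mul_pos (mul_pos c1 (weight_pos hzτ hR)) c2).ne'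

/-- Boundedness is available only up to times `τ < T`. The strips with rational end time exhaust
`(0, T)`, also for `T = ∞`, and are countably many. -/
theorem IsCauchySolution.bounds (hκ : 0 < κ) (h₁ : 1 < γ) (h₃ : γ < 3) {d : ℕ}
    {A : Fin d → ℝ} (hA : ∀ k, 0 < A k) {U₀ : Fin d → ℝ × ℝ} {i : Fin d → ℝ → ℝ × ℝ}
    {s : Fin d → ℝ → ℝ → ℝ × ℝ} (hT : 0 < T) (hs : IsCauchySolution κ γ A T U₀ i s)
    (hi : ∀ k, ∀ᵐ x ∂(volume.restrict (Set.Ioi (0 : ℝ))),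
      -M ≤ omega1 κ γ (i k x) ∧ omega1 κ γ (i k x) < omega2 κ γ (i k x) ∧
      omega2 κ γ (i k x) ≤ M) (k : Fin d) :
    ∀ᵐ z ∂(volume.restrict (pipe T)), InBounds κ γ M (s k z.1 z.2) := by
  have hM : 0 ≤ M := by
    have hne : (ae (volume.restrict (Set.Ioi (0 : ℝ)))).NeBot := by
      rw [ae_neBot]
      simp
    obtain ⟨x, hx⟩ := (hi k).exists
    linarith
  have hi' : ∀ k, ∀ᵐ x ∂(volume.restrict (Set.Ioi (0 : ℝ))), InBounds κ γ M (i k x) := by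
    intro k
    filter_upwards [hi k, hs.initial_mem k] with x hx hx'
    exact ⟨hx', hx.1, hx.2.2⟩
  have h : ∀ᵐ z : ℝ × ℝ, ∀ q : ℚ, ((q : ℝ) : EReal) < T → z ∈ pipe (q : ℝ) →
      InBounds κ γ M (s k z.1 z.2) := by
    refine ae_all_iff.2 fun q => ?_
    by_cases hq : ((q : ℝ) : EReal) < T
    · filter_upwards [(ae_restrict_iff' (measurableSet_pipe _)).1
        (hs.bounds_strip hκ h₁ h₃ hM hA hT hi' hq k)] with z hz _ using hz
    · exact ae_of_all _ fun z hz => absurd hz hq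
  rw [ae_restrict_iff' (measurableSet_pipe T)]
  filter_upwards [h] with z hz hzT
  obtain ⟨q, hq1, hq2⟩ := EReal.lt_iff_exists_rat_btwn.1 hzT.1.2
  exact hz q hq2 ⟨⟨hzT.1.1, hq1⟩, hzT.2⟩

end MaximumPrinciple

end IsentropicNetwork

theorem mainTheorem6 (κ γ : ℝ) (hκ : 0 < κ) (hγ₁ : 1 < γ) (hγ₃ : γ < 3)
    {d : ℕ} (A : Fin d → ℝ) (hA : ∀ k, 0 < A k) (ωM : ℝ) :
    (∀ (i : Fin d → ℝ × ℝ) (s : Fin d → ℝ → ℝ → ℝ × ℝ),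
      IsentropicNetwork.IsRiemannSolution κ γ A i s →
      (∀ k, -ωM ≤ IsentropicNetwork.omega1 κ γ (i k) ∧
        IsentropicNetwork.omega1 κ γ (i k) < IsentropicNetwork.omega2 κ γ (i k) ∧
        IsentropicNetwork.omega2 κ γ (i k) ≤ ωM) →
      ∀ k, ∀ᵐ z ∂(volume.restrict (IsentropicNetwork.pipe ⊤)),
        -ωM ≤ IsentropicNetwork.omega1 κ γ (s k z.1 z.2) ∧
        IsentropicNetwork.omega1 κ γ (s k z.1 z.2) ≤
          IsentropicNetwork.omega2 κ γ (s k z.1 z.2) ∧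
        (s k z.1 z.2 ≠ (0, 0) → IsentropicNetwork.omega1 κ γ (s k z.1 z.2) <
          IsentropicNetwork.omega2 κ γ (s k z.1 z.2)) ∧
        IsentropicNetwork.omega2 κ γ (s k z.1 z.2) ≤ ωM) ∧
    (∀ (T : EReal) (U₀ : Fin d → ℝ × ℝ) (i : Fin d → ℝ → ℝ × ℝ)
      (s : Fin d → ℝ → ℝ → ℝ × ℝ), 0 < T →
      IsentropicNetwork.IsCauchySolution κ γ A T U₀ i s →
      (∀ k, ∀ᵐ x ∂(volume.restrict (Set.Ioi (0 : ℝ))),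
        -ωM ≤ IsentropicNetwork.omega1 κ γ (i k x) ∧
        IsentropicNetwork.omega1 κ γ (i k x) < IsentropicNetwork.omega2 κ γ (i k x) ∧
        IsentropicNetwork.omega2 κ γ (i k x) ≤ ωM) →
      ∀ k, ∀ᵐ z ∂(volume.restrict (IsentropicNetwork.pipe T)),
        -ωM ≤ IsentropicNetwork.omega1 κ γ (s k z.1 z.2) ∧
        IsentropicNetwork.omega1 κ γ (s k z.1 z.2) ≤
          IsentropicNetwork.omega2 κ γ (s k z.1 z.2) ∧
        (s k z.1 z.2 ≠ (0, 0) → IsentropicNetwork.omega1 κ γ (s k z.1 z.2) <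
          IsentropicNetwork.omega2 κ γ (s k z.1 z.2)) ∧
        IsentropicNetwork.omega2 κ γ (s k z.1 z.2) ≤ ωM) := by
  refine ⟨fun i s hs hi k => ?_, fun T U₀ i s hT hs hi k => ?_⟩
  · exact (IsentropicNetwork.riemann_bounds hκ hγ₁ hγ₃ hA hs hi k).mono
      fun z hz => hz.conclusion hκ hγ₁
  · exact (hs.bounds hκ hγ₁ hγ₃ hA hT hi k).mono fun z hz => hz.conclusion hκ hγ₁
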